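/- **Setting.** Let $\mathsf{k}$ and $\mathfrak{h}$ be complex Hilbert spaces. For an interval $A\subseteq\mathbb{R}_+$ let $\mathcal{F}_A$ be the Boson Fock space over $L^2(A;\mathsf{k})$, with exponential vectors $\varepsilon(f)$, which are total and satisfy $\langle\varepsilon(f),\varepsilon(g)\rangle=\exp\langle f,g\rangle$. Write $\mathcal{F}=\mathcal{F}_{\mathbb{R}_+}$, $\mathcal{F}_{t)}=\mathcal{F}_{[0,t)}$, $\mathcal{F}_{[t}=\mathcal{F}_{[t,\infty)}$, and identify $\mathcal{F}\cong\mathcal{F}_{t)}\otimes\mathcal{F}_{[t}$ by $\varepsilon(f)\leftrightarrow\varepsilon(f|_{[0,t)})\otimes\varepsilon(f|_{[t,\infty)})$. Let $I_{t)}$ and $I_{[t}$ be the identity operators on $\mathcal{F}_{t)}$ and $\mathcal{F}_{[t}$, and let $\Gamma_t:\mathcal{F}\to\mathcal{F}_{[t}$ be the unitary operator with $\Gamma_t\varepsilon(f)=\varepsilon(f(\cdot-t))$. The CCR flow is $\sigma_t(X)=I_{t)}\otimes\Gamma_tX\Gamma_t^*$ for $t\in\mathbb{R}_+$, extended by ampliation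 to $B(\mathfrak{h}\otimes\mathcal{F})$; further, $\sigma_\infty(X):=I$ for all $X$. **Stop times.** A *quantum stop time* is a map $S$ from the Borel subsets of $[0,\infty]$ to the orthogonal projections on $\mathcal{F}$ such that $A\mapsto\langle x,S(A)y\rangle$ is a complex measure for all $x,y\in\mathcal{F}$, $S([0,\infty])=I$, $S(\{0\})\in\mathbb{C}I$ and $S([0,t])\in B(\mathcal{F}_{t)})\otimes I_{[t}$ for all $t\in(0,\infty)$. It is *finite* if $S(\{\infty\})=0$. For $t\in\mathbb{R}_+$ the quantum stop time $S+t$ is the image of the spectral measure $S$ under $s\mapsto s+t$, so that $(S+t)([0,u])$ equals $0$ if $u<t$ and $S([0,u-t])$ if $u\ge t$. Stop times act on $\mathfrak{h}\otimes\mathcal{F}$ by ampliation. **Cocycles.** Let $\mathcal{A}\subseteq B(\mathfrak{h})$ be a von Neumann algebra, let $p\in B(\mathsf{k})$ be an orthogonal projection, and let $P_{[t}\in B(\mathcal{F}_{[t})$ be its second quantisation, $P_{[t}\varepsilon(f)=\varepsilon(pf)$, where $p$ acts pointwise. A *$p$-adapted process* is a family $V=(V_t)_{t\in\mathbb{R}_+}$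 in $\mathcal{A}\,\overline{\otimes}\,B(\mathcal{F})$ (where $\overline\otimes$ is the ultraweak tensor product) with $V_t=V_{t)}\otimes P_{[t}$ and $V_{t)}\in\mathcal{A}\,\overline{\otimes}\,B(\mathcal{F}_{t)})$ for all $t$; put $\widehat V_t=V_{t)}\otimes I_{[t}$. It is a *left Markovian cocycle* if $V_{s+t}=\widehat V_s\,\sigma_s(V_t)$ for all $s,t\in\mathbb{R}_+$, and *isometric* if $V_{t)}^*V_{t)}=I$ for all $t\in\mathbb{R}_+$. **Stopping.** For $t\in(0,\infty]$, let $\pi=\{0=\pi_0<\dots<\pi_{n+1}=t\}$ run through the finite partitions of $[0,t]$, directed by refinement. For a finite quantum stop time $S$, a family $W=(W_t)_{t\in\mathbb{R}_+}$ in $B(\mathfrak{h}\otimes\mathcal{F})$ and $X\in B(\mathfrak{h}\otimes\mathcal{F})$ set, when the limits exist in the strong operator topology, $$W_{S,t}=\lim_\pi\sum_{j=1}^{n+1}W_{\pi_j}S\bigl((\pi_{j-1},\pi_j]\bigr)\quad(0<t<\infty),\qquad W_S=\lim_{t\to\infty}W_{S,t},$$ $$\sigma_S(X)=\lim_\pi\sum_{j=1}^{n+1}\sigma_{\pi_j}(X)\,S\bigl((\pi_{j-1},\pi_j]\bigr)\quad(t=\infty).$$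 **Theorem.** Let $S$ be a finite quantum stop time with $S(\{0\})=0$ and let $V$ be an isometric, strongly continuous $p$-adapted left Markovian cocycle. Then the limits defining $\widehat V_S$, $V_{S+t}$ and $\sigma_S(V_t)$ exist, and $$V_{S+t}=\widehat V_S\,\sigma_S(V_t)\qquad\text{for all }t\in\mathbb{R}_+.$$ -/

import Mathlib

open MeasureTheory Filter Topology Set
open scoped NNReal ENNReal TensorProduct InnerProductSpace ComplexOrder

noncomputable section

namespace QStop

section Hilbert

theorem denseRange_of_total {ι E : Type*} [NormedAddCommGroup E] [InnerProductSpace ℂ E]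
    (c : ι → E) (hc : (Submodule.span ℂ (range c)).topologicalClosure = ⊤) :
    DenseRange (Finsupp.linearCombination ℂ c) := by
  rw [DenseRange, ← LinearMap.coe_range, Finsupp.range_linearCombination]
  exact Submodule.dense_iff_topologicalClosure_eq_top.2 hc

theorem exists_unitary {ι E E' : Type*} [NormedAddCommGroup E] [InnerProductSpace ℂ E]
    [CompleteSpace E] [NormedAddCommGroup E'] [InnerProductSpace ℂ E'] [CompleteSpace E']
    (a : ι → E) (b : ι → E') (hab : ∀ i j, ⟪a i, a j⟫_ℂ = ⟪b i, b j⟫_ℂ)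
    (ha : (Submodule.span ℂ (range a)).topologicalClosure = ⊤)
    (hb : (Submodule.span ℂ (range b)).topologicalClosure = ⊤) :
    ∃ U : E ≃ₗᵢ[ℂ] E', ∀ i, U (a i) = b i := by
  have hn : ∀ x : ι →₀ ℂ, ‖Finsupp.linearCombination ℂ b x‖ = ‖Finsupp.linearCombination ℂ a x‖ := by
    intro x
    rw [← sq_eq_sq₀ (norm_nonneg _) (norm_nonneg _)]
    have : ⟪Finsupp.linearCombination ℂ b x, Finsupp.linearCombination ℂ b x⟫_ℂ =
        ⟪Finsupp.linearCombination ℂ a x, Finsupp.linearCombination ℂ a x⟫_ℂ := by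
      simp only [Finsupp.linearCombination_apply, Finsupp.sum, sum_inner, inner_sum,
        inner_smul_left, inner_smul_right, hab]
    rw [inner_self_eq_norm_sq_to_K, inner_self_eq_norm_sq_to_K] at this
    exact_mod_cast this
  refine ⟨(LinearEquiv.refl ℂ (ι →₀ ℂ)).extendOfIsometry _ _ (denseRange_of_total a ha)
    (denseRange_of_total b hb) hn, ?_⟩
  intro i
  have := (LinearEquiv.refl ℂ (ι →₀ ℂ)).extendOfIsometry_eq _ _ (denseRange_of_total a ha)
    (denseRange_of_total b hb) hn
    (Finsupp.single i 1)
  simpa using this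

/-- The Hilbert-space tensor product: the completion of the algebraic tensor product for the
inner product `⟪a ⊗ b, c ⊗ d⟫ = ⟪a, c⟫ ⟪b, d⟫`. -/
abbrev HilbertTensor (A B : Type*) [NormedAddCommGroup A] [InnerProductSpace ℂ A]
    [NormedAddCommGroup B] [InnerProductSpace ℂ B] : Type _ :=
  UniformSpace.Completion (A ⊗[ℂ] B)

variable {A B A' B' : Type*} [NormedAddCommGroup A] [InnerProductSpace ℂ A]
  [NormedAddCommGroup B] [InnerProductSpace ℂ B]
  [NormedAddCommGroup A'] [InnerProductSpace ℂ A']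
  [NormedAddCommGroup B'] [InnerProductSpace ℂ B']

/-- The elementary tensor `a ⊗ b`. -/
def tmul (a : A) (b : B) : HilbertTensor A B := ((a ⊗ₜ[ℂ] b : A ⊗[ℂ] B) : HilbertTensor A B)

/-- The operator `X ⊗ Y` on a Hilbert-space tensor product: the unique bounded operator such that
`(X ⊗ Y) (a ⊗ b) = X a ⊗ Y b`. -/
def opTensor (X : A →L[ℂ] A') (Y : B →L[ℂ] B') : HilbertTensor A B →L[ℂ] HilbertTensor A' B' :=
  (TensorProduct.mapL X Y).completion

theorem inner_tmul (a a' : A) (b b' : B) :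
    ⟪tmul a b, tmul a' b'⟫_ℂ = ⟪a, a'⟫_ℂ * ⟪b, b'⟫_ℂ := by
  simp [tmul, UniformSpace.Completion.inner_coe]

theorem opTensor_tmul (X : A →L[ℂ] A') (Y : B →L[ℂ] B') (a : A) (b : B) :
    opTensor X Y (tmul a b) = tmul (X a) (Y b) := by
  simp [tmul, opTensor, ContinuousLinearMap.completion_apply_coe]

theorem tmul_total {ι κ : Type*} (a : ι → A) (b : κ → B)
    (ha : (Submodule.span ℂ (range a)).topologicalClosure = ⊤)
    (hb : (Submodule.span ℂ (range b)).topologicalClosure = ⊤) :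
    (Submodule.span ℂ (range fun i : ι × κ => tmul (a i.1) (b i.2))).topologicalClosure = ⊤ := by
  set T := (Submodule.span ℂ (range fun i : ι × κ => tmul (a i.1) (b i.2))).topologicalClosure
    with hT
  have hTc : IsClosed (T : Set (HilbertTensor A B)) := Submodule.isClosed_topologicalClosure _
  let L : A →L[ℂ] B →L[ℂ] HilbertTensor A B :=
    (ContinuousLinearMap.compL ℂ B (A ⊗[ℂ] B) (HilbertTensor A B)
      UniformSpace.Completion.toComplL).comp (TensorProduct.mkL ℂ A B)
  have hL : ∀ x y, L x y = tmul x y := fun x y => rfl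
  have h1 : ∀ i y, tmul (a i) y ∈ T := by
    intro i y
    have : (Submodule.span ℂ (range b)).topologicalClosure ≤ T.comap (L (a i)).toLinearMap := by
      refine Submodule.topologicalClosure_minimal _ ?_ (hTc.preimage (L (a i)).continuous)
      rw [Submodule.span_le]
      rintro _ ⟨j, rfl⟩
      exact Submodule.le_topologicalClosure _ (Submodule.subset_span ⟨(i, j), rfl⟩)
    rw [hb] at this
    exact this (Submodule.mem_top (x := y))
  have h2 : ∀ x y, tmul x y ∈ T := by
    intro x y
    have : (Submodule.span ℂ (range a)).topologicalClosure ≤ T.comap (L.flip y).toLinearMap := by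
      refine Submodule.topologicalClosure_minimal _ ?_ (hTc.preimage (L.flip y).continuous)
      rw [Submodule.span_le]
      rintro _ ⟨j, rfl⟩
      exact h1 j y
    rw [ha] at this
    exact this (Submodule.mem_top (x := x))
  rw [eq_top_iff]
  rintro z -
  refine UniformSpace.Completion.induction_on z hTc fun w => ?_
  induction w using TensorProduct.induction_on with
  | zero => rw [UniformSpace.Completion.coe_zero]; exact T.zero_mem
  | tmul x y => exact h2 x y
  | add x y hx hy => rw [UniformSpace.Completion.coe_add]; exact T.add_mem hx hy

end Hilbert

section Fock

variable (H : Type*) [NormedAddCommGroup H] [InnerProductSpace ℂ H]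

/-- The exponential kernel `(f, g) ↦ exp ⟪f, g⟫`, as an operator-valued kernel on `ℂ`. -/
def expKernel : Matrix H H (ℂ →L[ℂ] ℂ) :=
  Matrix.of fun f g => Complex.exp ⟪f, g⟫_ℂ • ContinuousLinearMap.id ℂ ℂ

theorem expKernel_posSemidef : (expKernel H).PosSemidef := by
  have hherm : (Matrix.of fun f g : H => ⟪f, g⟫_ℂ).IsHermitian := by
    ext f g; simp [Matrix.conjTranspose_apply]
  have gram : (Matrix.of fun f g : H => ⟪f, g⟫_ℂ).PosSemidef := by
    refine ⟨hherm, fun x => ?_⟩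
    have : (x.sum fun i xi => x.sum fun j xj =>
        star xi * (Matrix.of fun f g : H => ⟪f, g⟫_ℂ) i j * xj) =
        ⟪x.sum fun i xi => xi • i, x.sum fun i xi => xi • i⟫_ℂ := by
      simp only [Finsupp.sum, sum_inner, inner_sum, inner_smul_left, inner_smul_right,
        Finset.mul_sum]
      rw [Finset.sum_comm]
      refine Finset.sum_congr rfl fun i _ => Finset.sum_congr rfl fun j _ => ?_
      simp only [Matrix.of_apply, RCLike.star_def]
      ring
    rw [this, inner_self_eq_norm_sq_to_K]
    have h : (0 : ℝ) ≤ ‖x.sum fun i xi => xi • i‖ ^ 2 := sq_nonneg _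
    have h' := Complex.zero_le_real.2 h
    rw [Complex.ofReal_pow] at h'
    exact h'
  have pow : ∀ n : ℕ, (Matrix.of fun f g : H => ⟪f, g⟫_ℂ ^ n).PosSemidef := by
    intro n
    induction n with
    | zero =>
      refine ⟨by ext; simp, fun x => ?_⟩
      have : (x.sum fun i xi => x.sum fun j xj =>
          star xi * (Matrix.of fun f g : H => ⟪f, g⟫_ℂ ^ 0) i j * xj) =
          star (x.sum fun _ xi => xi) * (x.sum fun _ xi => xi) := by
        simp [Finsupp.sum, Finset.sum_mul_sum]
      rw [this]
      exact star_mul_self_nonneg _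
    | succ n ih =>
      have e : (Matrix.of fun f g : H => ⟪f, g⟫_ℂ ^ (n + 1)) =
          (Matrix.of fun f g : H => ⟪f, g⟫_ℂ ^ n).hadamard (Matrix.of fun f g : H => ⟪f, g⟫_ℂ) := by
        ext f g; simp [pow_succ]
      rw [e]
      exact ih.hadamard gram
  have key : ∀ x : H →₀ ℂ,
      0 ≤ x.sum fun i xi => x.sum fun j xj => star xi * Complex.exp ⟪i, j⟫_ℂ * xj := by
    intro x
    have hlim : Tendsto (fun N : ℕ => ∑ n ∈ Finset.range N, ((n.factorial : ℝ)⁻¹ : ℝ) •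
        (x.sum fun i xi => x.sum fun j xj => star xi * ⟪i, j⟫_ℂ ^ n * xj)) atTop
        (𝓝 (x.sum fun i xi => x.sum fun j xj => star xi * Complex.exp ⟪i, j⟫_ℂ * xj)) := by
      have : (fun N : ℕ => ∑ n ∈ Finset.range N, ((n.factorial : ℝ)⁻¹ : ℝ) •
          (x.sum fun i xi => x.sum fun j xj => star xi * ⟪i, j⟫_ℂ ^ n * xj)) =
          fun N : ℕ => x.sum fun i xi => x.sum fun j xj =>
            star xi * (∑ n ∈ Finset.range N, ⟪i, j⟫_ℂ ^ n / n.factorial) * xj := by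
        funext N
        simp only [Finsupp.sum, Finset.smul_sum, Finset.mul_sum, Finset.sum_mul]
        rw [Finset.sum_comm]
        refine Finset.sum_congr rfl fun i _ => ?_
        rw [Finset.sum_comm]
        refine Finset.sum_congr rfl fun j _ => Finset.sum_congr rfl fun n _ => ?_
        simp only [Complex.real_smul]
        push_cast
        ring
      rw [this]
      refine tendsto_finsetSum _ fun i _ => tendsto_finsetSum _ fun j _ => ?_
      refine Tendsto.mul_const _ (Tendsto.const_mul _ ?_)
      have h := NormedSpace.expSeries_div_hasSum_exp (𝔸 := ℂ) (⟪i, j⟫_ℂ)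
      rw [← Complex.exp_eq_exp_ℂ] at h
      exact h.tendsto_sum_nat
    refine ge_of_tendsto' hlim fun N => Finset.sum_nonneg fun n _ => ?_
    exact smul_nonneg (by positivity) ((pow n).2 x)
  have herm : (expKernel H).IsHermitian := by
    have hid : ContinuousLinearMap.adjoint (ContinuousLinearMap.id ℂ ℂ) =
        ContinuousLinearMap.id ℂ ℂ := star_one (ℂ →L[ℂ] ℂ)
    ext f g
    simp [expKernel, Matrix.conjTranspose_apply, ContinuousLinearMap.star_eq_adjoint,
      ← Complex.exp_conj, hid]
  refine ((RKHS.posSemidef_tfae (K := expKernel H)).out 0 2).mpr (And.intro herm fun v => ?_)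
  have := key v
  rw [Complex.le_def] at this
  refine le_of_le_of_eq this.1 (congrArg Complex.re ?_)
  refine Finset.sum_congr rfl fun i _ => Finset.sum_congr rfl fun j _ => ?_
  simp [expKernel, ← Complex.exp_conj]
  ring

instance : Fact (expKernel H).PosSemidef := ⟨expKernel_posSemidef H⟩

/-- The Boson Fock space over `H`: the Hilbert space generated by exponential vectors `ε f`, for
`f ∈ H`, with `⟪ε f, ε g⟫ = exp ⟪f, g⟫`. It is realised as the reproducing-kernel Hilbert space of
the exponential kernel, a vector `x` being the function `f ↦ ⟪ε f, x⟫`. -/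
def Fock : Type _ := RKHS.OfKernel (expKernel H)

instance : NormedAddCommGroup (Fock H) :=
  inferInstanceAs (NormedAddCommGroup (RKHS.OfKernel (expKernel H)))

instance : InnerProductSpace ℂ (Fock H) :=
  inferInstanceAs (InnerProductSpace ℂ (RKHS.OfKernel (expKernel H)))

instance : CompleteSpace (Fock H) :=
  inferInstanceAs (CompleteSpace (RKHS.OfKernel (expKernel H)))

instance : RKHS ℂ (Fock H) H ℂ :=
  inferInstanceAs (RKHS ℂ (RKHS.OfKernel (expKernel H)) H ℂ)

variable {H}

/-- The exponential vector `ε f`. -/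
def expVec (f : H) : Fock H := RKHS.kerFun (Fock H) f (1 : ℂ)

theorem inner_expVec (f g : H) : ⟪expVec f, expVec g⟫_ℂ = Complex.exp ⟪f, g⟫_ℂ := by
  have hk : RKHS.kernel (Fock H) = expKernel H := RKHS.OfKernel.kernel_ofKernel
  rw [expVec, expVec, ← RKHS.kernel_inner, hk]
  simp [expKernel, ← Complex.exp_conj]

theorem expVec_total : (Submodule.span ℂ (range (expVec : H → Fock H))).topologicalClosure = ⊤ := by
  rw [eq_top_iff, ← RKHS.kerFun_dense (Fock H)]
  refine Submodule.topologicalClosure_mono (Submodule.span_le.2 ?_)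
  rintro _ ⟨x, v, rfl⟩
  have : RKHS.kerFun (Fock H) x v = v • expVec x := by
    rw [expVec, ← map_smul, smul_eq_mul, mul_one]
  rw [this]
  exact Submodule.smul_mem _ _ (Submodule.subset_span ⟨x, rfl⟩)

/-- The second quantisation `Γ(q)` of an orthogonal projection `q`: the orthogonal projection
with `Γ(q) (ε f) = ε (q f)` for all `f`, that is, the projection onto the closed linear span of the
exponential vectors `ε (q f)`. -/
def secondQuantProj (q : H →L[ℂ] H) : Fock H →L[ℂ] Fock H :=
  (Submodule.span ℂ (range fun f => expVec (q f))).topologicalClosure.starProjection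

theorem secondQuantProj_expVec (q : H →L[ℂ] H) (hq : ∀ f g, ⟪q f, g⟫_ℂ = ⟪q f, q g⟫_ℂ) (f : H) :
    secondQuantProj q (expVec f) = expVec (q f) := by
  refine Submodule.eq_starProjection_of_mem_of_inner_eq_zero
    (Submodule.le_topologicalClosure _ (Submodule.subset_span ⟨f, rfl⟩)) ?_
  have h : expVec f - expVec (q f) ∈ (Submodule.span ℂ (range fun f => expVec (q f)))ᗮ := by
    rw [Submodule.mem_orthogonal]
    intro w hw
    induction hw using Submodule.span_induction with
    | mem x hx =>
      obtain ⟨g, rfl⟩ := hx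
      rw [inner_sub_right, inner_expVec, inner_expVec, hq, sub_self]
    | zero => exact inner_zero_left _
    | add x y _ _ hx hy => rw [inner_add_left, hx, hy, add_zero]
    | smul a x _ hx => rw [inner_smul_left, hx, mul_zero]
  rw [← Submodule.orthogonal_closure] at h
  intro w hw
  exact inner_eq_zero_symm.1 (h w hw)

end Fock

section Intervals

/-- The space `L²(A; k)`, for `A ⊆ ℝ` and Lebesgue measure. -/
abbrev L2 (k : Type*) [NormedAddCommGroup k] (A : Set ℝ) : Type _ :=
  Lp k 2 ((volume : Measure ℝ).restrict A)

/-- The restriction `f|_A ∈ L²(A; k)` of `f ∈ L²(C; k)`, where `A ⊆ C`. -/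
def restr {k : Type*} [NormedAddCommGroup k] {A C : Set ℝ} (h : A ⊆ C) (f : L2 k C) : L2 k A :=
  ((Lp.memLp f).mono_measure (Measure.restrict_mono_set volume h)).toLp f

theorem restr_ae {k : Type*} [NormedAddCommGroup k] {A C : Set ℝ} {h : A ⊆ C} (f : L2 k C) : restr h f =ᵐ[volume.restrict A] f :=
  MemLp.coeFn_toLp _

/-- `C` is the disjoint union of the measurable sets `A` and `B`. -/
structure IsSplit (A B C : Set ℝ) : Prop where
  left : A ⊆ C
  right : B ⊆ C
  cover : C ⊆ A ∪ B
  disj : Disjoint A B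
  measLeft : MeasurableSet A
  measRight : MeasurableSet B

theorem IsSplit.ico_ici {a b : ℝ} (h : a ≤ b) : IsSplit (Ico a b) (Ici b) (Ici a) where
  left := Ico_subset_Ici_self
  right := Ici_subset_Ici.2 h
  cover := (Ico_union_Ici_eq_Ici h).ge
  disj := by
    rw [Set.disjoint_left]
    exact fun x hx hx' => not_lt_of_ge hx' hx.2
  measLeft := measurableSet_Ico
  measRight := measurableSet_Ici

theorem IsSplit.ico_ico {a b c : ℝ} (h : a ≤ b) (h' : b ≤ c) :
    IsSplit (Ico a b) (Ico b c) (Ico a c) where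
  left := Ico_subset_Ico_right h'
  right := Ico_subset_Ico_left h
  cover := (Ico_union_Ico_eq_Ico h h').ge
  disj := by
    rw [Set.disjoint_left]
    exact fun x hx hx' => not_lt_of_ge hx'.1 hx.2
  measLeft := measurableSet_Ico
  measRight := measurableSet_Ico

theorem IsSplit.exists_glue {k : Type*} [NormedAddCommGroup k] {A B C : Set ℝ}
    (h : IsSplit A B C) (f : L2 k A) (g : L2 k B) :
    ∃ F : L2 k C, restr h.left F = f ∧ restr h.right F = g := by
  have hf : MemLp (A.indicator f) 2 (volume.restrict C) :=
    ((memLp_indicator_iff_restrict h.measLeft).2 (Lp.memLp f)).restrict C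
  have hg : MemLp (B.indicator g) 2 (volume.restrict C) :=
    ((memLp_indicator_iff_restrict h.measRight).2 (Lp.memLp g)).restrict C
  have hF := hf.add hg
  have key : ∀ {D : Set ℝ} (hD : D ⊆ C), restr hD hF.toLp =ᵐ[volume.restrict D]
      A.indicator f + B.indicator g := fun hD =>
    (restr_ae _).trans (ae_mono (Measure.restrict_mono_set volume hD) hF.coeFn_toLp)
  refine ⟨hF.toLp, Lp.ext ((key h.left).trans ?_), Lp.ext ((key h.right).trans ?_)⟩
  · filter_upwards [ae_restrict_mem h.measLeft] with x hx
    simp [hx, Set.disjoint_left.1 h.disj hx]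
  · filter_upwards [ae_restrict_mem h.measRight] with x hx
    simp [hx, Set.disjoint_right.1 h.disj hx]

variable {k : Type*} [NormedAddCommGroup k] [InnerProductSpace ℂ k] {A B C : Set ℝ}

theorem IsSplit.inner_eq (h : IsSplit A B C) (f g : L2 k C) :
    ⟪f, g⟫_ℂ = ⟪restr h.left f, restr h.left g⟫_ℂ + ⟪restr h.right f, restr h.right g⟫_ℂ := by
  have hC : C = A ∪ B := h.cover.antisymm (union_subset h.left h.right)
  have hint : IntegrableOn (fun a => ⟪f a, g a⟫_ℂ) C volume := L2.integrable_inner f g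
  have e1 : ⟪restr h.left f, restr h.left g⟫_ℂ = ∫ a in A, ⟪f a, g a⟫_ℂ := by
    rw [L2.inner_def]
    refine integral_congr_ae ?_
    filter_upwards [restr_ae (h := h.left) f, restr_ae (h := h.left) g] with a ha hb
    rw [ha, hb]
  have e2 : ⟪restr h.right f, restr h.right g⟫_ℂ = ∫ a in B, ⟪f a, g a⟫_ℂ := by
    rw [L2.inner_def]
    refine integral_congr_ae ?_
    filter_upwards [restr_ae (h := h.right) f, restr_ae (h := h.right) g] with a ha hb
    rw [ha, hb]
  rw [e1, e2, L2.inner_def, ← setIntegral_union h.disj h.measRight (hint.mono_set h.left)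
    (hint.mono_set h.right), ← hC]

theorem IsSplit.total (h : IsSplit A B C) :
    (Submodule.span ℂ (range fun f : L2 k C =>
      tmul (expVec (restr h.left f)) (expVec (restr h.right f)))).topologicalClosure = ⊤ := by
  rw [← tmul_total (expVec : L2 k A → _) (expVec : L2 k B → _) expVec_total expVec_total]
  congr 2
  refine Subset.antisymm ?_ ?_
  · rintro _ ⟨f, rfl⟩
    exact ⟨(restr h.left f, restr h.right f), rfl⟩
  · rintro _ ⟨⟨f, g⟩, rfl⟩
    obtain ⟨F, rfl, rfl⟩ := h.exists_glue f g
    exact ⟨F, rfl⟩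

theorem IsSplit.exists_fock (h : IsSplit A B C) :
    ∃ U : HilbertTensor (Fock (L2 k A)) (Fock (L2 k B)) ≃ₗᵢ[ℂ] Fock (L2 k C),
      ∀ f : L2 k C, U (tmul (expVec (restr h.left f)) (expVec (restr h.right f))) = expVec f := by
  refine exists_unitary _ _ (fun f g => ?_) h.total expVec_total
  rw [inner_tmul, inner_expVec, inner_expVec, inner_expVec, ← Complex.exp_add, ← h.inner_eq]

/-- The isomorphism `F_A ⊗ F_B ≅ F_C`, `ε(f|_A) ⊗ ε(f|_B) ↔ ε(f)`, where `C = A ⊔ B`. -/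
def fockSplit (h : IsSplit A B C) :
    HilbertTensor (Fock (L2 k A)) (Fock (L2 k B)) ≃ₗᵢ[ℂ] Fock (L2 k C) :=
  h.exists_fock.choose

theorem fockSplit_apply (h : IsSplit A B C) (f : L2 k C) :
    fockSplit h (tmul (expVec (restr h.left f)) (expVec (restr h.right f))) = expVec f :=
  h.exists_fock.choose_spec f

theorem total_univ (𝔥 : Type*) [NormedAddCommGroup 𝔥] [InnerProductSpace ℂ 𝔥] :
    (Submodule.span ℂ (range (id : 𝔥 → 𝔥))).topologicalClosure = ⊤ := by
  rw [range_id, Submodule.span_univ]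
  exact top_le_iff.1 (Submodule.le_topologicalClosure _)

variable (𝔥 : Type*) [NormedAddCommGroup 𝔥] [InnerProductSpace ℂ 𝔥]

theorem IsSplit.exists_left (h : IsSplit A B C) :
    ∃ U : HilbertTensor (HilbertTensor 𝔥 (Fock (L2 k A))) (Fock (L2 k B)) ≃ₗᵢ[ℂ]
        HilbertTensor 𝔥 (Fock (L2 k C)),
      ∀ i : 𝔥 × L2 k C,
        U (tmul (tmul i.1 (expVec (restr h.left i.2))) (expVec (restr h.right i.2))) =
          tmul i.1 (expVec i.2) := by
  refine exists_unitary
    (fun i : 𝔥 × L2 k C =>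
      tmul (tmul i.1 (expVec (restr h.left i.2))) (expVec (restr h.right i.2)))
    (fun i : 𝔥 × L2 k C => tmul i.1 (expVec i.2)) (fun f g => ?_) ?_
    (tmul_total id expVec (total_univ 𝔥) expVec_total)
  · simp only [inner_tmul, inner_expVec]
    rw [h.inner_eq f.2 g.2, Complex.exp_add]
    ring
  · rw [← tmul_total _ (expVec : L2 k B → _) (tmul_total _ (expVec : L2 k A → _) (total_univ 𝔥)
      expVec_total) expVec_total]
    congr 2
    refine Subset.antisymm ?_ ?_
    · rintro _ ⟨⟨u, f⟩, rfl⟩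
      exact ⟨((u, restr h.left f), restr h.right f), rfl⟩
    · rintro _ ⟨⟨⟨u, f⟩, g⟩, rfl⟩
      obtain ⟨F, rfl, rfl⟩ := h.exists_glue f g
      exact ⟨(u, F), rfl⟩

theorem IsSplit.exists_right (h : IsSplit A B C) :
    ∃ U : HilbertTensor (Fock (L2 k A)) (HilbertTensor 𝔥 (Fock (L2 k B))) ≃ₗᵢ[ℂ]
        HilbertTensor 𝔥 (Fock (L2 k C)),
      ∀ i : 𝔥 × L2 k C,
        U (tmul (expVec (restr h.left i.2)) (tmul i.1 (expVec (restr h.right i.2)))) =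
          tmul i.1 (expVec i.2) := by
  refine exists_unitary
    (fun i : 𝔥 × L2 k C =>
      tmul (expVec (restr h.left i.2)) (tmul i.1 (expVec (restr h.right i.2))))
    (fun i : 𝔥 × L2 k C => tmul i.1 (expVec i.2)) (fun f g => ?_) ?_
    (tmul_total id expVec (total_univ 𝔥) expVec_total)
  · simp only [inner_tmul, inner_expVec]
    rw [h.inner_eq f.2 g.2, Complex.exp_add]
    ring
  · rw [← tmul_total (expVec : L2 k A → _) _ expVec_total (tmul_total _ (expVec : L2 k B → _)
      (total_univ 𝔥) expVec_total)]
    congr 2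
    refine Subset.antisymm ?_ ?_
    · rintro _ ⟨⟨u, f⟩, rfl⟩
      exact ⟨(restr h.left f, (u, restr h.right f)), rfl⟩
    · rintro _ ⟨⟨f, ⟨u, g⟩⟩, rfl⟩
      obtain ⟨F, rfl, rfl⟩ := h.exists_glue f g
      exact ⟨(u, F), rfl⟩

/-- The isomorphism `(𝔥 ⊗ F_A) ⊗ F_B ≅ 𝔥 ⊗ F_C`, `(u ⊗ ε(f|_A)) ⊗ ε(f|_B) ↔ u ⊗ ε(f)`. -/
def splitLeft (h : IsSplit A B C) :
    HilbertTensor (HilbertTensor 𝔥 (Fock (L2 k A))) (Fock (L2 k B)) ≃ₗᵢ[ℂ]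
      HilbertTensor 𝔥 (Fock (L2 k C)) :=
  (h.exists_left 𝔥).choose

theorem splitLeft_apply (h : IsSplit A B C) (u : 𝔥) (f : L2 k C) :
    splitLeft 𝔥 h (tmul (tmul u (expVec (restr h.left f))) (expVec (restr h.right f))) =
      tmul u (expVec f) :=
  (h.exists_left 𝔥).choose_spec (u, f)

/-- The isomorphism `F_A ⊗ (𝔥 ⊗ F_B) ≅ 𝔥 ⊗ F_C`, `ε(f|_A) ⊗ (u ⊗ ε(f|_B)) ↔ u ⊗ ε(f)`. -/
def splitRight (h : IsSplit A B C) :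
    HilbertTensor (Fock (L2 k A)) (HilbertTensor 𝔥 (Fock (L2 k B))) ≃ₗᵢ[ℂ]
      HilbertTensor 𝔥 (Fock (L2 k C)) :=
  (h.exists_right 𝔥).choose

theorem splitRight_apply (h : IsSplit A B C) (u : 𝔥) (f : L2 k C) :
    splitRight 𝔥 h (tmul (expVec (restr h.left f)) (tmul u (expVec (restr h.right f)))) =
      tmul u (expVec f) :=
  (h.exists_right 𝔥).choose_spec (u, f)

end Intervals

section Flow

variable {k : Type*} [NormedAddCommGroup k] [InnerProductSpace ℂ k]

theorem measurePreserving_sub (t : ℝ) : MeasurePreserving (fun s : ℝ => s - t)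
    (volume.restrict (Ici t)) (volume.restrict (Ici 0)) := by
  have h := (measurePreserving_sub_right (volume : Measure ℝ) t).restrict_preimage
    (measurableSet_Ici (a := (0 : ℝ)))
  have e : (fun s : ℝ => s - t) ⁻¹' Ici 0 = Ici t := by ext; simp
  rwa [e] at h

theorem measurePreserving_add (t : ℝ) : MeasurePreserving (fun s : ℝ => s + t)
    (volume.restrict (Ici 0)) (volume.restrict (Ici t)) := by
  have h := (measurePreserving_add_right (volume : Measure ℝ) t).restrict_preimage
    (measurableSet_Ici (a := t))
  have e : (fun s : ℝ => s + t) ⁻¹' Ici t = Ici 0 := by ext; simp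
  rwa [e] at h

/-- The right shift `(θ_t f)(s) = f(s - t)`, from `L²([0, ∞); k)` onto `L²([t, ∞); k)`. -/
def rightShift (t : ℝ) : L2 k (Ici 0) →ₗᵢ[ℂ] L2 k (Ici t) :=
  Lp.compMeasurePreservingₗᵢ ℂ (fun s => s - t) (measurePreserving_sub t)

theorem rightShift_surjective (t : ℝ) :
    Function.Surjective (rightShift t : L2 k (Ici 0) → L2 k (Ici t)) := by
  intro g
  refine ⟨Lp.compMeasurePreserving (fun s => s + t) (measurePreserving_add t) g, ?_⟩
  refine Lp.ext ?_
  have h1 := Lp.coeFn_compMeasurePreserving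
    (Lp.compMeasurePreserving (fun s => s + t) (measurePreserving_add t) g)
    (measurePreserving_sub t)
  have h2 := (measurePreserving_sub t).quasiMeasurePreserving.ae_eq_comp
    (Lp.coeFn_compMeasurePreserving g (measurePreserving_add t))
  refine h1.trans (h2.trans ?_)
  filter_upwards with s
  simp

theorem exists_fockShift (t : ℝ) : ∃ U : Fock (L2 k (Ici 0)) ≃ₗᵢ[ℂ] Fock (L2 k (Ici t)),
    ∀ f, U (expVec f) = expVec (rightShift t f) := by
  refine exists_unitary _ _ (fun f g => ?_) expVec_total ?_
  · rw [inner_expVec, inner_expVec, LinearIsometry.inner_map_map]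
  · rw [← expVec_total (H := L2 k (Ici t))]
    congr 2
    exact (rightShift_surjective t).range_comp expVec

/-- The second quantisation `Γ_t` of the right shift, as an isomorphism from the Fock space `F`
onto `F_{[t}`, with `Γ_t ε(f) = ε(θ_t f)`. -/
def fockShift (t : ℝ) : Fock (L2 k (Ici 0)) ≃ₗᵢ[ℂ] Fock (L2 k (Ici t)) :=
  (exists_fockShift t).choose

theorem fockShift_expVec (t : ℝ) (f : L2 k (Ici 0)) :
    fockShift t (expVec f) = expVec (rightShift t f) :=
  (exists_fockShift t).choose_spec f

end Flow

section StopTimes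

/-- The Boson Fock space `F` over `L²(ℝ₊; k)`. -/
abbrev FockSpace (k : Type*) [NormedAddCommGroup k] [InnerProductSpace ℂ k] : Type _ :=
  Fock (L2 k (Ici 0))

/-- The Boson Fock space `F_{t)}` over `L²([0, t); k)`. -/
abbrev FockPast (k : Type*) [NormedAddCommGroup k] [InnerProductSpace ℂ k] (t : ℝ≥0) : Type _ :=
  Fock (L2 k (Ico 0 (t : ℝ)))

/-- The Boson Fock space `F_{[t}` over `L²([t, ∞); k)`. -/
abbrev FockFuture (k : Type*) [NormedAddCommGroup k] [InnerProductSpace ℂ k] (t : ℝ≥0) : Type _ :=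
  Fock (L2 k (Ici (t : ℝ)))

theorem isSplit (t : ℝ≥0) : IsSplit (Ico 0 (t : ℝ)) (Ici (t : ℝ)) (Ici 0) :=
  IsSplit.ico_ici t.coe_nonneg

variable {k : Type*} [NormedAddCommGroup k] [InnerProductSpace ℂ k]

/-- The operator `Y ⊗ I_{[t}` on `F ≅ F_{t)} ⊗ F_{[t}`. -/
def pastOp (t : ℝ≥0) (Y : FockPast k t →L[ℂ] FockPast k t) : FockSpace k →L[ℂ] FockSpace k :=
  (fockSplit (isSplit t)).conjStarAlgEquiv (opTensor Y (ContinuousLinearMap.id ℂ _))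

variable (k) in
/-- A quantum stop time: an identity-adapted spectral measure on the Borel subsets of `[0, ∞]`,
with values in the orthogonal projections on the Fock space. (The values of `proj` on non-measurable
sets play no role.) -/
structure QuantumStopTime where
  proj : Set ℝ≥0∞ → (FockSpace k →L[ℂ] FockSpace k)
  isStarProjection : ∀ A, MeasurableSet A → IsStarProjection (proj A)
  complexMeasure : ∀ x y, ∃ μ : ComplexMeasure ℝ≥0∞,
    ∀ A, MeasurableSet A → μ A = ⟪x, proj A y⟫_ℂ
  proj_univ : proj univ = ContinuousLinearMap.id ℂ _
  adapted_zero : ∃ c : ℂ, proj {0} = c • ContinuousLinearMap.id ℂ _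
  adapted : ∀ t : ℝ≥0, 0 < t → ∃ Y : FockPast k t →L[ℂ] FockPast k t,
    proj (Iic (t : ℝ≥0∞)) = pastOp t Y

theorem fockSplit_symm_apply {A B C : Set ℝ} (h : IsSplit A B C) (f : L2 k C) :
    (fockSplit h).symm (expVec f) = tmul (expVec (restr h.left f)) (expVec (restr h.right f)) := by
  rw [LinearIsometryEquiv.symm_apply_eq, fockSplit_apply]

theorem inner_pastOp (t : ℝ≥0) (Y : FockPast k t →L[ℂ] FockPast k t) (f g : L2 k (Ici 0)) :
    ⟪expVec f, pastOp t Y (expVec g)⟫_ℂ =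
      ⟪expVec (restr (isSplit t).left f), Y (expVec (restr (isSplit t).left g))⟫_ℂ *
      Complex.exp ⟪restr (isSplit t).right f, restr (isSplit t).right g⟫_ℂ := by
  have hs := fockSplit_symm_apply (k := k) (isSplit t)
  rw [pastOp, LinearIsometryEquiv.conjStarAlgEquiv_apply_apply, hs, opTensor_tmul,
    ← LinearIsometryEquiv.inner_map_map (fockSplit (isSplit t)).symm,
    LinearIsometryEquiv.symm_apply_apply, hs, inner_tmul]
  simp [inner_expVec]

theorem ext_expVec {H : Type*} [NormedAddCommGroup H] [InnerProductSpace ℂ H]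
    {X Y : Fock H →L[ℂ] Fock H}
    (h : ∀ f g : H, ⟪expVec f, X (expVec g)⟫_ℂ = ⟪expVec f, Y (expVec g)⟫_ℂ) : X = Y := by
  have hd : Dense (Submodule.span ℂ (range (expVec : H → Fock H)) : Set (Fock H)) :=
    Submodule.dense_iff_topologicalClosure_eq_top.2 expVec_total
  refine ContinuousLinearMap.ext_on hd ?_
  rintro _ ⟨g, rfl⟩
  refine hd.eq_of_inner_right ℂ fun v hv => ?_
  induction hv using Submodule.span_induction with
  | mem x hx => obtain ⟨f, rfl⟩ := hx; exact h f g
  | zero => simp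
  | add x y _ _ hx hy => rw [inner_add_left, inner_add_left, hx, hy]
  | smul a x _ hx => rw [inner_smul_left, inner_smul_left, hx]

theorem restr_restr {k : Type*} [NormedAddCommGroup k] {A B C : Set ℝ} (h : A ⊆ B) (h' : B ⊆ C)
    (f : L2 k C) : restr h (restr h' f) = restr (h.trans h') f :=
  have h1 : restr h' f =ᵐ[volume.restrict A] f :=
    ae_mono (Measure.restrict_mono_set volume h) (restr_ae f)
  Lp.ext ((restr_ae _).trans (h1.trans (restr_ae f).symm))

/-- `B(F_{s)}) ⊗ I_{[s} ⊆ B(F_{t)}) ⊗ I_{[t}` for `s ≤ t`. -/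
theorem pastOp_mono {s t : ℝ≥0} (hst : s ≤ t) (Y : FockPast k s →L[ℂ] FockPast k s) :
    ∃ Z : FockPast k t →L[ℂ] FockPast k t, pastOp s Y = pastOp t Z := by
  have h := IsSplit.ico_ico s.coe_nonneg (NNReal.coe_le_coe.2 hst)
  have h' := IsSplit.ico_ici (NNReal.coe_le_coe.2 hst)
  refine ⟨(fockSplit h).conjStarAlgEquiv (opTensor Y (ContinuousLinearMap.id ℂ _)), ?_⟩
  have hs := fockSplit_symm_apply (k := k) h
  refine ext_expVec fun f g => ?_
  rw [inner_pastOp, inner_pastOp, LinearIsometryEquiv.conjStarAlgEquiv_apply_apply, hs,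
    opTensor_tmul, ← LinearIsometryEquiv.inner_map_map (fockSplit h).symm,
    LinearIsometryEquiv.symm_apply_apply, hs, inner_tmul, ContinuousLinearMap.id_apply,
    inner_expVec, mul_assoc, ← Complex.exp_add, h'.inner_eq]
  simp only [restr_restr]

theorem QuantumStopTime.proj_empty (S : QuantumStopTime k) : S.proj ∅ = 0 := by
  refine ContinuousLinearMap.ext fun y => ext_inner_left ℂ fun x => ?_
  obtain ⟨μ, hμ⟩ := S.complexMeasure x y
  rw [← hμ ∅ MeasurableSet.empty]
  simp

/-- The quantum stop time `S + t`: the image of the spectral measure `S` under `s ↦ s + t`. Thus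
`(S + t)([0, u])` equals `0` if `u < t` and `S([0, u - t])` if `u ≥ t`. -/
def QuantumStopTime.addTime (S : QuantumStopTime k) (t : ℝ≥0) : QuantumStopTime k where
  proj A := S.proj ((fun s => s + (t : ℝ≥0∞)) ⁻¹' A)
  isStarProjection A hA := S.isStarProjection _ (hA.preimage (by fun_prop))
  complexMeasure x y := by
    obtain ⟨μ, hμ⟩ := S.complexMeasure x y
    have hm : Measurable fun s : ℝ≥0∞ => s + (t : ℝ≥0∞) := by fun_prop
    exact ⟨μ.map _, fun A hA => by rw [VectorMeasure.map_apply _ hm hA, hμ _ (hA.preimage hm)]⟩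
  proj_univ := S.proj_univ
  adapted_zero := by
    rcases eq_or_ne t 0 with rfl | ht
    · simpa using! S.adapted_zero
    · have e : (fun s : ℝ≥0∞ => s + (t : ℝ≥0∞)) ⁻¹' {0} = ∅ := by ext s; simp [ht]
      exact ⟨0, by rw [e, S.proj_empty, zero_smul]⟩
  adapted u hu := by
    rcases lt_trichotomy u t with h | rfl | h
    · have e : (fun s : ℝ≥0∞ => s + (t : ℝ≥0∞)) ⁻¹' Iic (u : ℝ≥0∞) = ∅ := by
        ext s
        simpa using (ENNReal.coe_lt_coe.2 h).trans_le le_add_self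
      refine ⟨0, ?_⟩
      rw [e, S.proj_empty]
      exact ext_expVec fun f g => by simp [inner_pastOp]
    · have e : (fun s : ℝ≥0∞ => s + (u : ℝ≥0∞)) ⁻¹' Iic (u : ℝ≥0∞) = {0} := by
        ext s
        constructor
        · intro hs
          by_contra h0
          have h1 : (u : ℝ≥0∞) < u + s := ENNReal.lt_add_right ENNReal.coe_ne_top h0
          rw [add_comm] at h1
          exact absurd hs (not_le.2 h1)
        · rintro rfl; simp
      obtain ⟨c, hc⟩ := S.adapted_zero
      refine ⟨c • ContinuousLinearMap.id ℂ _, ?_⟩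
      rw [e, hc]
      refine ext_expVec fun f g => ?_
      rw [inner_pastOp]
      simp only [smul_apply, ContinuousLinearMap.id_apply, inner_smul_right,
        inner_expVec]
      rw [mul_assoc, ← Complex.exp_add, (isSplit u).inner_eq]
    · obtain ⟨Y, hY⟩ := S.adapted (u - t) (tsub_pos_of_lt h)
      obtain ⟨Z, hZ⟩ := pastOp_mono (tsub_le_self : u - t ≤ u) Y
      refine ⟨Z, ?_⟩
      rw [← hZ, ← hY]
      congr 1
      ext s
      rw [mem_preimage, mem_Iic, mem_Iic, ENNReal.coe_sub]
      exact (ENNReal.le_sub_iff_add_le_right ENNReal.coe_ne_top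
        (ENNReal.coe_le_coe.2 h.le)).symm

end StopTimes

section Stopping

variable {k : Type*} [NormedAddCommGroup k] [InnerProductSpace ℂ k]
variable {𝔥 : Type*} [NormedAddCommGroup 𝔥] [InnerProductSpace ℂ 𝔥]

/-- The bounded operators on `𝔥 ⊗ F`. -/
abbrev Op (𝔥 k : Type*) [NormedAddCommGroup 𝔥] [InnerProductSpace ℂ 𝔥] [NormedAddCommGroup k]
    [InnerProductSpace ℂ k] : Type _ :=
  HilbertTensor 𝔥 (FockSpace k) →L[ℂ] HilbertTensor 𝔥 (FockSpace k)

/-- The CCR flow `σ_t(X) = I_{t)} ⊗ Γ_t X Γ_t^*`, extended by ampliation to `B(𝔥 ⊗ F)`. -/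
def ccrFlow (t : ℝ≥0) (X : Op 𝔥 k) : Op 𝔥 k :=
  (splitRight 𝔥 (isSplit t)).conjStarAlgEquiv
    (opTensor (ContinuousLinearMap.id ℂ (FockPast k t))
      (opTensor (ContinuousLinearMap.id ℂ 𝔥)
          (fockShift (k := k) t : FockSpace k →L[ℂ] FockFuture k t) ∘L X ∘L
        opTensor (ContinuousLinearMap.id ℂ 𝔥)
          ((fockShift (k := k) t).symm : FockFuture k t →L[ℂ] FockSpace k)))

/-- The CCR flow with time parameter in `[0, ∞]`, where `σ_∞` is constant with value `I`. -/
def ccrFlowExt (t : ℝ≥0∞) (X : Op 𝔥 k) : Op 𝔥 k :=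
  if t = ∞ then ContinuousLinearMap.id ℂ _ else ccrFlow t.toNNReal X

/-- Finite partitions `0 = π₀ < ⋯ < π_{n+1} = t` of `[0, t]`, as finite sets of points ordered by
inclusion, that is, by refinement. -/
abbrev Partition (t : ℝ≥0∞) : Type :=
  {π : Finset ℝ≥0∞ // 0 ∈ π ∧ t ∈ π ∧ ∀ x ∈ π, x ≤ t}

/-- The point `π_{j-1}` of the partition `π` which precedes the point `b = π_j`, where `j ≥ 1`. -/
def pred (π : Finset ℝ≥0∞) (b : ℝ≥0∞) : ℝ≥0∞ := (π.filter (· < b)).sup id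

/-- The Riemann sum `∑_{j ≥ 1} Z(π_j) S((π_{j-1}, π_j])`, where `S` acts on `𝔥 ⊗ F` by
ampliation. -/
def riemannSum (Z : ℝ≥0∞ → Op 𝔥 k) (S : QuantumStopTime k) (π : Finset ℝ≥0∞) : Op 𝔥 k :=
  ∑ b ∈ π.filter (0 < ·),
    Z b ∘L opTensor (ContinuousLinearMap.id ℂ 𝔥) (S.proj (Ioc (pred π b) b))

/-- Convergence in the strong operator topology. -/
def StrongLim {ι E : Type*} [NormedAddCommGroup E] [NormedSpace ℂ E] (l : Filter ι)
    (T : ι → E →L[ℂ] E) (L : E →L[ℂ] E) : Prop :=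
  ∀ z, Tendsto (fun i => T i z) l (𝓝 (L z))

/-- `W = σ_S(X)`, the stopped CCR flow: `σ_S(X) = st.lim_π ∑_j σ_{π_j}(X) S((π_{j-1}, π_j])`, where
`π` runs through the finite partitions of `[0, ∞]`, directed by refinement. -/
def IsStoppedFlow (S : QuantumStopTime k) (X W : Op 𝔥 k) : Prop :=
  StrongLim atTop (fun π : Partition ∞ => riemannSum (fun b => ccrFlowExt b X) S π.1) W

/-- `W = V_{S,t}` for `t ∈ (0, ∞)`: `V_{S,t} = st.lim_π ∑_j V_{π_j} S((π_{j-1}, π_j])`, where `π`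
runs through the finite partitions of `[0, t]`, directed by refinement. -/
def IsStoppedBy (V : ℝ≥0 → Op 𝔥 k) (S : QuantumStopTime k) (t : ℝ≥0) (W : Op 𝔥 k) : Prop :=
  StrongLim atTop (fun π : Partition (t : ℝ≥0∞) => riemannSum (fun b => V b.toNNReal) S π.1) W

/-- `W = V_S`, the process `V` stopped at `S`: every `V_{S,t}` exists, and
`V_S = st.lim_{t → ∞} V_{S,t}`. -/
def IsStopped (V : ℝ≥0 → Op 𝔥 k) (S : QuantumStopTime k) (W : Op 𝔥 k) : Prop :=
  ∃ Vt : ℝ≥0 → Op 𝔥 k,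
    (∀ t, 0 < t → IsStoppedBy V S t (Vt t)) ∧ StrongLim atTop Vt W

end Stopping

section Cocycles

/-- The ultraweak tensor product `𝒜 ⊗ B(K)`: the von Neumann algebra generated by the operators
`a ⊗ b` with `a ∈ 𝒜` and `b ∈ B(K)`, as a double commutant. -/
def vnTensor {𝔥 : Type*} [NormedAddCommGroup 𝔥] [InnerProductSpace ℂ 𝔥] [CompleteSpace 𝔥]
    (𝒜 : VonNeumannAlgebra 𝔥) (K : Type*) [NormedAddCommGroup K] [InnerProductSpace ℂ K] :
    Set (HilbertTensor 𝔥 K →L[ℂ] HilbertTensor 𝔥 K) :=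
  Set.centralizer (Set.centralizer {X | ∃ a ∈ 𝒜, ∃ b : K →L[ℂ] K, X = opTensor a b})

variable {k : Type*} [NormedAddCommGroup k] [InnerProductSpace ℂ k]
variable {𝔥 : Type*} [NormedAddCommGroup 𝔥] [InnerProductSpace ℂ 𝔥]

/-- The operator `P_{[t}` on `F_{[t}`: the second quantisation of the orthogonal projection `p`
acting pointwise on `L²([t, ∞); k)`. -/
def futureProj (p : k →L[ℂ] k) (t : ℝ≥0) : FockFuture k t →L[ℂ] FockFuture k t :=
  secondQuantProj (p.compLpL 2 (volume.restrict (Ici (t : ℝ))))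

theorem futureProj_expVec [CompleteSpace k] {p : k →L[ℂ] k} (hp : IsStarProjection p) (t : ℝ≥0)
    (f : L2 k (Ici (t : ℝ))) :
    futureProj p t (expVec f) = expVec (p.compLpL 2 _ f) := by
  refine secondQuantProj_expVec _ (fun f g => ?_) f
  rw [L2.inner_def, L2.inner_def]
  refine integral_congr_ae ?_
  filter_upwards [p.coeFn_compLpL (p := 2) f, p.coeFn_compLpL (p := 2) g] with s hf hg
  rw [hf, hg, ← ContinuousLinearMap.adjoint_inner_left, ← ContinuousLinearMap.star_eq_adjoint,
    hp.isSelfAdjoint.star_eq, ← mul_apply_eq_comp, hp.isIdempotentElem.eq]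

/-- The operator `A ⊗ B` on `𝔥 ⊗ F ≅ (𝔥 ⊗ F_{t)}) ⊗ F_{[t}`. -/
def pastFuture (t : ℝ≥0) (A : HilbertTensor 𝔥 (FockPast k t) →L[ℂ] HilbertTensor 𝔥 (FockPast k t))
    (B : FockFuture k t →L[ℂ] FockFuture k t) : Op 𝔥 k :=
  (splitLeft 𝔥 (isSplit t)).conjStarAlgEquiv (opTensor A B)

/-- A `p`-adapted process `V` in `𝒜 ⊗ B(F)`: `V_t = V_{t)} ⊗ P_{[t}` with
`V_{t)} ∈ 𝒜 ⊗ B(F_{t)})`, for all `t ≥ 0`. (The operators `V_{t)}` are determined by `V`.) -/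
structure AdaptedProcess [CompleteSpace 𝔥] (𝒜 : VonNeumannAlgebra 𝔥) (p : k →L[ℂ] k) where
  /-- `V_t` -/
  op : ℝ≥0 → Op 𝔥 k
  /-- `V_{t)}` -/
  past : ∀ t : ℝ≥0, HilbertTensor 𝔥 (FockPast k t) →L[ℂ] HilbertTensor 𝔥 (FockPast k t)
  op_mem : ∀ t, op t ∈ vnTensor 𝒜 (FockSpace k)
  past_mem : ∀ t, past t ∈ vnTensor 𝒜 (FockPast k t)
  op_eq : ∀ t, op t = pastFuture t (past t) (futureProj p t)

namespace AdaptedProcess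

variable [CompleteSpace 𝔥] {𝒜 : VonNeumannAlgebra 𝔥} {p : k →L[ℂ] k}

/-- The identity-adapted projection, `V̂_t = V_{t)} ⊗ I_{[t}`. -/
def hat (V : AdaptedProcess 𝒜 p) (t : ℝ≥0) : Op 𝔥 k :=
  pastFuture t (V.past t) (ContinuousLinearMap.id ℂ _)

/-- `V` is a left operator Markovian cocycle of the CCR flow: `V_{s + t} = V̂_s σ_s(V_t)`. -/
def IsCocycle (V : AdaptedProcess 𝒜 p) : Prop :=
  ∀ s t : ℝ≥0, V.op (s + t) = V.hat s ∘L ccrFlow s (V.op t)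

/-- `V_{t)}^* V_{t)} = I` for all `t ≥ 0`. -/
def IsIsometric (V : AdaptedProcess 𝒜 p) : Prop :=
  ∀ t, ContinuousLinearMap.adjoint (V.past t) ∘L V.past t = ContinuousLinearMap.id ℂ _

/-- `V` is strongly continuous: `t ↦ V_t z` is continuous for all `z`. -/
def IsStronglyContinuous (V : AdaptedProcess 𝒜 p) : Prop :=
  ∀ z, Continuous fun t => V.op t z

end AdaptedProcess

end Cocycles

end QStop

end

/-! All the limits come from one orthogonality principle. The processes `V`, `V.hat` and `t ↦
σ_t(X)` can each be written as `Z(b + r) = J(b) σ_b(Y(r))`, with `J(b)` isometric and `Y` bounded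
and strongly continuous at `0` (`IsFlowProcess`). Hence `Z(b)^* Z(b + r) = σ_b(Y(0)^* Y(r))` acts
trivially on the past of `b`, so it commutes with `S([0, a])` for `a ≤ b`. Consequently the vectors
`Z(π_j) S((π_{j-1}, π_j]) x` of a Riemann sum are pairwise orthogonal, and Pythagoras bounds the
sums, their tails and their change under refinement (`norm_sum_le`, `norm_projSum_sub_le`).

Convergence is then tested on the total set of vectors `u ⊗ ε(f)`. The increment of `Z` from `c` to
`c + r`, applied to `S((a, c])(u ⊗ ε(f))`, has norm equal to a factor from the past times `‖(Y(r) -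
Y(0))(u ⊗ ε(θ_c^* f))‖`, where `θ_c^*` is the left shift. This is small uniformly for `c ∈ [0, T]`
by compactness (`hasModulus`). The contribution after time `T` is controlled by `S((T, ∞])`, which
tends strongly to `S({∞}) = 0`.

To apply this to `V.hat` one needs that it satisfies a cocycle identity of its own
(`IsCocycle.hat_add`). It agrees with `V` at time `t` on exponential vectors that vanish after `t`,
since `P_{[t}` fixes the vacuum, and the missing future is restored by operators that commute with
everything in sight (`replaceFuture`).

The identity itself already holds for Riemann sums (`projSum_addTime`). A partition of `[0, T + t]`
containing `t` is translated by `-t`; then `V_{b+t} = V̂_b σ_b(V_t)`, the operator `σ_b(V_t)`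
commutes with the spectral projection of the cell ending at `b`, and disjoint cells have orthogonal
projections, so the sum for `V_{S+t}` is the product of the sums for `V̂_S` and `σ_S(V_t)`. Products
of uniformly bounded strongly convergent nets converge, which gives the theorem on passing to the
limit in the partition and then in `T`. -/

noncomputable section

namespace QStop

/-! ### Riemann sums against a projection-valued measure, and their orthogonality. -/

section RiemannSums

variable {E : Type*} [NormedAddCommGroup E] [InnerProductSpace ℂ E]

/-- A finitely additive family of orthogonal projections indexed by the Borel subsets of
`[0, ∞]`. -/
structure IsProjFamily (Q : Set ℝ≥0∞ → E →L[ℂ] E) : Prop where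
  symm : ∀ A, MeasurableSet A → ∀ x y, ⟪Q A x, y⟫_ℂ = ⟪x, Q A y⟫_ℂ
  mul_self : ∀ A, MeasurableSet A → ∀ x, Q A (Q A x) = Q A x
  mul_disjoint : ∀ A B, MeasurableSet A → MeasurableSet B → Disjoint A B → ∀ x, Q A (Q B x) = 0
  union : ∀ A B, MeasurableSet A → MeasurableSet B → Disjoint A B → Q (A ∪ B) = Q A + Q B

namespace IsProjFamily

variable {Q : Set ℝ≥0∞ → E →L[ℂ] E} (hQ : IsProjFamily Q)
include hQ

theorem empty : Q ∅ = 0 := by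
  have h := hQ.union ∅ ∅ .empty .empty (disjoint_bot_left)
  simpa using h

theorem norm_sq_union {A B : Set ℝ≥0∞} (hA : MeasurableSet A) (hB : MeasurableSet B)
    (h : Disjoint A B) (x : E) : ‖Q (A ∪ B) x‖ ^ 2 = ‖Q A x‖ ^ 2 + ‖Q B x‖ ^ 2 := by
  have h0 : ⟪Q A x, Q B x⟫_ℂ = 0 := by
    rw [hQ.symm A hA, hQ.mul_disjoint A B hA hB h, inner_zero_right]
  rw [hQ.union A B hA hB h, add_apply]
  have := norm_add_sq_eq_norm_sq_add_norm_sq_of_inner_eq_zero _ _ h0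
  simpa [sq] using this

theorem norm_mono {A B : Set ℝ≥0∞} (hA : MeasurableSet A) (hB : MeasurableSet B)
    (h : A ⊆ B) (x : E) : ‖Q A x‖ ≤ ‖Q B x‖ := by
  have := hQ.norm_sq_union hA (hB.diff hA) disjoint_sdiff_right x
  rw [union_sdiff_cancel h] at this
  refine (sq_le_sq₀ (norm_nonneg _) (norm_nonneg _)).1 ?_
  rw [this]
  exact le_add_of_nonneg_right (sq_nonneg _)

theorem norm_le {A : Set ℝ≥0∞} (hA : MeasurableSet A) (x : E) : ‖Q A x‖ ≤ ‖x‖ := by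
  rcases eq_or_ne (Q A x) 0 with h0 | h0
  · simp [h0]
  have h : ⟪Q A x, Q A x⟫_ℂ = ⟪x, Q A x⟫_ℂ := by rw [hQ.symm A hA, hQ.mul_self A hA]
  have h1 : ‖Q A x‖ * ‖Q A x‖ ≤ ‖x‖ * ‖Q A x‖ := by
    have h2 : ‖⟪Q A x, Q A x⟫_ℂ‖ = ‖Q A x‖ * ‖Q A x‖ := by
      rw [inner_self_eq_norm_sq_to_K]; simp [sq]
    rw [← h2, h]
    exact norm_inner_le_norm _ _
  exact le_of_mul_le_mul_right h1 (norm_pos_iff.2 h0)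

theorem biUnion {ι : Type*} (s : Finset ι) (A : ι → Set ℝ≥0∞) (hA : ∀ i, MeasurableSet (A i))
    (hd : (s : Set ι).PairwiseDisjoint A) : Q (⋃ i ∈ s, A i) = ∑ i ∈ s, Q (A i) := by
  classical
  induction s using Finset.induction_on with
  | empty => simp [hQ.empty]
  | insert i s hi ih =>
    rw [Finset.set_biUnion_insert, Finset.sum_insert hi, hQ.union _ _ (hA i)
      (s.measurableSet_biUnion fun j _ => hA j), ih]
    · exact hd.subset (by simp)
    · rw [Set.disjoint_iUnion₂_right]
      intro j hj
      exact hd (by simp) (by simp [hj]) (by rintro rfl; exact hi hj)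

theorem sum_norm_sq {ι : Type*} (s : Finset ι) (A : ι → Set ℝ≥0∞) (hA : ∀ i, MeasurableSet (A i))
    (hd : (s : Set ι).PairwiseDisjoint A) (x : E) :
    ∑ i ∈ s, ‖Q (A i) x‖ ^ 2 = ‖Q (⋃ i ∈ s, A i) x‖ ^ 2 := by
  classical
  induction s using Finset.induction_on with
  | empty => simp [hQ.empty]
  | insert i s hi ih =>
    rw [Finset.set_biUnion_insert, Finset.sum_insert hi, hQ.norm_sq_union (hA i)
      (s.measurableSet_biUnion fun j _ => hA j), ih]
    · exact hd.subset (by simp)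
    · rw [Set.disjoint_iUnion₂_right]
      intro j hj
      exact hd (by simp) (by simp [hj]) (by rintro rfl; exact hi hj)

theorem Ioc_eq {a b : ℝ≥0∞} (h : a ≤ b) : Q (Ioc a b) = Q (Iic b) - Q (Iic a) := by
  rw [← Iic_union_Ioc_eq_Iic h, hQ.union _ _ measurableSet_Iic measurableSet_Ioc]
  · simp
  · rw [Set.disjoint_left]
    exact fun s hs hs' => not_lt_of_ge hs hs'.1

end IsProjFamily

theorem norm_sum_sq_of_pairwise_inner_eq_zero {ι : Type*} (s : Finset ι) (v : ι → E)
    (h : ∀ i ∈ s, ∀ j ∈ s, i ≠ j → ⟪v i, v j⟫_ℂ = 0) :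
    ‖∑ i ∈ s, v i‖ ^ 2 = ∑ i ∈ s, ‖v i‖ ^ 2 := by
  classical
  induction s using Finset.induction_on with
  | empty => simp
  | insert i s hi ih =>
    have h0 : ⟪v i, ∑ j ∈ s, v j⟫_ℂ = 0 := by
      rw [inner_sum]
      refine Finset.sum_eq_zero fun j hj => h i (by simp) j (by simp [hj]) ?_
      rintro rfl; exact hi hj
    have := norm_add_sq_eq_norm_sq_add_norm_sq_of_inner_eq_zero _ _ h0
    rw [Finset.sum_insert hi, Finset.sum_insert hi, ← ih fun i hi j hj =>
      h i (by simp [hi]) j (by simp [hj])]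
    simpa [sq] using this

/-- The point of `π` which is closest to `s` from the right. -/
def next (π : Finset ℝ≥0∞) (s : ℝ≥0∞) : ℝ≥0∞ := (π.filter (s ≤ ·)).inf id

theorem next_le {π : Finset ℝ≥0∞} {s b : ℝ≥0∞} (hb : b ∈ π) (h : s ≤ b) : next π s ≤ b :=
  Finset.inf_le (f := id) (Finset.mem_filter.2 ⟨hb, h⟩)

theorem le_next (π : Finset ℝ≥0∞) (s : ℝ≥0∞) : s ≤ next π s :=
  Finset.le_inf fun _ hb => (Finset.mem_filter.1 hb).2

theorem next_mem {π : Finset ℝ≥0∞} {s T : ℝ≥0∞} (hT : T ∈ π) (h : s ≤ T) : next π s ∈ π := by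
  have hne : (π.filter (s ≤ ·)).Nonempty := ⟨T, Finset.mem_filter.2 ⟨hT, h⟩⟩
  obtain ⟨b, hb, e⟩ := Finset.exists_mem_eq_inf _ hne id
  rw [next, e]
  exact (Finset.mem_filter.1 hb).1

/-- Positivity of `s` covers the case of no earlier point, where the supremum defining `pred` is
`0`. -/
theorem pred_lt_iff {π : Finset ℝ≥0∞} {b s : ℝ≥0∞} (hs : 0 < s) :
    pred π b < s ↔ ∀ y ∈ π, y < b → y < s := by
  rw [pred, Finset.sup_lt_iff (by simpa using hs)]
  simp

theorem le_pred {π : Finset ℝ≥0∞} {y b : ℝ≥0∞} (hy : y ∈ π) (h : y < b) : y ≤ pred π b :=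
  Finset.le_sup (f := id) (Finset.mem_filter.2 ⟨hy, h⟩)

theorem pred_le (π : Finset ℝ≥0∞) (b : ℝ≥0∞) : pred π b ≤ b :=
  Finset.sup_le fun _ hy => (Finset.mem_filter.1 hy).2.le

/-- The cells of a partition are the fibres of the rounding-up map `next π` on positive times.
Disjointness and behaviour under refinement then become statements about maps. -/
theorem mem_Ioc_pred {π : Finset ℝ≥0∞} {b s : ℝ≥0∞} (hb : b ∈ π) :
    s ∈ Ioc (pred π b) b ↔ 0 < s ∧ s ≤ b ∧ next π s = b := by
  constructor
  · rintro ⟨h1, h2⟩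
    have hs : 0 < s := bot_le.trans_lt h1
    refine ⟨hs, h2, le_antisymm (next_le hb h2) ?_⟩
    refine Finset.le_inf fun y hy => ?_
    rw [Finset.mem_filter] at hy
    by_contra! hlt
    exact absurd ((pred_lt_iff hs).1 h1 y hy.1 hlt) (not_lt.2 hy.2)
  · rintro ⟨hs, h2, rfl⟩
    refine ⟨(pred_lt_iff hs).2 fun y hy hlt => ?_, h2⟩
    by_contra! hle
    exact absurd (next_le hy hle) (not_le.2 hlt)

theorem pairwiseDisjoint_Ioc_pred (π : Finset ℝ≥0∞) :
    (π : Set ℝ≥0∞).PairwiseDisjoint fun b => Ioc (pred π b) b := by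
  intro b hb c hc hbc
  rw [Function.onFun, Set.disjoint_left]
  intro s hs hs'
  rw [mem_Ioc_pred hb] at hs
  rw [mem_Ioc_pred hc] at hs'
  exact hbc (hs.2.2.symm.trans hs'.2.2)

theorem next_next {π₀ π : Finset ℝ≥0∞} (h : π₀ ⊆ π) {s T : ℝ≥0∞} (hT : T ∈ π₀) (hs : s ≤ T) :
    next π₀ (next π s) = next π₀ s := by
  have h1 : next π s ≤ next π₀ s := next_le (h (next_mem hT hs)) (le_next _ _)
  refine le_antisymm (next_le (next_mem hT hs) h1) ?_
  exact next_le (next_mem hT (next_le (h hT) hs)) ((le_next _ _).trans (le_next _ _))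

/-- By `next_next`, rounding up in `π₀` factors through rounding up in the finer `π`, so each coarse
cell is the union of the fine cells whose right endpoints round up to its own. -/
theorem Ioc_pred_eq_biUnion {π₀ π : Finset ℝ≥0∞} (h : π₀ ⊆ π) {T : ℝ≥0∞} (hT : T ∈ π₀)
    (hmax : ∀ b ∈ π₀, b ≤ T) {b₀ : ℝ≥0∞} (hb₀ : b₀ ∈ π₀) :
    Ioc (pred π₀ b₀) b₀ =
      ⋃ b ∈ (π.filter (0 < ·)).filter (next π₀ · = b₀), Ioc (pred π b) b := by
  ext s
  simp only [mem_iUnion, Finset.mem_filter, exists_prop]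
  constructor
  · intro hs
    obtain ⟨h1, h2, h3⟩ := (mem_Ioc_pred hb₀).1 hs
    have hsT := h2.trans (hmax _ hb₀)
    have hm := next_mem (h hT) hsT
    refine ⟨next π s, ⟨⟨hm, h1.trans_le (le_next _ _)⟩, ?_⟩,
      (mem_Ioc_pred hm).2 ⟨h1, le_next _ _, rfl⟩⟩
    rw [next_next h hT hsT, h3]
  · rintro ⟨b, ⟨⟨hb, hb0⟩, rfl⟩, hs⟩
    obtain ⟨h1, h2, rfl⟩ := (mem_Ioc_pred hb).1 hs
    have hle : next π s ≤ T := (le_next π₀ _).trans (hmax _ hb₀)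
    exact (mem_Ioc_pred hb₀).2 ⟨h1, (le_next _ _).trans (le_next _ _),
      (next_next h hT (h2.trans hle)).symm⟩

/-- The Riemann sum `∑_{j ≥ 1} Z(π_j) Q((π_{j-1}, π_j])`. -/
def projSum (Z : ℝ≥0∞ → E →L[ℂ] E) (Q : Set ℝ≥0∞ → E →L[ℂ] E) (π : Finset ℝ≥0∞) : E →L[ℂ] E :=
  ∑ b ∈ π.filter (0 < ·), Z b ∘L Q (Ioc (pred π b) b)

theorem projSum_apply (Z : ℝ≥0∞ → E →L[ℂ] E) (Q : Set ℝ≥0∞ → E →L[ℂ] E) (π : Finset ℝ≥0∞)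
    (x : E) : projSum Z Q π x = ∑ b ∈ π.filter (0 < ·), Z b (Q (Ioc (pred π b) b) x) := by
  simp [projSum]

/-- An operator-valued function `Z`, bounded by `M`, such that `Z(b)^* Z(c)` commutes with the
projections `Q([0, a])`, `a ≤ min(b, c)`. -/
structure IsOrthoIntegrand (Q : Set ℝ≥0∞ → E →L[ℂ] E) (Z : ℝ≥0∞ → E →L[ℂ] E) (M : ℝ) : Prop where
  nonneg : 0 ≤ M
  bound : ∀ b x, ‖Z b x‖ ≤ M * ‖x‖
  ortho : ∀ a b c, a ≤ b → a ≤ c → ∀ x y,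
    ⟪Z b (Q (Iic a) x), Z c y⟫_ℂ = ⟪Z b x, Z c (Q (Iic a) y)⟫_ℂ

namespace IsOrthoIntegrand

variable {Q : Set ℝ≥0∞ → E →L[ℂ] E} {Z : ℝ≥0∞ → E →L[ℂ] E} {M : ℝ}
  (hZ : IsOrthoIntegrand Q Z M) (hQ : IsProjFamily Q)
include hZ hQ

theorem ortho_Ioc {a b c d : ℝ≥0∞} (hab : a ≤ b) (hc : b ≤ c) (hd : b ≤ d) (x y : E) :
    ⟪Z c (Q (Ioc a b) x), Z d y⟫_ℂ = ⟪Z c x, Z d (Q (Ioc a b) y)⟫_ℂ := by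
  rw [hQ.Ioc_eq hab]
  simp only [sub_apply, map_sub, inner_sub_left, inner_sub_right]
  rw [hZ.ortho b c d hc hd, hZ.ortho a c d (hab.trans hc) (hab.trans hd)]

/-- The projection of the earlier cell can be moved across the inner product, where it meets that of
a disjoint cell. The evaluation times `b'`, `c'` may lie beyond the cells because a coarse Riemann
sum, rewritten over fine cells, evaluates `Z` at later points. -/
theorem inner_eq_zero {π : Finset ℝ≥0∞} {b c b' c' : ℝ≥0∞} (hb : b ∈ π) (hc : c ∈ π)
    (hbc : b ≠ c) (hb' : b ≤ b') (hc' : c ≤ c') (x y : E) :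
    ⟪Z b' (Q (Ioc (pred π b) b) x), Z c' (Q (Ioc (pred π c) c) y)⟫_ℂ = 0 := by
  wlog h : b < c generalizing b c b' c' x y
  · rw [← inner_conj_symm, this hc hb hbc.symm hc' hb' y x (hbc.lt_or_gt.resolve_left h), map_zero]
  rw [hZ.ortho_Ioc hQ (pred_le _ _) hb' (h.le.trans hc'), hQ.mul_disjoint _ _ measurableSet_Ioc
    measurableSet_Ioc (pairwiseDisjoint_Ioc_pred π hb hc hbc), map_zero, inner_zero_right]

/-- Pythagoras is used twice: for the summands, and for the projections of the disjoint cells. -/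
theorem norm_sum_le {π s : Finset ℝ≥0∞} (hs : s ⊆ π) {A : Set ℝ≥0∞} (hA : MeasurableSet A)
    (hsA : ∀ b ∈ s, Ioc (pred π b) b ⊆ A) (x : E) :
    ‖∑ b ∈ s, Z b (Q (Ioc (pred π b) b) x)‖ ≤ M * ‖Q A x‖ := by
  refine (sq_le_sq₀ (norm_nonneg _) (mul_nonneg hZ.nonneg (norm_nonneg _))).1 ?_
  rw [norm_sum_sq_of_pairwise_inner_eq_zero s _ fun b hb c hc hbc =>
    hZ.inner_eq_zero hQ (hs hb) (hs hc) hbc le_rfl le_rfl x x, mul_pow]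
  have hU : ‖Q (⋃ b ∈ s, Ioc (pred π b) b) x‖ ≤ ‖Q A x‖ :=
    hQ.norm_mono (s.measurableSet_biUnion fun _ _ => measurableSet_Ioc) hA
      (iUnion₂_subset hsA) x
  calc _ ≤ ∑ b ∈ s, M ^ 2 * ‖Q (Ioc (pred π b) b) x‖ ^ 2 := by
        refine Finset.sum_le_sum fun b _ => ?_
        rw [← mul_pow]
        exact pow_le_pow_left₀ (norm_nonneg _) (hZ.bound _ _) 2
    _ = M ^ 2 * ‖Q (⋃ b ∈ s, Ioc (pred π b) b) x‖ ^ 2 := by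
        rw [← Finset.mul_sum, hQ.sum_norm_sq s _ (fun _ => measurableSet_Ioc)
          ((pairwiseDisjoint_Ioc_pred π).subset (by exact_mod_cast hs))]
    _ ≤ _ := by gcongr

theorem norm_projSum_le (π : Finset ℝ≥0∞) (x : E) : ‖projSum Z Q π x‖ ≤ M * ‖x‖ := by
  rw [projSum_apply]
  refine (hZ.norm_sum_le hQ (Finset.filter_subset _ _) .univ (fun _ _ => subset_univ _) x).trans ?_
  exact mul_le_mul_of_nonneg_left (hQ.norm_le .univ x) hZ.nonneg

/-- Over the cells of `π` the coarse sum has the same form with `Z b` replaced by `Z (next π₀ b)`.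
The differences of terms remain pairwise orthogonal, so a relative error `ε` on each cell gives a
relative error `ε` overall, whatever the number of cells. -/
theorem norm_projSum_sub_le {π₀ π : Finset ℝ≥0∞} (h : π₀ ⊆ π) {T : ℝ≥0∞} (hT : T ∈ π₀)
    (hmax : ∀ b ∈ π, b ≤ T) {ε : ℝ} (hε : 0 ≤ ε) (x : E)
    (hx : ∀ a b, a ≤ b → b ≤ T → ‖Z b (Q (Ioc a b) x) - Z (next π₀ b) (Q (Ioc a b) x)‖ ≤
      ε * ‖Q (Ioc a b) x‖) :
    ‖projSum Z Q π x - projSum Z Q π₀ x‖ ≤ ε * ‖x‖ := by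
  have e : projSum Z Q π₀ x =
      ∑ b ∈ π.filter (0 < ·), Z (next π₀ b) (Q (Ioc (pred π b) b) x) := by
    have hmap : ∀ b ∈ π.filter (0 < ·), next π₀ b ∈ π₀.filter (0 < ·) := by
      intro b hb
      rw [Finset.mem_filter] at hb ⊢
      exact ⟨next_mem hT (hmax b hb.1), hb.2.trans_le (le_next _ _)⟩
    rw [projSum_apply, ← Finset.sum_fiberwise_of_maps_to hmap]
    refine Finset.sum_congr rfl fun b₀ hb₀ => ?_
    rw [Finset.mem_filter] at hb₀
    rw [Ioc_pred_eq_biUnion h hT (fun b hb => hmax b (h hb)) hb₀.1,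
      hQ.biUnion _ _ (fun _ => measurableSet_Ioc) ((pairwiseDisjoint_Ioc_pred π).subset
        fun b hb => by simp at hb; exact hb.1.1), sum_apply, map_sum]
    refine Finset.sum_congr rfl fun b hb => ?_
    rw [(Finset.mem_filter.1 hb).2]
  rw [e, projSum_apply, ← Finset.sum_sub_distrib]
  refine (sq_le_sq₀ (norm_nonneg _) (mul_nonneg hε (norm_nonneg _))).1 ?_
  have hsub : π.filter (0 < ·) ⊆ π := Finset.filter_subset _ _
  rw [norm_sum_sq_of_pairwise_inner_eq_zero]
  · calc _ ≤ ∑ b ∈ π.filter (0 < ·), ε ^ 2 * ‖Q (Ioc (pred π b) b) x‖ ^ 2 := by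
          refine Finset.sum_le_sum fun b hb => ?_
          rw [← mul_pow]
          exact pow_le_pow_left₀ (norm_nonneg _) (hx _ _ (pred_le _ _) (hmax _ (hsub hb))) 2
      _ = ε ^ 2 * ‖Q (⋃ b ∈ π.filter (0 < ·), Ioc (pred π b) b) x‖ ^ 2 := by
          rw [← Finset.mul_sum, hQ.sum_norm_sq _ _ (fun _ => measurableSet_Ioc)
            ((pairwiseDisjoint_Ioc_pred π).subset (by exact_mod_cast hsub))]
      _ ≤ (ε * ‖x‖) ^ 2 := by
          rw [mul_pow]
          gcongr
          exact hQ.norm_le (Finset.measurableSet_biUnion _ fun _ _ => measurableSet_Ioc) x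
  -- The four products obtained by expanding two differences all vanish, since both evaluation times
  -- are at or after the right endpoint of the cell.
  · intro b hb c hc hbc
    simp only [inner_sub_left, inner_sub_right]
    rw [hZ.inner_eq_zero hQ (hsub hb) (hsub hc) hbc le_rfl le_rfl,
      hZ.inner_eq_zero hQ (hsub hb) (hsub hc) hbc le_rfl (le_next _ _),
      hZ.inner_eq_zero hQ (hsub hb) (hsub hc) hbc (le_next _ _) le_rfl,
      hZ.inner_eq_zero hQ (hsub hb) (hsub hc) hbc (le_next _ _) (le_next _ _)]
    simp

end IsOrthoIntegrand

end RiemannSums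

/-! ### Strong limits of uniformly bounded nets. -/

section StrongLimits

variable {E : Type*} [NormedAddCommGroup E] [InnerProductSpace ℂ E]
  {ι : Type*} {l : Filter ι}

/-- Composition is not jointly continuous in the strong topology; the uniform bound on the left
factors controls `S i (T i z - L z)`. -/
theorem StrongLim.comp {S T : ι → E →L[ℂ] E} {K L : E →L[ℂ] E} {M : ℝ}
    (hM : ∀ i x, ‖S i x‖ ≤ M * ‖x‖) (hS : StrongLim l S K) (hT : StrongLim l T L) :
    StrongLim l (fun i => S i ∘L T i) (K ∘L L) := by
  intro z
  have h1 : Tendsto (fun i => S i (T i z - L z)) l (𝓝 0) := by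
    have h0 : Tendsto (fun i => M * ‖T i z - L z‖) l (𝓝 0) := by
      have := ((hT z).sub_const (L z)).norm.const_mul M
      simpa using this
    exact squeeze_zero_norm (fun i => hM i _) h0
  have := h1.add (hS (L z))
  simpa using this

variable [CompleteSpace E]

theorem exists_strongLim [NeBot l] {T : ι → E →L[ℂ] E} {M : ℝ} (hM : ∀ i x, ‖T i x‖ ≤ M * ‖x‖)
    {D : Set E} (hD : (Submodule.span ℂ D).topologicalClosure = ⊤)
    (h : ∀ x ∈ D, ∃ y, Tendsto (fun i => T i x) l (𝓝 y)) :
    ∃ L : E →L[ℂ] E, StrongLim l T L ∧ ∀ x, ‖L x‖ ≤ M * ‖x‖ := by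
  have hspan : ∀ x ∈ Submodule.span ℂ D, ∃ y, Tendsto (fun i => T i x) l (𝓝 y) := by
    intro x hx
    induction hx using Submodule.span_induction with
    | mem x hx => exact h x hx
    | zero => exact ⟨0, by simp⟩
    | add x y _ _ hx hy =>
      obtain ⟨a, ha⟩ := hx
      obtain ⟨b, hb⟩ := hy
      exact ⟨a + b, by simpa using ha.add hb⟩
    | smul c x _ hx =>
      obtain ⟨a, ha⟩ := hx
      exact ⟨c • a, by simpa using ha.const_smul c⟩
  have hall : ∀ x, ∃ y, Tendsto (fun i => T i x) l (𝓝 y) := by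
    intro x
    rw [← cauchy_map_iff_exists_tendsto, Metric.cauchy_iff]
    refine ⟨inferInstance, fun ε hε => ?_⟩
    -- No sign is imposed on `M`, so a positive upper bound is used as the divisor.
    have hM' : 0 < |M| + 1 := by positivity
    have hx : x ∈ closure (Submodule.span ℂ D : Set E) := by
      rw [← Submodule.topologicalClosure_coe, hD]; trivial
    obtain ⟨z, hz, hxz⟩ := Metric.mem_closure_iff.1 hx (ε / 4 / (|M| + 1)) (by positivity)
    obtain ⟨y, hy⟩ := hspan z hz
    have hev : ∀ᶠ i in l, dist (T i x) y < ε / 2 := by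
      filter_upwards [Metric.tendsto_nhds.1 hy (ε / 4) (by positivity)] with i hi
      have h1 : dist (T i x) (T i z) ≤ ε / 4 := by
        rw [dist_eq_norm, ← map_sub]
        refine (hM i _).trans ?_
        rw [← dist_eq_norm]
        calc M * dist x z ≤ (|M| + 1) * dist x z := by
              gcongr; exact (le_abs_self M).trans (by linarith)
          _ ≤ (|M| + 1) * (ε / 4 / (|M| + 1)) := by gcongr
          _ = ε / 4 := by field_simp
      have := dist_triangle (T i x) (T i z) y
      linarith
    refine ⟨Metric.ball y (ε / 2), hev, fun a ha b hb => ?_⟩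
    have := dist_triangle_right a b y
    rw [Metric.mem_ball] at ha hb
    linarith
  choose L hL using hall
  have hbd : ∀ x, ‖L x‖ ≤ M * ‖x‖ := fun x =>
    le_of_tendsto (hL x).norm (Eventually.of_forall fun i => hM i x)
  let L' : E →ₗ[ℂ] E :=
    { toFun := L
      map_add' := fun x y => tendsto_nhds_unique (hL (x + y)) (by simpa using (hL x).add (hL y))
      map_smul' := fun c x => tendsto_nhds_unique (hL (c • x)) (by simpa using (hL x).const_smul c) }
  exact ⟨L'.mkContinuous M hbd, hL, hbd⟩

theorem strongLim_of_total [NeBot l] {T : ι → E →L[ℂ] E} {M : ℝ} (hM : ∀ i x, ‖T i x‖ ≤ M * ‖x‖)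
    {D : Set E} (hD : (Submodule.span ℂ D).topologicalClosure = ⊤) (L : E →L[ℂ] E)
    (h : ∀ x ∈ D, Tendsto (fun i => T i x) l (𝓝 (L x))) : StrongLim l T L := by
  obtain ⟨L', hL', -⟩ := exists_strongLim hM hD fun x hx => ⟨_, h x hx⟩
  have : L' = L := ContinuousLinearMap.ext_on (Submodule.dense_iff_topologicalClosure_eq_top.2 hD)
    fun x hx => tendsto_nhds_unique (hL' x) (h x hx)
  rwa [← this]

end StrongLimits

/-! ### Partitions and the existence of the stopped limits. -/

section Convergence

instance (t : ℝ≥0∞) : Nonempty (Partition t) :=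
  ⟨⟨{0, t}, by simp, by simp, by simp⟩⟩

instance (t : ℝ≥0∞) : IsDirectedOrder (Partition t) :=
  ⟨fun π π' => ⟨⟨π.1 ∪ π'.1, Finset.mem_union_left _ π.2.1, Finset.mem_union_left _ π.2.2.1,
    fun x hx => (Finset.mem_union.1 hx).elim (π.2.2.2 x) (π'.2.2.2 x)⟩,
    Finset.subset_union_left, Finset.subset_union_right⟩⟩

theorem exists_partition (T δ : ℝ≥0) (hδ : 0 < δ) :
    ∃ π₀ : Partition (T : ℝ≥0∞), ∀ s : ℝ≥0, s ≤ T → next π₀.1 s ≤ ((s + δ : ℝ≥0) : ℝ≥0∞) := by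
  -- The mesh consists of the multiples of `δ` capped at `T`; a time `s` is rounded up to at most
  -- the multiple with index `⌈s / δ⌉`.
  let g : ℕ → ℝ≥0∞ := fun n => ((min (n * δ) T : ℝ≥0) : ℝ≥0∞)
  refine ⟨⟨insert 0 (insert (T : ℝ≥0∞) ((Finset.range (⌈T / δ⌉₊ + 1)).image g)), by simp, by simp,
    ?_⟩, fun s hs => ?_⟩
  · intro x hx
    simp only [Finset.mem_insert, Finset.mem_image] at hx
    rcases hx with rfl | rfl | ⟨n, -, rfl⟩
    · simp
    · exact le_rfl
    · exact ENNReal.coe_le_coe.2 (min_le_right _ _)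
  · have hn : ⌈s / δ⌉₊ ∈ Finset.range (⌈T / δ⌉₊ + 1) :=
      Finset.mem_range_succ_iff.2 (Nat.ceil_mono (by gcongr))
    have h1 : s ≤ min (⌈s / δ⌉₊ * δ) T :=
      le_min ((div_le_iff₀ hδ).1 (Nat.le_ceil _)) hs
    have h2 : min (⌈s / δ⌉₊ * δ) T ≤ s + δ := by
      refine (min_le_left _ _).trans ?_
      have := (Nat.ceil_lt_add_one (zero_le (a := s / δ))).le
      calc (⌈s / δ⌉₊ : ℝ≥0) * δ ≤ (s / δ + 1) * δ := by gcongr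
        _ = s + δ := by field_simp
    refine (next_le ?_ (ENNReal.coe_le_coe.2 h1)).trans (ENNReal.coe_le_coe.2 h2)
    exact Finset.mem_insert_of_mem (Finset.mem_insert_of_mem (Finset.mem_image_of_mem g hn))

/-- The restriction to `[0, T]` of a partition of `[0, U]`, where `T ≤ U`. -/
def truncPartition {T U : ℝ≥0∞} (π : Partition U) : Partition T :=
  ⟨insert 0 (insert T (π.1.filter (· ≤ T))), by simp, by simp, by
    intro x hx
    simp only [Finset.mem_insert, Finset.mem_filter] at hx
    rcases hx with rfl | rfl | hx
    exacts [zero_le, le_rfl, hx.2]⟩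

theorem eventually_mem_partition {U : ℝ≥0∞} {T : ℝ≥0∞} (h : T ≤ U) :
    ∀ᶠ π : Partition U in atTop, T ∈ π.1 := by
  filter_upwards [eventually_ge_atTop (⟨{0, T, U}, by simp, by simp, by simp [h]⟩ : Partition U)]
    with π hπ
  exact hπ (by simp)

/-- Cofinality of truncation allows Riemann sums over `[0, T]` and over `[0, U]` to be compared
along a single filter. -/
theorem tendsto_truncPartition {T U : ℝ≥0∞} (h : T ≤ U) :
    Tendsto (truncPartition : Partition U → Partition T) atTop atTop := by
  refine tendsto_atTop.2 fun π₀ => ?_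
  have hU : ∀ x ∈ insert U π₀.1, x ≤ U := by
    intro x hx
    rcases Finset.mem_insert.1 hx with rfl | hx
    exacts [le_rfl, (π₀.2.2.2 x hx).trans h]
  filter_upwards [eventually_ge_atTop (⟨insert U π₀.1, by simp [π₀.2.1], by simp, hU⟩ :
    Partition U)] with π hπ x hx
  have : x ∈ π.1 := hπ (Finset.mem_insert_of_mem hx)
  simp [truncPartition, this, π₀.2.2.2 x hx]

theorem truncPartition_eq {T U : ℝ≥0∞} {π : Partition U} (hT : T ∈ π.1) :
    (truncPartition π : Partition T).1 = π.1.filter (· ≤ T) := by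
  ext x
  simp only [truncPartition, Finset.mem_insert, Finset.mem_filter]
  constructor
  · rintro (rfl | rfl | h)
    exacts [⟨π.2.1, zero_le⟩, ⟨hT, le_rfl⟩, h]
  · exact fun h => Or.inr (Or.inr h)

theorem pred_filter_le {π : Finset ℝ≥0∞} {b T : ℝ≥0∞} (h : b ≤ T) :
    pred (π.filter (· ≤ T)) b = pred π b := by
  rw [pred, pred, Finset.filter_filter]
  congr 1
  refine Finset.filter_congr fun x _ => ⟨And.right, fun hx => ⟨hx.le.trans h, hx⟩⟩

variable {E : Type*} [NormedAddCommGroup E] [InnerProductSpace ℂ E]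
  {Q : Set ℝ≥0∞ → E →L[ℂ] E} {Z : ℝ≥0∞ → E →L[ℂ] E} {M : ℝ}

/-- When `T` is a partition point, the cells up to `T` cancel exactly and every remaining cell lies
in `(T, ∞]`. -/
theorem IsOrthoIntegrand.norm_projSum_sub_trunc_le (hZ : IsOrthoIntegrand Q Z M)
    (hQ : IsProjFamily Q) {T U : ℝ≥0∞} {π : Partition U} (hT : T ∈ π.1) (x : E) :
    ‖projSum Z Q π.1 x - projSum Z Q (truncPartition π : Partition T).1 x‖ ≤
      M * ‖Q (Ioi T) x‖ := by
  have e : projSum Z Q π.1 x - projSum Z Q (truncPartition π : Partition T).1 x =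
      ∑ b ∈ π.1.filter (T < ·), Z b (Q (Ioc (pred π.1 b) b) x) := by
    rw [truncPartition_eq hT, projSum_apply, projSum_apply,
      ← Finset.sum_filter_add_sum_filter_not (π.1.filter (0 < ·)) (· ≤ T), Finset.filter_filter,
      Finset.filter_filter, Finset.filter_filter, add_comm, add_sub_assoc]
    have h1 : π.1.filter (fun a => 0 < a ∧ ¬ a ≤ T) = π.1.filter (T < ·) := by
      refine Finset.filter_congr fun a _ => ?_
      rw [not_le]
      exact ⟨And.right, fun h => ⟨bot_le.trans_lt h, h⟩⟩
    have h2 : π.1.filter (fun a => a ≤ T ∧ 0 < a) = π.1.filter (fun a => 0 < a ∧ a ≤ T) :=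
      Finset.filter_congr fun a _ => and_comm
    rw [h1, h2, add_eq_left, sub_eq_zero]
    refine Finset.sum_congr rfl fun b hb => ?_
    rw [pred_filter_le (Finset.mem_filter.1 hb).2.2]
  rw [e]
  refine hZ.norm_sum_le hQ (Finset.filter_subset _ _) measurableSet_Ioi (fun b hb s hs => ?_) x
  exact (le_pred hT (Finset.mem_filter.1 hb).2).trans_lt hs.1

/-- The values of `Z` on `Q((a, c]) x` depend continuously on time from the right, locally
uniformly. -/
def HasModulus (Q : Set ℝ≥0∞ → E →L[ℂ] E) (Z : ℝ≥0∞ → E →L[ℂ] E) (x : E) : Prop :=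
  ∀ T : ℝ≥0, ∀ ε > 0, ∃ δ : ℝ≥0, 0 < δ ∧ ∀ a c b : ℝ≥0, a ≤ c → c ≤ b → b ≤ c + δ → b ≤ T →
    ‖Z b (Q (Ioc (a : ℝ≥0∞) c) x) - Z c (Q (Ioc (a : ℝ≥0∞) c) x)‖ ≤
      ε * ‖Q (Ioc (a : ℝ≥0∞) c) x‖

variable [CompleteSpace E]

theorem IsOrthoIntegrand.exists_tendsto (hZ : IsOrthoIntegrand Q Z M) (hQ : IsProjFamily Q) {x : E}
    (hx : HasModulus Q Z x) (T : ℝ≥0) :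
    ∃ y, Tendsto (fun π : Partition (T : ℝ≥0∞) => projSum Z Q π.1 x) atTop (𝓝 y) := by
  rw [← cauchy_map_iff_exists_tendsto, Metric.cauchy_iff]
  refine ⟨inferInstance, fun ε hε => ?_⟩
  have hε' : 0 < ε / 4 / (‖x‖ + 1) := by positivity
  obtain ⟨δ, hδ, h⟩ := hx T _ hε'
  obtain ⟨π₀, hπ₀⟩ := exists_partition T δ hδ
  have hev : ∀ᶠ π : Partition (T : ℝ≥0∞) in atTop,
      dist (projSum Z Q π.1 x) (projSum Z Q π₀.1 x) ≤ ε / 4 := by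
    filter_upwards [eventually_ge_atTop π₀] with π hπ
    rw [dist_eq_norm]
    refine (hZ.norm_projSum_sub_le hQ hπ π₀.2.2.1 π.2.2.2 hε'.le x fun a c hac hcT => ?_).trans ?_
    · lift c to ℝ≥0 using ne_top_of_le_ne_top ENNReal.coe_ne_top hcT
      lift a to ℝ≥0 using ne_top_of_le_ne_top ENNReal.coe_ne_top hac
      have hc := ENNReal.coe_le_coe.1 hcT
      have h1 := hπ₀ c hc
      have h2 := π₀.2.2.2 _ (next_mem π₀.2.2.1 hcT)
      have h3 := le_next π₀.1 (c : ℝ≥0∞)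
      lift next π₀.1 c to ℝ≥0 using ne_top_of_le_ne_top ENNReal.coe_ne_top h2 with b
      -- The cell ends at `c` and the coarse sum evaluates `Z` at `b = next π₀ c`, which lies within
      -- `δ` to the right of `c`; this is the situation of the modulus.
      rw [norm_sub_rev]
      exact h a c b (ENNReal.coe_le_coe.1 hac) (ENNReal.coe_le_coe.1 h3) (ENNReal.coe_le_coe.1 h1)
        (ENNReal.coe_le_coe.1 h2)
    · rw [div_mul_eq_mul_div, div_le_iff₀ (by positivity)]
      gcongr
      linarith
  refine ⟨Metric.closedBall (projSum Z Q π₀.1 x) (ε / 4), hev, fun a ha b hb => ?_⟩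
  have := dist_triangle_right a b (projSum Z Q π₀.1 x)
  rw [Metric.mem_closedBall] at ha hb
  linarith

/-- The tail estimate makes `Wt` strongly Cauchy as the time grows. It also identifies its limit
with the limit over partitions of `[0, ∞]`, the form in which the stopped flow is defined. -/
theorem IsOrthoIntegrand.exists_limits (hZ : IsOrthoIntegrand Q Z M) (hQ : IsProjFamily Q)
    (hinf : ∀ x, Tendsto (fun T : ℝ≥0 => Q (Ioi (T : ℝ≥0∞)) x) atTop (𝓝 0))
    {D : Set E} (hD : (Submodule.span ℂ D).topologicalClosure = ⊤)
    (hmod : ∀ x ∈ D, HasModulus Q Z x) :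
    ∃ (Wt : ℝ≥0 → E →L[ℂ] E) (W : E →L[ℂ] E),
      (∀ T : ℝ≥0, StrongLim atTop (fun π : Partition (T : ℝ≥0∞) => projSum Z Q π.1) (Wt T)) ∧
      (∀ (T : ℝ≥0) x, ‖Wt T x‖ ≤ M * ‖x‖) ∧ StrongLim atTop Wt W ∧
      StrongLim atTop (fun π : Partition ∞ => projSum Z Q π.1) W := by
  have h1 : ∀ T : ℝ≥0, ∃ L : E →L[ℂ] E,
      StrongLim atTop (fun π : Partition (T : ℝ≥0∞) => projSum Z Q π.1) L ∧
        ∀ x, ‖L x‖ ≤ M * ‖x‖ := fun T =>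
    exists_strongLim (fun π x => hZ.norm_projSum_le hQ π.1 x) hD
      fun x hx => hZ.exists_tendsto hQ (hmod x hx) T
  choose Wt hWt hbd using h1
  have hdiff : ∀ (T U : ℝ≥0), T ≤ U → ∀ x, ‖Wt U x - Wt T x‖ ≤ M * ‖Q (Ioi (T : ℝ≥0∞)) x‖ := by
    intro T U hTU x
    have hTU' := ENNReal.coe_le_coe.2 hTU
    refine le_of_tendsto ((hWt U x).sub ((hWt T x).comp (tendsto_truncPartition hTU'))).norm ?_
    filter_upwards [eventually_mem_partition hTU'] with π hπ
    exact hZ.norm_projSum_sub_trunc_le hQ hπ x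
  have hsmall : ∀ x, ∀ ε > 0, ∃ T : ℝ≥0, M * ‖Q (Ioi (T : ℝ≥0∞)) x‖ < ε := by
    intro x ε hε
    have := (hinf x).norm.const_mul M
    rw [norm_zero, mul_zero] at this
    exact (this.eventually_lt_const hε).exists
  have h2 : ∀ x, ∃ y, Tendsto (fun T => Wt T x) atTop (𝓝 y) := by
    intro x
    rw [← cauchy_map_iff_exists_tendsto, Metric.cauchy_iff]
    refine ⟨inferInstance, fun ε hε => ?_⟩
    obtain ⟨T, hT⟩ := hsmall x (ε / 2) (by positivity)
    refine ⟨Metric.ball (Wt T x) (ε / 2), ?_, fun a ha b hb => ?_⟩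
    · rw [mem_map]
      filter_upwards [eventually_ge_atTop T] with U hU
      rw [mem_preimage, Metric.mem_ball, dist_eq_norm]
      exact (hdiff T U hU x).trans_lt hT
    · have := dist_triangle_right a b (Wt T x)
      rw [Metric.mem_ball] at ha hb
      linarith
  obtain ⟨W, hW, -⟩ := exists_strongLim hbd hD fun x _ => h2 x
  refine ⟨Wt, W, hWt, hbd, hW, fun x => ?_⟩
  rw [Metric.tendsto_nhds]
  intro ε hε
  obtain ⟨T, hT⟩ := hsmall x (ε / 3) (by positivity)
  have h3 : dist (W x) (Wt T x) ≤ M * ‖Q (Ioi (T : ℝ≥0∞)) x‖ := by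
    rw [dist_eq_norm]
    refine le_of_tendsto ((hW x).sub_const (Wt T x)).norm ?_
    filter_upwards [eventually_ge_atTop T] with U hU
    exact hdiff T U hU x
  have h4 := ((hWt T x).comp (tendsto_truncPartition (U := ∞) le_top))
  filter_upwards [eventually_mem_partition (U := ∞) (T := (T : ℝ≥0∞)) le_top,
    Metric.tendsto_nhds.1 h4 (ε / 3) (by positivity)] with π hπ hd
  have h5 := hZ.norm_projSum_sub_trunc_le hQ hπ x
  rw [← dist_eq_norm] at h5
  have h6 := dist_triangle4_right (projSum Z Q π.1 x) (W x)
    (projSum Z Q (truncPartition π : Partition (T : ℝ≥0∞)).1 x) (Wt T x)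
  simp only [Function.comp_apply] at hd
  linarith

end Convergence

/-! ### Operators on Hilbert-space tensor products. -/

section Tensor

variable {A B A' B' A'' B'' : Type*} [NormedAddCommGroup A] [InnerProductSpace ℂ A]
  [NormedAddCommGroup B] [InnerProductSpace ℂ B]
  [NormedAddCommGroup A'] [InnerProductSpace ℂ A']
  [NormedAddCommGroup B'] [InnerProductSpace ℂ B']
  [NormedAddCommGroup A''] [InnerProductSpace ℂ A'']
  [NormedAddCommGroup B''] [InnerProductSpace ℂ B'']

theorem norm_opTensor_apply_le (X : A →L[ℂ] A') (Y : B →L[ℂ] B') (x : HilbertTensor A B) :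
    ‖opTensor X Y x‖ ≤ ‖X‖ * ‖Y‖ * ‖x‖ := by
  refine UniformSpace.Completion.induction_on x
    (isClosed_le (by fun_prop) (by fun_prop)) fun w => ?_
  rw [opTensor, ContinuousLinearMap.completion_apply_coe, UniformSpace.Completion.norm_coe,
    UniformSpace.Completion.norm_coe]
  exact ((TensorProduct.mapL X Y).le_opNorm w).trans (by gcongr; exact TensorProduct.norm_mapL_le X Y)

/-- The bilinear map `(a, b) ↦ a ⊗ b`, as a continuous bilinear map. -/
def tmulL (A B : Type*) [NormedAddCommGroup A] [InnerProductSpace ℂ A]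
    [NormedAddCommGroup B] [InnerProductSpace ℂ B] : A →L[ℂ] B →L[ℂ] HilbertTensor A B :=
  (ContinuousLinearMap.compL ℂ B (A ⊗[ℂ] B) (HilbertTensor A B)
    UniformSpace.Completion.toComplL).comp (TensorProduct.mkL ℂ A B)

theorem tmulL_apply (a : A) (b : B) : tmulL A B a b = tmul a b := rfl

theorem tmul_add (a : A) (b c : B) : tmul a (b + c) = tmul a b + tmul a c := by
  simp [← tmulL_apply]

theorem tmul_zero (a : A) : tmul a (0 : B) = 0 := by
  simp [← tmulL_apply]

theorem norm_tmul (a : A) (b : B) : ‖tmul a b‖ = ‖a‖ * ‖b‖ := by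
  rw [tmul, UniformSpace.Completion.norm_coe]
  exact TensorProduct.norm_tmul a b

/-- Bounded operators on a Hilbert-space tensor product agree if they agree on elementary
tensors of vectors from total families. -/
theorem tensor_ext {ι κ F : Type*} [NormedAddCommGroup F] [NormedSpace ℂ F] {a : ι → A} {b : κ → B}
    (ha : (Submodule.span ℂ (range a)).topologicalClosure = ⊤)
    (hb : (Submodule.span ℂ (range b)).topologicalClosure = ⊤)
    {X Y : HilbertTensor A B →L[ℂ] F} (h : ∀ i j, X (tmul (a i) (b j)) = Y (tmul (a i) (b j))) :
    X = Y := by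
  refine ContinuousLinearMap.ext_on
    (Submodule.dense_iff_topologicalClosure_eq_top.2 (tmul_total a b ha hb)) ?_
  rintro _ ⟨⟨i, j⟩, rfl⟩
  exact h i j

theorem tensor_ext' {F : Type*} [NormedAddCommGroup F] [NormedSpace ℂ F]
    {X Y : HilbertTensor A B →L[ℂ] F} (h : ∀ a b, X (tmul a b) = Y (tmul a b)) : X = Y :=
  tensor_ext (total_univ A) (total_univ B) h

theorem opTensor_comp (X : A →L[ℂ] A') (X' : A' →L[ℂ] A'') (Y : B →L[ℂ] B') (Y' : B' →L[ℂ] B'') :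
    opTensor (X' ∘L X) (Y' ∘L Y) = opTensor X' Y' ∘L opTensor X Y :=
  tensor_ext' fun a b => by simp [opTensor_tmul]

theorem opTensor_id :
    opTensor (ContinuousLinearMap.id ℂ A) (ContinuousLinearMap.id ℂ B) =
      ContinuousLinearMap.id ℂ _ :=
  tensor_ext' fun a b => by simp [opTensor_tmul]

/-- The form of an operator and its adjoint agree if they agree on total families. -/
theorem inner_eq_of_total {ι κ E F : Type*} [NormedAddCommGroup E] [InnerProductSpace ℂ E]
    [NormedAddCommGroup F] [InnerProductSpace ℂ F] [CompleteSpace E] [CompleteSpace F]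
    {a : ι → E} {b : κ → F}
    (ha : (Submodule.span ℂ (range a)).topologicalClosure = ⊤)
    (hb : (Submodule.span ℂ (range b)).topologicalClosure = ⊤)
    {X : E →L[ℂ] F} {Y : F →L[ℂ] E} (h : ∀ i j, ⟪X (a i), b j⟫_ℂ = ⟪a i, Y (b j)⟫_ℂ) (x : E) (y : F) :
    ⟪X x, y⟫_ℂ = ⟪x, Y y⟫_ℂ := by
  have e : ContinuousLinearMap.adjoint X = Y := by
    refine ContinuousLinearMap.ext_on (Submodule.dense_iff_topologicalClosure_eq_top.2 hb) ?_
    rintro _ ⟨j, rfl⟩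
    refine (Submodule.dense_iff_topologicalClosure_eq_top.2 ha).eq_of_inner_right ℂ fun v hv => ?_
    induction hv using Submodule.span_induction with
    | mem x hx =>
      obtain ⟨i, rfl⟩ := hx
      rw [ContinuousLinearMap.adjoint_inner_right, h]
    | zero => simp
    | add x y _ _ hx hy => rw [inner_add_left, inner_add_left, hx, hy]
    | smul a x _ hx => rw [inner_smul_left, inner_smul_left, hx]
  rw [← e, ContinuousLinearMap.adjoint_inner_right]

/-- Adjoints of the factors are given through identities of forms because the factor spaces are not
assumed complete. -/
theorem inner_opTensor {X : A →L[ℂ] A'} {Y : B →L[ℂ] B'} {X' : A' →L[ℂ] A} {Y' : B' →L[ℂ] B}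
    (hX : ∀ a b, ⟪X a, b⟫_ℂ = ⟪a, X' b⟫_ℂ) (hY : ∀ a b, ⟪Y a, b⟫_ℂ = ⟪a, Y' b⟫_ℂ)
    (x : HilbertTensor A B) (y : HilbertTensor A' B') :
    ⟪opTensor X Y x, y⟫_ℂ = ⟪x, opTensor X' Y' y⟫_ℂ := by
  refine inner_eq_of_total (tmul_total id id (total_univ A) (total_univ B))
    (tmul_total id id (total_univ A') (total_univ B')) (fun i j => ?_) x y
  simp only [id, opTensor_tmul, inner_tmul, hX, hY]

end Tensor

/-! ### The spectral measure of a stop time and its ampliation. -/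

section SpectralMeasure

variable {k : Type*} [NormedAddCommGroup k] [InnerProductSpace ℂ k] (S : QuantumStopTime k)
variable (𝔥 : Type*) [NormedAddCommGroup 𝔥] [InnerProductSpace ℂ 𝔥]

/-- The ampliation of the spectral measure `S` to `𝔥 ⊗ F`. -/
def QuantumStopTime.ampl (A : Set ℝ≥0∞) : Op 𝔥 k :=
  opTensor (ContinuousLinearMap.id ℂ 𝔥) (S.proj A)

variable {S}

theorem QuantumStopTime.proj_union {A B : Set ℝ≥0∞} (hA : MeasurableSet A) (hB : MeasurableSet B)
    (h : Disjoint A B) : S.proj (A ∪ B) = S.proj A + S.proj B := by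
  refine ContinuousLinearMap.ext fun y => ext_inner_left ℂ fun x => ?_
  obtain ⟨μ, hμ⟩ := S.complexMeasure x y
  rw [add_apply, inner_add_right, ← hμ _ hA, ← hμ _ hB, ← hμ _ (hA.union hB),
    μ.of_union h hA hB]

theorem QuantumStopTime.inner_proj {A : Set ℝ≥0∞} (hA : MeasurableSet A) (x y : FockSpace k) :
    ⟪S.proj A x, y⟫_ℂ = ⟪x, S.proj A y⟫_ℂ := by
  rw [← ContinuousLinearMap.adjoint_inner_right, ← ContinuousLinearMap.star_eq_adjoint,
    (S.isStarProjection A hA).isSelfAdjoint.star_eq]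

/-- If projections `P`, `Q` have idempotent sum, then `PQ + QP = 0`. Multiplying by `P` on the left
and on the right gives `PQ = -PQP = QP`, so `2PQ = 0`. -/
theorem QuantumStopTime.proj_mul_disjoint {A B : Set ℝ≥0∞} (hA : MeasurableSet A)
    (hB : MeasurableSet B) (h : Disjoint A B) : S.proj A ∘L S.proj B = 0 := by
  have hAB := (S.isStarProjection _ (hA.union hB)).isIdempotentElem
  rw [S.proj_union hA hB h] at hAB
  have h1 := (S.isStarProjection A hA).isIdempotentElem
  have h2 := (h1.add_iff (S.isStarProjection B hB).isIdempotentElem).1 hAB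
  have : S.proj A * S.proj B + S.proj A * S.proj B = 0 := by
    have h3 : S.proj A * (S.proj A * S.proj B + S.proj B * S.proj A) = 0 := by rw [h2, mul_zero]
    have h4 : (S.proj A * S.proj B + S.proj B * S.proj A) * S.proj A = 0 := by rw [h2, zero_mul]
    rw [mul_add, ← mul_assoc, h1.eq, ← mul_assoc] at h3
    rw [add_mul, mul_assoc (S.proj B), h1.eq] at h4
    have h5 : S.proj A * S.proj B = S.proj B * S.proj A :=
      add_right_cancel (h3.trans (h4.symm.trans (add_comm _ _)))
    rwa [← h5] at h2
  rw [← two_smul ℂ] at this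
  exact (smul_eq_zero.1 this).resolve_left two_ne_zero

theorem QuantumStopTime.ampl_tmul (A : Set ℝ≥0∞) (u : 𝔥) (ξ : FockSpace k) :
    S.ampl 𝔥 A (tmul u ξ) = tmul u (S.proj A ξ) := by
  rw [QuantumStopTime.ampl, opTensor_tmul, ContinuousLinearMap.id_apply]

variable (S) in
theorem QuantumStopTime.isProjFamily : IsProjFamily (S.ampl 𝔥) where
  symm A hA := inner_opTensor (fun _ _ => rfl) (S.inner_proj hA)
  mul_self A hA x := by
    have h : S.ampl 𝔥 A ∘L S.ampl 𝔥 A = S.ampl 𝔥 A := by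
      rw [QuantumStopTime.ampl, ← opTensor_comp, ContinuousLinearMap.id_comp]
      congr 1
      exact (S.isStarProjection A hA).isIdempotentElem
    exact congrArg (· x) h
  mul_disjoint A B hA hB h x := by
    have h : S.ampl 𝔥 A ∘L S.ampl 𝔥 B = 0 := by
      refine tensor_ext' fun u ξ => ?_
      have := congrArg (· ξ) (S.proj_mul_disjoint hA hB h)
      simp only [ContinuousLinearMap.comp_apply, zero_apply] at this
      simp [S.ampl_tmul, this, tmul_zero]
    exact congrArg (· x) h
  union A B hA hB h := tensor_ext' fun u ξ => by
    simp only [S.ampl_tmul, add_apply, S.proj_union hA hB h, tmul_add]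

theorem QuantumStopTime.norm_sq_proj {A : Set ℝ≥0∞} (hA : MeasurableSet A) (ξ : FockSpace k) :
    ((‖S.proj A ξ‖ ^ 2 : ℝ) : ℂ) = ⟪ξ, S.proj A ξ⟫_ℂ := by
  have h : S.proj A (S.proj A ξ) = S.proj A ξ :=
    congrArg (· ξ) (S.isStarProjection A hA).isIdempotentElem.eq
  have := inner_self_eq_norm_sq_to_K (𝕜 := ℂ) (S.proj A ξ)
  rw [S.inner_proj hA, h] at this
  rw [this]
  simp

theorem QuantumStopTime.proj_mono_zero {A B : Set ℝ≥0∞} (hA : MeasurableSet A)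
    (hB : MeasurableSet B) (h : A ⊆ B) (h0 : S.proj B = 0) : S.proj A = 0 := by
  have h1 := S.proj_union hA (hB.diff hA) disjoint_sdiff_right
  rw [union_sdiff_cancel h, h0] at h1
  have h2 := congrArg (S.proj A * ·) h1
  simp only [mul_zero, mul_add, (S.isStarProjection A hA).isIdempotentElem.eq] at h2
  rw [show S.proj A * S.proj (B \ A) = 0 from S.proj_mul_disjoint hA (hB.diff hA)
    disjoint_sdiff_right, add_zero] at h2
  exact h2.symm

theorem tmul_expVec_total : (Submodule.span ℂ (range fun i : 𝔥 × L2 k (Ici 0) =>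
    (tmul i.1 (expVec i.2) : HilbertTensor 𝔥 (FockSpace k)))).topologicalClosure = ⊤ :=
  tmul_total id expVec (total_univ 𝔥) expVec_total

/-- Continuity from above of the measure `A ↦ ⟪ξ, S(A) ξ⟫ = ‖S(A) ξ‖²` gives the limit along integer
times; monotonicity extends it to real times and totality to all vectors. -/
theorem QuantumStopTime.tendsto_ampl_Ioi (h : S.proj {∞} = 0)
    (x : HilbertTensor 𝔥 (FockSpace k)) :
    Tendsto (fun T : ℝ≥0 => S.ampl 𝔥 (Ioi (T : ℝ≥0∞)) x) atTop (𝓝 0) := by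
  have key : ∀ ξ, Tendsto (fun T : ℝ≥0 => ‖S.proj (Ioi (T : ℝ≥0∞)) ξ‖ ^ 2) atTop (𝓝 0) := by
    intro ξ
    have hanti : Antitone fun T : ℝ≥0 => ‖S.proj (Ioi (T : ℝ≥0∞)) ξ‖ ^ 2 := by
      intro T U hTU
      -- Taking `ℂ` as initial space and `1` as its vector transfers monotonicity from the
      -- ampliation back to `S` itself.
      have h1 := (S.isProjFamily ℂ).norm_mono measurableSet_Ioi measurableSet_Ioi
        (Ioi_subset_Ioi (ENNReal.coe_le_coe.2 hTU)) (tmul 1 ξ)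
      simp only [S.ampl_tmul, norm_tmul, norm_one, one_mul] at h1
      exact pow_le_pow_left₀ (norm_nonneg _) h1 2
    obtain ⟨μ, hμ⟩ := S.complexMeasure ξ ξ
    have h1 := μ.tendsto_vectorMeasure_iInter_atTop_nat (s := fun n : ℕ => Ioi (n : ℝ≥0∞))
      (fun m n hmn => Ioi_subset_Ioi (by exact_mod_cast hmn)) fun _ => measurableSet_Ioi
    have h2 : (⋂ n : ℕ, Ioi (n : ℝ≥0∞)) = {∞} := by
      ext s
      simp only [mem_iInter, mem_Ioi, mem_singleton_iff]
      refine ⟨fun hs => ?_, fun hs n => hs ▸ ENNReal.natCast_lt_top n⟩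
      by_contra hne
      obtain ⟨n, hn⟩ := ENNReal.exists_nat_gt hne
      exact lt_asymm hn (hs n)
    rw [h2, hμ _ (measurableSet_singleton _), h] at h1
    simp only [hμ _ measurableSet_Ioi, ← S.norm_sq_proj measurableSet_Ioi, zero_apply,
      inner_zero_right] at h1
    have h3 : Tendsto (fun n : ℕ => ‖S.proj (Ioi (n : ℝ≥0∞)) ξ‖ ^ 2) atTop (𝓝 0) := by
      have := (Complex.continuous_re.tendsto _).comp h1
      simpa [Function.comp_def, ← Complex.ofReal_pow] using this
    rw [Metric.tendsto_atTop] at h3 ⊢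
    intro ε hε
    obtain ⟨n, hn⟩ := h3 ε hε
    refine ⟨n, fun T hT => ?_⟩
    have h4 := hn n le_rfl
    have h5 := hanti hT
    rw [Real.dist_0_eq_abs, abs_of_nonneg (sq_nonneg _)] at h4 ⊢
    exact h5.trans_lt (by simpa using h4)
  refine strongLim_of_total (M := 1) (fun T x => ?_) (tmul_expVec_total (k := k) 𝔥) 0 ?_ x
  · rw [one_mul]
    exact (S.isProjFamily 𝔥).norm_le measurableSet_Ioi x
  · rintro _ ⟨⟨u, f⟩, rfl⟩
    rw [zero_apply, tendsto_zero_iff_norm_tendsto_zero]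
    have := ((key (expVec f)).sqrt).const_mul ‖u‖
    simpa [S.ampl_tmul, norm_tmul] using this

end SpectralMeasure

/-! ### Shifts, restriction and concatenation on `L²([0, ∞); k)`. -/

section Shifts

variable {k : Type*} [NormedAddCommGroup k] {A B C : Set ℝ}

theorem restr_eq_iff {h : A ⊆ C} {f g : L2 k C} :
    restr h f = restr h g ↔ f =ᵐ[volume.restrict A] g := by
  constructor
  · intro e
    exact (restr_ae f).symm.trans ((Lp.ext_iff.1 e).trans (restr_ae g))
  · exact fun e => Lp.ext ((restr_ae f).trans (e.trans (restr_ae g).symm))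

theorem restr_sub (h : A ⊆ C) (f g : L2 k C) : restr h (f - g) = restr h f - restr h g := by
  refine Lp.ext ((restr_ae _).trans ?_)
  filter_upwards [ae_mono (Measure.restrict_mono_set volume h) (Lp.coeFn_sub f g),
    Lp.coeFn_sub (restr h f) (restr h g), restr_ae (h := h) f, restr_ae (h := h) g]
    with s h1 h2 h3 h4
  rw [h1, h2, Pi.sub_apply, Pi.sub_apply, h3, h4]

/-- The left shift `(θ_t^* f)(s) = f(s + t)` on `L²([0, ∞); k)`. -/
def leftShift (t : ℝ≥0) (f : L2 k (Ici 0)) : L2 k (Ici 0) :=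
  Lp.compMeasurePreserving (fun s => s + (t : ℝ)) (measurePreserving_add t)
    (restr (isSplit t).right f)

theorem leftShift_ae (t : ℝ≥0) (f : L2 k (Ici 0)) :
    leftShift t f =ᵐ[volume.restrict (Ici 0)] fun s => f (s + t) :=
  (Lp.coeFn_compMeasurePreserving _ (measurePreserving_add (t : ℝ))).trans
    ((measurePreserving_add (t : ℝ)).quasiMeasurePreserving.ae_eq_comp (restr_ae f))

theorem leftShift_sub (t : ℝ≥0) (f g : L2 k (Ici 0)) :
    leftShift t (f - g) = leftShift t f - leftShift t g := by
  rw [leftShift, restr_sub, map_sub]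
  rfl

theorem leftShift_zero (f : L2 k (Ici 0)) : leftShift 0 f = f := by
  refine Lp.ext ((leftShift_ae 0 f).trans ?_)
  simp

theorem leftShift_add (s t : ℝ≥0) (f : L2 k (Ici 0)) :
    leftShift (s + t) f = leftShift t (leftShift s f) := by
  refine Lp.ext ((leftShift_ae _ _).trans ((leftShift_ae _ _).trans ?_).symm)
  have h : leftShift s f =ᵐ[volume.restrict (Ici (t : ℝ))] fun x => f (x + s) :=
    ae_mono (Measure.restrict_mono_set volume (isSplit t).right) (leftShift_ae s f)
  refine ((measurePreserving_add (t : ℝ)).quasiMeasurePreserving.ae_eq_comp h).trans ?_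
  filter_upwards with x
  simp [add_assoc, add_comm (t : ℝ)]

/-- The interval `[0, s + t)` is cut at `s`; the second hypothesis, translated by `s`, gives
equality on `[s, s + t)`. -/
theorem restr_left_add {s t : ℝ≥0} {f g : L2 k (Ici 0)}
    (h1 : restr (isSplit s).left f = restr (isSplit s).left g)
    (h2 : restr (isSplit t).left (leftShift s f) = restr (isSplit t).left (leftShift s g)) :
    restr (isSplit (s + t)).left f = restr (isSplit (s + t)).left g := by
  rw [restr_eq_iff] at h1 h2 ⊢
  have hle := Measure.restrict_mono_set volume (isSplit t).left
  have hf : leftShift s f =ᵐ[volume.restrict (Ico 0 (t : ℝ))] fun x => f (x + s) :=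
    ae_mono hle (leftShift_ae s f)
  have hg : leftShift s g =ᵐ[volume.restrict (Ico 0 (t : ℝ))] fun x => g (x + s) :=
    ae_mono hle (leftShift_ae s g)
  have h3 : (fun x => f (x + s)) =ᵐ[volume.restrict (Ico 0 (t : ℝ))] fun x => g (x + s) :=
    hf.symm.trans (h2.trans hg)
  have hmp : MeasurePreserving (fun x : ℝ => x - s)
      (volume.restrict (Ico (s : ℝ) (s + t))) (volume.restrict (Ico 0 (t : ℝ))) := by
    have h := (measurePreserving_sub_right (volume : Measure ℝ) (s : ℝ)).restrict_preimage
      (measurableSet_Ico (a := (0 : ℝ)) (b := (t : ℝ)))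
    have e : (fun x : ℝ => x - s) ⁻¹' Ico 0 (t : ℝ) = Ico (s : ℝ) (s + t) := by
      ext x; simp [add_comm]
    rwa [e] at h
  have h4 : f =ᵐ[volume.restrict (Ico (s : ℝ) (s + t))] g := by
    have := hmp.quasiMeasurePreserving.ae_eq_comp h3
    filter_upwards [this] with x hx
    simpa using hx
  have hU : Ico 0 ((s + t : ℝ≥0) : ℝ) = Ico 0 (s : ℝ) ∪ Ico (s : ℝ) (s + t) := by
    rw [Ico_union_Ico_eq_Ico s.coe_nonneg (by simp)]
    simp
  rw [hU]
  exact ae_restrict_union_iff _ _ _ |>.2 ⟨h1, h4⟩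

variable [InnerProductSpace ℂ k]

theorem IsSplit.norm_sq_eq (h : IsSplit A B C) (f : L2 k C) :
    ‖f‖ ^ 2 = ‖restr h.left f‖ ^ 2 + ‖restr h.right f‖ ^ 2 := by
  have := h.inner_eq f f
  simp only [inner_self_eq_norm_sq_to_K] at this
  exact_mod_cast this

theorem IsSplit.ext (h : IsSplit A B C) {f g : L2 k C} (h1 : restr h.left f = restr h.left g)
    (h2 : restr h.right f = restr h.right g) : f = g := by
  have := h.norm_sq_eq (f - g)
  rw [restr_sub, restr_sub, h1, h2, sub_self, sub_self] at this
  simpa [sub_eq_zero] using this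

theorem rightShift_leftShift (t : ℝ≥0) (f : L2 k (Ici 0)) :
    rightShift t (leftShift t f) = restr (isSplit t).right f := by
  refine Lp.ext ?_
  have h1 := Lp.coeFn_compMeasurePreserving (leftShift t f) (measurePreserving_sub (t : ℝ))
  have h2 := (measurePreserving_sub (t : ℝ)).quasiMeasurePreserving.ae_eq_comp (leftShift_ae t f)
  refine h1.trans (h2.trans ?_)
  filter_upwards [restr_ae (h := (isSplit t).right) f] with s hs
  simp [hs]

theorem norm_sq_eq_leftShift (t : ℝ≥0) (f : L2 k (Ici 0)) :
    ‖f‖ ^ 2 = ‖restr (isSplit t).left f‖ ^ 2 + ‖leftShift t f‖ ^ 2 := by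
  rw [(isSplit t).norm_sq_eq f, ← rightShift_leftShift, LinearIsometry.norm_map]

theorem norm_leftShift_le (t : ℝ≥0) (f : L2 k (Ici 0)) : ‖leftShift t f‖ ≤ ‖f‖ := by
  refine (sq_le_sq₀ (norm_nonneg _) (norm_nonneg _)).1 ?_
  rw [norm_sq_eq_leftShift t f]
  exact le_add_of_nonneg_left (sq_nonneg _)

theorem norm_restr_left_le (t : ℝ≥0) (f : L2 k (Ici 0)) : ‖restr (isSplit t).left f‖ ≤ ‖f‖ := by
  refine (sq_le_sq₀ (norm_nonneg _) (norm_nonneg _)).1 ?_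
  rw [norm_sq_eq_leftShift t f]
  exact le_add_of_nonneg_right (sq_nonneg _)

theorem ext_leftShift {t : ℝ≥0} {f g : L2 k (Ici 0)}
    (h1 : restr (isSplit t).left f = restr (isSplit t).left g)
    (h2 : leftShift t f = leftShift t g) : f = g := by
  refine (isSplit t).ext h1 ?_
  rw [← rightShift_leftShift, ← rightShift_leftShift, h2]

/-- The function which is `h` on `[0, t)` and the right shift of `g` on `[t, ∞)`. -/
def concat (t : ℝ≥0) (h : L2 k (Ico 0 (t : ℝ))) (g : L2 k (Ici 0)) : L2 k (Ici 0) :=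
  ((isSplit t).exists_glue h (rightShift t g)).choose

theorem restr_concat (t : ℝ≥0) (h : L2 k (Ico 0 (t : ℝ))) (g : L2 k (Ici 0)) :
    restr (isSplit t).left (concat t h g) = h :=
  ((isSplit t).exists_glue h (rightShift t g)).choose_spec.1

theorem restr_right_concat (t : ℝ≥0) (h : L2 k (Ico 0 (t : ℝ))) (g : L2 k (Ici 0)) :
    restr (isSplit t).right (concat t h g) = rightShift t g :=
  ((isSplit t).exists_glue h (rightShift t g)).choose_spec.2

theorem leftShift_concat (t : ℝ≥0) (h : L2 k (Ico 0 (t : ℝ))) (g : L2 k (Ici 0)) :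
    leftShift t (concat t h g) = g :=
  (rightShift (k := k) (t : ℝ)).injective (by rw [rightShift_leftShift, restr_right_concat])

theorem concat_restr_leftShift (t : ℝ≥0) (f : L2 k (Ici 0)) :
    concat t (restr (isSplit t).left f) (leftShift t f) = f :=
  ext_leftShift (restr_concat _ _ _) (leftShift_concat _ _ _)

theorem concat_zero (h : L2 k (Ico 0 ((0 : ℝ≥0) : ℝ))) (g : L2 k (Ici 0)) : concat 0 h g = g := by
  rw [← leftShift_zero (concat 0 h g), leftShift_concat]

/-- Both sides agree before time `s + t` and have the same left shift. This underlies the semigroup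
law of the flow. -/
theorem concat_add (s t : ℝ≥0) (f g : L2 k (Ici 0)) :
    concat (s + t) (restr (isSplit (s + t)).left f) g =
      concat s (restr (isSplit s).left f)
        (concat t (restr (isSplit t).left (leftShift s f)) g) := by
  refine ext_leftShift (t := s + t) ?_ ?_
  · rw [restr_concat]
    refine restr_left_add ?_ ?_
    · rw [restr_concat]
    · rw [leftShift_concat, restr_concat]
  · rw [leftShift_concat, leftShift_add, leftShift_concat, leftShift_concat]

/-- Extended by zero to `ℝ`, `f` has a continuous orbit under translations in `L²(ℝ; k)`;
restriction to the half-line is continuous and recovers the left shift. -/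
theorem continuous_leftShift (f : L2 k (Ici 0)) : Continuous fun t : ℝ≥0 => leftShift t f := by
  let F : Lp k 2 (volume : Measure ℝ) :=
    ((memLp_indicator_iff_restrict measurableSet_Ici).2 (Lp.memLp f)).toLp ((Ici 0).indicator f)
  have hF : F =ᵐ[volume] (Ici (0 : ℝ)).indicator f := MemLp.coeFn_toLp _
  have hmp : ∀ t : ℝ≥0, MeasurePreserving (fun s : ℝ => s + (t : ℝ)) volume volume :=
    fun t => measurePreserving_add_right volume (t : ℝ)
  let τ : ℝ≥0 → C(ℝ, ℝ) := fun t => ⟨fun s => s + (t : ℝ), by fun_prop⟩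
  have hτ : Continuous τ := by
    refine ContinuousMap.continuous_of_continuous_uncurry _ ?_
    simp only [τ, Function.uncurry_def, ContinuousMap.coe_mk]
    fun_prop
  have hc : Continuous fun t : ℝ≥0 => Lp.compMeasurePreserving (τ t) (hmp t) F :=
    continuous_const.compMeasurePreservingLp hτ hmp (by simp)
  have e : ∀ t : ℝ≥0, leftShift t f = LpToLpRestrictCLM ℝ k ℂ volume 2 (Ici 0)
      (Lp.compMeasurePreserving (τ t) (hmp t) F) := by
    intro t
    refine Lp.ext ((leftShift_ae t f).trans ?_)
    have h1 := LpToLpRestrictCLM_coeFn (p := 2) (μ := volume) ℂ (Ici (0 : ℝ))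
      (Lp.compMeasurePreserving (τ t) (hmp t) F)
    refine (h1.trans ?_).symm
    have h2 := (Lp.coeFn_compMeasurePreserving F (hmp t)).trans
      ((hmp t).quasiMeasurePreserving.ae_eq_comp hF)
    filter_upwards [ae_restrict_of_ae h2, ae_restrict_mem measurableSet_Ici] with s hs hs0
    have : (0 : ℝ) ≤ s + t := add_nonneg hs0 t.coe_nonneg
    refine hs.trans ?_
    simp [this]
  simp only [e]
  exact (ContinuousLinearMap.continuous _).comp hc

/-- By Pythagoras, the norm over `[0, t)` is determined by the norm of the left shift, so continuity
of the latter suffices. -/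
theorem tendsto_norm_restr_left (f : L2 k (Ici 0)) :
    Tendsto (fun t : ℝ≥0 => ‖restr (isSplit t).left f‖) (𝓝 0) (𝓝 0) := by
  have h : ∀ t : ℝ≥0, ‖restr (isSplit t).left f‖ = √(‖f‖ ^ 2 - ‖leftShift t f‖ ^ 2) := by
    intro t
    rw [norm_sq_eq_leftShift t f, add_sub_cancel_right, Real.sqrt_sq (norm_nonneg _)]
  simp only [h]
  have := ((((continuous_leftShift f).tendsto 0).norm.pow 2).const_sub (‖f‖ ^ 2)).sqrt
  simpa [leftShift_zero] using this

theorem tendsto_concat (f g : L2 k (Ici 0)) :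
    Tendsto (fun t : ℝ≥0 => concat t (restr (isSplit t).left f) g) (𝓝 0) (𝓝 g) := by
  rw [tendsto_iff_norm_sub_tendsto_zero]
  have h : ∀ t : ℝ≥0, ‖concat t (restr (isSplit t).left f) g - g‖ =
      √(‖restr (isSplit t).left (f - g)‖ ^ 2 + ‖g - leftShift t g‖ ^ 2) := by
    intro t
    rw [← Real.sqrt_sq (norm_nonneg (concat t (restr (isSplit t).left f) g - g)),
      norm_sq_eq_leftShift t, restr_sub, leftShift_sub, restr_concat, leftShift_concat, restr_sub]
  simp only [h]
  have h1 := (tendsto_norm_restr_left (f - g)).pow 2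
  have h2 := (((continuous_leftShift g).tendsto 0).const_sub g).norm.pow 2
  simpa [leftShift_zero] using (h1.add h2).sqrt

end Shifts

/-! ### Norms and continuity of exponential vectors. -/

section Fock

variable {H : Type*} [NormedAddCommGroup H] [InnerProductSpace ℂ H]

theorem norm_sq_expVec (f : H) : ‖expVec f‖ ^ 2 = Real.exp (‖f‖ ^ 2) := by
  have h := inner_expVec f f
  rw [inner_self_eq_norm_sq_to_K, inner_self_eq_norm_sq_to_K] at h
  have h' : ((‖expVec f‖ ^ 2 : ℝ) : ℂ) = ((Real.exp (‖f‖ ^ 2) : ℝ) : ℂ) := by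
    push_cast
    exact h
  exact_mod_cast h'

theorem one_le_norm_expVec (f : H) : 1 ≤ ‖expVec f‖ := by
  refine (sq_le_sq₀ zero_le_one (norm_nonneg _)).1 ?_
  rw [norm_sq_expVec, one_pow]
  exact Real.one_le_exp (sq_nonneg _)

theorem norm_expVec_le {H' : Type*} [NormedAddCommGroup H'] [InnerProductSpace ℂ H'] {f : H}
    {g : H'} (h : ‖f‖ ≤ ‖g‖) : ‖expVec f‖ ≤ ‖expVec g‖ := by
  refine (sq_le_sq₀ (norm_nonneg _) (norm_nonneg _)).1 ?_
  rw [norm_sq_expVec, norm_sq_expVec]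
  gcongr

theorem norm_expVec_zero : ‖expVec (0 : H)‖ = 1 := by
  have := norm_sq_expVec (0 : H)
  rw [norm_zero, zero_pow two_ne_zero, Real.exp_zero] at this
  exact (pow_eq_one_iff_of_nonneg (norm_nonneg _) two_ne_zero).1 this

theorem continuous_expVec : Continuous (expVec : H → Fock H) := by
  rw [continuous_iff_continuousAt]
  intro f
  rw [ContinuousAt, tendsto_iff_norm_sub_tendsto_zero]
  -- The distance is an explicit continuous function of `g`, through the exponential kernel.
  have h : ∀ g : H, ‖expVec g - expVec f‖ =
      √(Real.exp (‖g‖ ^ 2) - 2 * (Complex.exp ⟪g, f⟫_ℂ).re + Real.exp (‖f‖ ^ 2)) := by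
    intro g
    rw [← Real.sqrt_sq (norm_nonneg (expVec g - expVec f)), norm_sub_sq (𝕜 := ℂ), norm_sq_expVec,
      norm_sq_expVec, inner_expVec]
    rfl
  simp only [h]
  have hc : Continuous fun g : H =>
      √(Real.exp (‖g‖ ^ 2) - 2 * (Complex.exp ⟪g, f⟫_ℂ).re + Real.exp (‖f‖ ^ 2)) := by
    fun_prop
  have h0 := hc.tendsto f
  rwa [← h f, sub_self, norm_zero] at h0

end Fock

/-! ### The CCR flow through embeddings of the future, and its commutation with the past. -/

section Flow

variable {k : Type*} [NormedAddCommGroup k] [InnerProductSpace ℂ k]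
variable {𝔥 : Type*} [NormedAddCommGroup 𝔥] [InnerProductSpace ℂ 𝔥]

theorem op_ext {X Y : Op 𝔥 k}
    (h : ∀ (u : 𝔥) (f : L2 k (Ici 0)), X (tmul u (expVec f)) = Y (tmul u (expVec f))) : X = Y :=
  tensor_ext (total_univ 𝔥) expVec_total h

variable (𝔥) in
/-- The isometric embedding `y ↦ ξ ⊗ Γ_t y` of `𝔥 ⊗ F` into `𝔥 ⊗ F ≅ F_{t)} ⊗ (𝔥 ⊗ F_{[t})`, up to
the factor `‖ξ‖`. -/
def embed (t : ℝ≥0) (ξ : FockPast k t) : Op 𝔥 k :=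
  (splitRight 𝔥 (isSplit t)).toContinuousLinearEquiv.toContinuousLinearMap ∘L
    tmulL (FockPast k t) (HilbertTensor 𝔥 (FockFuture k t)) ξ ∘L
    opTensor (ContinuousLinearMap.id ℂ 𝔥) (fockShift (k := k) t : FockSpace k →L[ℂ] FockFuture k t)

theorem embed_apply (t : ℝ≥0) (ξ : FockPast k t) (y : HilbertTensor 𝔥 (FockSpace k)) :
    embed 𝔥 t ξ y = splitRight 𝔥 (isSplit t) (tmul ξ (opTensor (ContinuousLinearMap.id ℂ 𝔥)
      (fockShift (k := k) t : FockSpace k →L[ℂ] FockFuture k t) y)) := rfl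

theorem norm_ampl_fockShift (t : ℝ≥0) (y : HilbertTensor 𝔥 (FockSpace k)) :
    ‖opTensor (ContinuousLinearMap.id ℂ 𝔥)
      (fockShift (k := k) t : FockSpace k →L[ℂ] FockFuture k t) y‖ = ‖y‖ := by
  have h : ∀ z w, ⟪opTensor (ContinuousLinearMap.id ℂ 𝔥)
      (fockShift (k := k) t : FockSpace k →L[ℂ] FockFuture k t) z, w⟫_ℂ =
      ⟪z, opTensor (ContinuousLinearMap.id ℂ 𝔥)
        ((fockShift (k := k) t).symm : FockFuture k t →L[ℂ] FockSpace k) w⟫_ℂ :=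
    inner_opTensor (fun _ _ => rfl) fun a b => by
      simpa using LinearIsometryEquiv.inner_map_eq_flip (fockShift (k := k) t) a b
  have h2 : opTensor (ContinuousLinearMap.id ℂ 𝔥)
        ((fockShift (k := k) t).symm : FockFuture k t →L[ℂ] FockSpace k)
      (opTensor (ContinuousLinearMap.id ℂ 𝔥)
        (fockShift (k := k) t : FockSpace k →L[ℂ] FockFuture k t) y) = y := by
    rw [← ContinuousLinearMap.comp_apply, ← opTensor_comp]
    have e : ((fockShift (k := k) t).symm : FockFuture k t →L[ℂ] FockSpace k) ∘L
        (fockShift (k := k) t : FockSpace k →L[ℂ] FockFuture k t) =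
        ContinuousLinearMap.id ℂ _ := by ext; simp
    rw [e, ContinuousLinearMap.id_comp, opTensor_id, ContinuousLinearMap.id_apply]
  have h3 := h y (opTensor (ContinuousLinearMap.id ℂ 𝔥)
    (fockShift (k := k) t : FockSpace k →L[ℂ] FockFuture k t) y)
  rw [h2, inner_self_eq_norm_sq_to_K, inner_self_eq_norm_sq_to_K] at h3
  rw [← sq_eq_sq₀ (norm_nonneg _) (norm_nonneg _)]
  exact_mod_cast h3

theorem norm_embed (t : ℝ≥0) (ξ : FockPast k t) (y : HilbertTensor 𝔥 (FockSpace k)) :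
    ‖embed 𝔥 t ξ y‖ = ‖ξ‖ * ‖y‖ := by
  rw [embed_apply, LinearIsometryEquiv.norm_map, norm_tmul, norm_ampl_fockShift]

theorem embed_expVec (t : ℝ≥0) (h : L2 k (Ico 0 (t : ℝ))) (u : 𝔥) (g : L2 k (Ici 0)) :
    embed 𝔥 t (expVec h) (tmul u (expVec g)) = tmul u (expVec (concat t h g)) := by
  rw [embed_apply, opTensor_tmul, ContinuousLinearMap.id_apply]
  have e := splitRight_apply 𝔥 (isSplit t) u (concat t h g)
  rw [restr_concat, restr_right_concat] at e
  rw [← e]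
  congr 3
  exact fockShift_expVec (t : ℝ) g

/-- At each time `t`, every vector of the total family lies in the range of an embedding, so
identities for the flow need only be checked on embedded vectors. -/
theorem tmul_expVec_eq_embed (t : ℝ≥0) (u : 𝔥) (f : L2 k (Ici 0)) :
    (tmul u (expVec f) : HilbertTensor 𝔥 (FockSpace k)) =
      embed 𝔥 t (expVec (restr (isSplit t).left f)) (tmul u (expVec (leftShift t f))) := by
  rw [embed_expVec, concat_restr_leftShift]

/-- The embeddings intertwine `X` and `σ_t(X)`. Multiplicativity, the semigroup law and strong
continuity of the flow are all read off from this relation. -/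
theorem ccrFlow_embed (t : ℝ≥0) (X : Op 𝔥 k) (ξ : FockPast k t)
    (y : HilbertTensor 𝔥 (FockSpace k)) : ccrFlow t X (embed 𝔥 t ξ y) = embed 𝔥 t ξ (X y) := by
  rw [embed_apply, ccrFlow, LinearIsometryEquiv.conjStarAlgEquiv_apply_apply,
    LinearIsometryEquiv.symm_apply_apply, opTensor_tmul, embed_apply]
  congr 2
  simp only [ContinuousLinearMap.comp_apply]
  congr 2
  rw [← ContinuousLinearMap.comp_apply, ← opTensor_comp]
  have e : ((fockShift (k := k) t).symm : FockFuture k t →L[ℂ] FockSpace k) ∘L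
      (fockShift (k := k) t : FockSpace k →L[ℂ] FockFuture k t) =
      ContinuousLinearMap.id ℂ _ := by ext; simp
  rw [e, ContinuousLinearMap.id_comp, opTensor_id, ContinuousLinearMap.id_apply]

theorem ccrFlow_tmul_expVec (t : ℝ≥0) (X : Op 𝔥 k) (u : 𝔥) (f : L2 k (Ici 0)) :
    ccrFlow t X (tmul u (expVec f)) =
      embed 𝔥 t (expVec (restr (isSplit t).left f)) (X (tmul u (expVec (leftShift t f)))) := by
  rw [tmul_expVec_eq_embed t u f, ccrFlow_embed]

theorem ccrFlow_comp (t : ℝ≥0) (X Y : Op 𝔥 k) :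
    ccrFlow t (X ∘L Y) = ccrFlow t X ∘L ccrFlow t Y :=
  op_ext fun u f => by
    rw [ContinuousLinearMap.comp_apply, ccrFlow_tmul_expVec, ccrFlow_tmul_expVec, ccrFlow_embed]
    rfl

theorem ccrFlow_sub (t : ℝ≥0) (X Y : Op 𝔥 k) :
    ccrFlow t (X - Y) = ccrFlow t X - ccrFlow t Y :=
  op_ext fun u f => by simp only [sub_apply, ccrFlow_tmul_expVec, map_sub]

theorem norm_ccrFlow_apply_le (t : ℝ≥0) (X : Op 𝔥 k) (x : HilbertTensor 𝔥 (FockSpace k)) :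
    ‖ccrFlow t X x‖ ≤ ‖X‖ * ‖x‖ := by
  rw [ccrFlow, LinearIsometryEquiv.conjStarAlgEquiv_apply_apply, LinearIsometryEquiv.norm_map]
  refine (norm_opTensor_apply_le _ _ _).trans ?_
  rw [LinearIsometryEquiv.norm_map]
  refine mul_le_mul_of_nonneg_right ?_ (norm_nonneg _)
  refine (mul_le_of_le_one_left (norm_nonneg _) ContinuousLinearMap.norm_id_le).trans ?_
  refine ContinuousLinearMap.opNorm_le_bound _ (norm_nonneg X) fun y => ?_
  simp only [ContinuousLinearMap.comp_apply]
  rw [norm_ampl_fockShift]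
  refine (X.le_opNorm _).trans (mul_le_mul_of_nonneg_left ?_ (norm_nonneg _))
  refine (norm_opTensor_apply_le _ _ _).trans (mul_le_of_le_one_left (norm_nonneg _) ?_)
  refine mul_le_one₀ ContinuousLinearMap.norm_id_le (norm_nonneg _) ?_
  refine ContinuousLinearMap.opNorm_le_bound _ zero_le_one fun y => ?_
  simp

theorem embed_add (s t : ℝ≥0) (f : L2 k (Ici 0)) :
    embed 𝔥 (s + t) (expVec (restr (isSplit (s + t)).left f)) =
      embed 𝔥 s (expVec (restr (isSplit s).left f)) ∘L
        embed 𝔥 t (expVec (restr (isSplit t).left (leftShift s f))) :=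
  op_ext fun u g => by
    rw [ContinuousLinearMap.comp_apply, embed_expVec, embed_expVec, embed_expVec, concat_add]

theorem ccrFlow_add (s t : ℝ≥0) (X : Op 𝔥 k) : ccrFlow (s + t) X = ccrFlow s (ccrFlow t X) :=
  op_ext fun u f => by
    rw [ccrFlow_tmul_expVec, ccrFlow_tmul_expVec, ccrFlow_tmul_expVec, embed_add, leftShift_add]
    rfl

theorem embed_zero (h : L2 k (Ico 0 ((0 : ℝ≥0) : ℝ))) :
    embed 𝔥 0 (expVec h) = ContinuousLinearMap.id ℂ _ :=
  op_ext fun u g => by rw [embed_expVec, concat_zero]; rfl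

theorem ccrFlow_zero (X : Op 𝔥 k) : ccrFlow 0 X = X :=
  op_ext fun u f => by rw [ccrFlow_tmul_expVec, embed_zero, leftShift_zero]; rfl

theorem continuous_tmul_expVec (u : 𝔥) : Continuous fun f : L2 k (Ici 0) =>
    (tmul u (expVec f) : HilbertTensor 𝔥 (FockSpace k)) :=
  (tmulL 𝔥 (FockSpace k) u).continuous.comp continuous_expVec

/-- As `t → 0` the prepended piece of `f` and the shift by `t` both disappear, and the embeddings
are bounded by `‖ε(f)‖`. -/
theorem tendsto_embed (f : L2 k (Ici 0)) :
    StrongLim (𝓝 0) (fun t : ℝ≥0 => embed 𝔥 t (expVec (restr (isSplit t).left f)))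
      (ContinuousLinearMap.id ℂ _) := by
  refine strongLim_of_total (M := ‖expVec f‖) (fun t x => ?_) (tmul_expVec_total (k := k) 𝔥) _ ?_
  · rw [norm_embed]
    exact mul_le_mul_of_nonneg_right (norm_expVec_le (norm_restr_left_le t f)) (norm_nonneg _)
  · rintro _ ⟨⟨u, g⟩, rfl⟩
    simp only [embed_expVec, ContinuousLinearMap.id_apply]
    exact ((continuous_tmul_expVec u).tendsto g).comp (tendsto_concat f g)

theorem tendsto_ccrFlow (X : Op 𝔥 k) : StrongLim (𝓝 0) (fun t : ℝ≥0 => ccrFlow t X) X := by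
  refine strongLim_of_total (M := ‖X‖) (fun t x => norm_ccrFlow_apply_le t X x)
    (tmul_expVec_total (k := k) 𝔥) _ ?_
  rintro _ ⟨⟨u, f⟩, rfl⟩
  simp only [ccrFlow_tmul_expVec]
  have h1 : Tendsto (fun t : ℝ≥0 => X (tmul u (expVec (leftShift t f)))) (𝓝 0)
      (𝓝 (X (tmul u (expVec f)))) := by
    have := ((X.continuous.comp (continuous_tmul_expVec u)).comp
      (continuous_leftShift f)).tendsto 0
    simpa [leftShift_zero, Function.comp_def] using this
  have h2 : Tendsto (fun t : ℝ≥0 => embed 𝔥 t (expVec (restr (isSplit t).left f))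
      (X (tmul u (expVec (leftShift t f))) - X (tmul u (expVec f)))) (𝓝 0) (𝓝 0) := by
    have h0 : Tendsto (fun t : ℝ≥0 => ‖expVec f‖ *
        ‖X (tmul u (expVec (leftShift t f))) - X (tmul u (expVec f))‖) (𝓝 0) (𝓝 0) := by
      simpa using (h1.sub_const (X (tmul u (expVec f)))).norm.const_mul ‖expVec f‖
    refine squeeze_zero_norm (fun t => ?_) h0
    rw [norm_embed]
    exact mul_le_mul_of_nonneg_right (norm_expVec_le (norm_restr_left_le t f)) (norm_nonneg _)
  have h3 := h2.add (tendsto_embed f (X (tmul u (expVec f))))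
  simpa using h3

/-- `B(F_{t)}) ⊗ I_{[t}` acts on the first tensor factor of `F_{t)} ⊗ (𝔥 ⊗ F_{[t})`. -/
theorem ampl_pastOp_embed (t : ℝ≥0) (Y : FockPast k t →L[ℂ] FockPast k t) (ξ : FockPast k t)
    (y : HilbertTensor 𝔥 (FockSpace k)) :
    opTensor (ContinuousLinearMap.id ℂ 𝔥) (pastOp t Y) (embed 𝔥 t ξ y) = embed 𝔥 t (Y ξ) y := by
  -- Here `η` must be arbitrary, since `Y` does not preserve exponential vectors. Both sides are
  -- continuous and linear in `η`, so exponential `η` suffice for the proof.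
  have h1 : ∀ (η : FockPast k t) (u : 𝔥) (g : L2 k (Ici 0)),
      embed 𝔥 t η (tmul u (expVec g)) = tmul u (fockSplit (isSplit t) (tmul η
        (expVec (rightShift t g)))) := by
    intro η u g
    let L : FockPast k t →L[ℂ] HilbertTensor 𝔥 (FockSpace k) :=
      (splitRight 𝔥 (isSplit t)).toContinuousLinearEquiv.toContinuousLinearMap ∘L
        (tmulL (FockPast k t) (HilbertTensor 𝔥 (FockFuture k t))).flip
          (tmul u (expVec (rightShift t g)))
    let R : FockPast k t →L[ℂ] HilbertTensor 𝔥 (FockSpace k) :=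
      tmulL 𝔥 (FockSpace k) u ∘L
        (fockSplit (isSplit t)).toContinuousLinearEquiv.toContinuousLinearMap ∘L
        (tmulL (FockPast k t) (FockFuture k t)).flip (expVec (rightShift t g))
    have hLR : L = R := by
      refine ContinuousLinearMap.ext_on
        (Submodule.dense_iff_topologicalClosure_eq_top.2 expVec_total) ?_
      rintro _ ⟨h, rfl⟩
      have e1 := splitRight_apply 𝔥 (isSplit t) u (concat t h g)
      have e2 := fockSplit_apply (isSplit t) (concat t h g)
      rw [restr_concat, restr_right_concat] at e1 e2
      exact e1.trans (congrArg (tmul u) e2).symm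
    have hL : embed 𝔥 t η (tmul u (expVec g)) = L η := by
      rw [embed_apply, opTensor_tmul, ContinuousLinearMap.id_apply]
      have e : (fockShift (k := k) t : FockSpace k →L[ℂ] FockFuture k t) (expVec g) =
        expVec (rightShift t g) := fockShift_expVec (t : ℝ) g
      rw [e]
      rfl
    rw [hL, hLR]
    rfl
  have h2 : opTensor (ContinuousLinearMap.id ℂ 𝔥) (pastOp t Y) ∘L embed 𝔥 t ξ =
      embed 𝔥 t (Y ξ) := by
    refine op_ext fun u g => ?_
    rw [ContinuousLinearMap.comp_apply, h1, opTensor_tmul, h1, pastOp,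
      LinearIsometryEquiv.conjStarAlgEquiv_apply_apply, LinearIsometryEquiv.symm_apply_apply,
      opTensor_tmul]
    rfl
  exact congrArg (· y) h2

/-- Adaptedness at positive times is combined with the scalar value of `S({0})`, which covers `a =
0`. -/
theorem QuantumStopTime.exists_pastOp (S : QuantumStopTime k) {a : ℝ≥0∞} {t : ℝ≥0}
    (h : a ≤ t) : ∃ Y : FockPast k t →L[ℂ] FockPast k t, S.proj (Iic a) = pastOp t Y := by
  lift a to ℝ≥0 using ne_top_of_le_ne_top ENNReal.coe_ne_top h
  rcases eq_or_ne a 0 with rfl | ha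
  · obtain ⟨c, hc⟩ := S.adapted_zero
    refine ⟨c • ContinuousLinearMap.id ℂ _, ?_⟩
    have e : Iic ((0 : ℝ≥0) : ℝ≥0∞) = {0} := by ext; simp
    rw [e, hc]
    refine ext_expVec fun f g => ?_
    rw [inner_pastOp]
    simp only [smul_apply, ContinuousLinearMap.id_apply, inner_smul_right, inner_expVec]
    rw [mul_assoc, ← Complex.exp_add, (isSplit t).inner_eq]
  · obtain ⟨Y, hY⟩ := S.adapted a (pos_iff_ne_zero.2 ha)
    obtain ⟨Z, hZ⟩ := pastOp_mono (ENNReal.coe_le_coe.1 h) Y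
    exact ⟨Z, hY.trans hZ⟩

theorem pastOp_sub (t : ℝ≥0) (Y Z : FockPast k t →L[ℂ] FockPast k t) :
    pastOp t (Y - Z) = pastOp t Y - pastOp t Z :=
  ext_expVec fun f g => by
    simp only [inner_pastOp, sub_apply, inner_sub_right, sub_mul]

theorem QuantumStopTime.exists_ampl_embed (S : QuantumStopTime k) {a b : ℝ≥0∞} {t : ℝ≥0}
    (hab : a ≤ b) (h : b ≤ t) : ∃ Y : FockPast k t →L[ℂ] FockPast k t,
      ∀ ξ y, S.ampl 𝔥 (Ioc a b) (embed 𝔥 t ξ y) = embed 𝔥 t (Y ξ) y := by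
  obtain ⟨Y, hY⟩ := S.exists_pastOp (hab.trans h)
  obtain ⟨Z, hZ⟩ := S.exists_pastOp h
  refine ⟨Z - Y, fun ξ y => ?_⟩
  have e : S.proj (Ioc a b) = pastOp t (Z - Y) := by
    have := S.proj_union (A := Iic a) (B := Ioc a b) measurableSet_Iic measurableSet_Ioc (by
      rw [Set.disjoint_left]
      exact fun s hs hs' => not_lt_of_ge hs hs'.1)
    rw [Iic_union_Ioc_eq_Iic hab, hY, hZ] at this
    rw [pastOp_sub, this, add_sub_cancel_left]
  rw [QuantumStopTime.ampl, e, ampl_pastOp_embed]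

/-- On embedded vectors `S([0, a])` changes only the past factor and the flow only the future one.
This commutation is the source of the orthogonality. -/
theorem QuantumStopTime.ampl_Iic_ccrFlow (S : QuantumStopTime k) {a : ℝ≥0∞} {t : ℝ≥0}
    (h : a ≤ t) (X : Op 𝔥 k) (x : HilbertTensor 𝔥 (FockSpace k)) :
    S.ampl 𝔥 (Iic a) (ccrFlow t X x) = ccrFlow t X (S.ampl 𝔥 (Iic a) x) := by
  obtain ⟨Y, hY⟩ := S.exists_pastOp h
  have : S.ampl 𝔥 (Iic a) ∘L ccrFlow t X = ccrFlow t X ∘L S.ampl 𝔥 (Iic a) :=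
    op_ext fun u f => by
      rw [ContinuousLinearMap.comp_apply, ContinuousLinearMap.comp_apply, ccrFlow_tmul_expVec,
        tmul_expVec_eq_embed t u f, QuantumStopTime.ampl, hY, ampl_pastOp_embed, ampl_pastOp_embed,
        ccrFlow_embed]
  exact congrArg (· x) this

end Flow

/-! ### Processes driven by the flow: orthogonality and modulus of continuity. -/

section Processes

variable {k : Type*} [NormedAddCommGroup k] [InnerProductSpace ℂ k]
variable {𝔥 : Type*} [NormedAddCommGroup 𝔥] [InnerProductSpace ℂ 𝔥]

/-- A process `Z` with `Z(b + r) = J(b) σ_b(Y(r))`, where the `J(b)` are isometries, and where `Y`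
is bounded and strongly continuous at `0`. -/
structure IsFlowProcess (Z J Y : ℝ≥0 → Op 𝔥 k) (M : ℝ) : Prop where
  nonneg : 0 ≤ M
  inner_map : ∀ b x y, ⟪J b x, J b y⟫_ℂ = ⟪x, y⟫_ℂ
  add : ∀ b r, Z (b + r) = J b ∘L ccrFlow b (Y r)
  bound : ∀ r x, ‖Y r x‖ ≤ M * ‖x‖
  tendsto : StrongLim (𝓝 0) Y (Y 0)

/-- The extension of a process by `0` to the time `∞`. -/
def extendZero (Z : ℝ≥0 → Op 𝔥 k) (b : ℝ≥0∞) : Op 𝔥 k := if b = ∞ then 0 else Z b.toNNReal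

theorem extendZero_coe (Z : ℝ≥0 → Op 𝔥 k) (b : ℝ≥0) : extendZero Z b = Z b := by
  simp [extendZero]

theorem extendZero_top (Z : ℝ≥0 → Op 𝔥 k) : extendZero Z ∞ = 0 := by
  simp [extendZero]

namespace IsFlowProcess

variable {Z J Y : ℝ≥0 → Op 𝔥 k} {M : ℝ} (h : IsFlowProcess Z J Y M)
include h

theorem norm_map (b : ℝ≥0) (x : HilbertTensor 𝔥 (FockSpace k)) : ‖J b x‖ = ‖x‖ := by
  have h1 := h.inner_map b x x
  rw [inner_self_eq_norm_sq_to_K, inner_self_eq_norm_sq_to_K] at h1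
  rw [← sq_eq_sq₀ (norm_nonneg _) (norm_nonneg _)]
  exact_mod_cast h1

theorem norm_apply_le (b : ℝ≥0) (x : HilbertTensor 𝔥 (FockSpace k)) : ‖Z b x‖ ≤ M * ‖x‖ := by
  have h1 := h.add 0 b
  rw [zero_add, ccrFlow_zero] at h1
  rw [h1, ContinuousLinearMap.comp_apply, h.norm_map]
  exact h.bound b x

theorem isOrthoIntegrand (S : QuantumStopTime k) :
    IsOrthoIntegrand (S.ampl 𝔥) (extendZero Z) M where
  nonneg := h.nonneg
  bound b x := by
    induction b with
    | top => simpa [extendZero_top] using mul_nonneg h.nonneg (norm_nonneg x)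
    | coe b => rw [extendZero_coe]; exact h.norm_apply_le b x
  ortho a b c hab hac x y := by
    -- The isometry `J b` cancels from the inner product; the self-adjoint projection then commutes
    -- with both `σ_b(Y 0)` and `σ_b(Y r)`. Conjugation gives the case with the times in the
    -- opposite order.
    have key : ∀ b r : ℝ≥0, a ≤ b → ∀ x y,
        ⟪Z b (S.ampl 𝔥 (Iic a) x), Z (b + r) y⟫_ℂ =
          ⟪Z b x, Z (b + r) (S.ampl 𝔥 (Iic a) y)⟫_ℂ := by
      intro b r hab x y
      have hb := h.add b 0
      rw [add_zero] at hb
      rw [h.add b r, hb]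
      simp only [ContinuousLinearMap.comp_apply, h.inner_map]
      rw [← S.ampl_Iic_ccrFlow hab, ← S.ampl_Iic_ccrFlow hab,
        (S.isProjFamily 𝔥).symm _ measurableSet_Iic]
    induction b with
    | top => simp [extendZero_top]
    | coe b =>
      induction c with
      | top => simp [extendZero_top]
      | coe c =>
        rw [extendZero_coe, extendZero_coe]
        rcases le_total b c with hbc | hbc
        · obtain ⟨r, rfl⟩ := exists_add_of_le hbc
          exact key b r hab x y
        · obtain ⟨r, rfl⟩ := exists_add_of_le hbc
          rw [← inner_conj_symm, ← key c r hac y x, inner_conj_symm]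

/-- After removal of `J(c)`, the increment acts as `Y(r) - Y(0)` on the future of `c`, while `S((a,
c])` acts on the past only. The norm factorises, and the future factor is uniformly small for `c ∈
[0, T]`. -/
theorem hasModulus (S : QuantumStopTime k) (u : 𝔥) (f : L2 k (Ici 0)) :
    HasModulus (S.ampl 𝔥) (extendZero Z) (tmul u (expVec f)) := by
  intro T ε hε
  rcases eq_or_ne u 0 with rfl | hu
  · refine ⟨1, one_pos, fun a c b _ _ _ _ => ?_⟩
    have : (tmul (0 : 𝔥) (expVec f) : HilbertTensor 𝔥 (FockSpace k)) = 0 := by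
      simp [← tmulL_apply]
    simp [this]
  have hu' : 0 < ‖u‖ := norm_pos_iff.2 hu
  let z : ℝ≥0 → HilbertTensor 𝔥 (FockSpace k) := fun c => tmul u (expVec (leftShift c f))
  have hz : Continuous z := (continuous_tmul_expVec u).comp (continuous_leftShift f)
  -- The uniform bound on `Y` upgrades strong continuity at `0` to joint convergence in `(r, c)`, as
  -- the compactness argument needs.
  have hlim : ∀ c : ℝ≥0, Tendsto (fun p : ℝ≥0 × ℝ≥0 => ‖(Y p.1 - Y 0) (z p.2)‖) (𝓝 (0, c))
      (𝓝 0) := by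
    intro c
    have h1 : Tendsto (fun p : ℝ≥0 × ℝ≥0 => ‖(Y p.1 - Y 0) (z c)‖ + 2 * M * ‖z p.2 - z c‖)
        (𝓝 (0, c)) (𝓝 0) := by
      have h2 : Tendsto (fun p : ℝ≥0 × ℝ≥0 => ‖(Y p.1 - Y 0) (z c)‖) (𝓝 (0, c)) (𝓝 0) := by
        have := (((h.tendsto (z c)).sub_const (Y 0 (z c))).norm).comp
          (continuous_fst.tendsto ((0 : ℝ≥0), c))
        simpa [Function.comp_def] using this
      have h3 : Tendsto (fun p : ℝ≥0 × ℝ≥0 => 2 * M * ‖z p.2 - z c‖) (𝓝 (0, c)) (𝓝 0) := by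
        have := ((((hz.comp continuous_snd).tendsto ((0 : ℝ≥0), c)).sub_const (z c)).norm).const_mul
          (2 * M)
        simpa [Function.comp_def] using this
      simpa using h2.add h3
    refine squeeze_zero (fun _ => norm_nonneg _) (fun p => ?_) h1
    have e : (Y p.1 - Y 0) (z p.2) = (Y p.1 - Y 0) (z c) + (Y p.1 - Y 0) (z p.2 - z c) := by
      rw [← map_add]; simp
    rw [e]
    refine (norm_add_le _ _).trans (add_le_add_right ?_ _)
    rw [sub_apply]
    refine (norm_sub_le _ _).trans ?_
    have := h.bound p.1 (z p.2 - z c)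
    have := h.bound 0 (z p.2 - z c)
    linarith
  have hev : ∀ᶠ r in 𝓝 (0 : ℝ≥0), ∀ c ∈ Icc 0 T, ‖(Y r - Y 0) (z c)‖ < ε * ‖u‖ := by
    refine isCompact_Icc.eventually_forall_of_forall_eventually fun c _ => ?_
    exact (hlim c).eventually_lt_const (by positivity)
  obtain ⟨δ, hδ, hball⟩ := Metric.eventually_nhds_iff.1 hev
  refine ⟨(δ / 2).toNNReal, Real.toNNReal_pos.2 (by positivity), ?_⟩
  intro a c b hac hcb hbc hbT
  obtain ⟨r, rfl⟩ := exists_add_of_le hcb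
  have hr : (r : ℝ) ≤ δ / 2 := by
    have := NNReal.coe_le_coe.2 (le_of_add_le_add_left hbc)
    rwa [Real.coe_toNNReal _ (by positivity)] at this
  have hYr := hball (y := r) (by
    rw [NNReal.dist_eq]
    simp only [NNReal.coe_zero, sub_zero, NNReal.abs_eq]
    linarith) c ⟨zero_le, hcb.trans hbT⟩
  obtain ⟨Q, hQ⟩ := S.exists_ampl_embed (𝔥 := 𝔥) (t := c) (ENNReal.coe_le_coe.2 hac) le_rfl
  have e0 := h.add c 0
  rw [add_zero] at e0
  rw [extendZero_coe, extendZero_coe, h.add c r, e0]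
  simp only [ContinuousLinearMap.comp_apply]
  rw [← map_sub, h.norm_map, ← sub_apply, ← ccrFlow_sub, tmul_expVec_eq_embed c u f, hQ,
    ccrFlow_embed, norm_embed, norm_embed, norm_tmul]
  have h1 := one_le_norm_expVec (leftShift c f)
  calc _ ≤ ‖Q (expVec (restr (isSplit c).left f))‖ * (ε * ‖u‖) := by gcongr
    -- The norm to be compared with contains `‖ε(θ_c^* f)‖`, which is at least `1` and so can be
    -- inserted freely.
    _ ≤ ‖Q (expVec (restr (isSplit c).left f))‖ * (ε * ‖u‖ * ‖expVec (leftShift c f)‖) := by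
        refine mul_le_mul_of_nonneg_left ?_ (norm_nonneg _)
        exact le_mul_of_one_le_right (by positivity) h1
    _ = _ := by ring

theorem exists_limits (S : QuantumStopTime k) (hS : S.proj {∞} = 0) :
    ∃ (Wt : ℝ≥0 → Op 𝔥 k) (W : Op 𝔥 k),
      (∀ T : ℝ≥0, StrongLim atTop
        (fun π : Partition (T : ℝ≥0∞) => projSum (extendZero Z) (S.ampl 𝔥) π.1) (Wt T)) ∧
      (∀ (T : ℝ≥0) x, ‖Wt T x‖ ≤ M * ‖x‖) ∧ StrongLim atTop Wt W ∧
      StrongLim atTop (fun π : Partition ∞ => projSum (extendZero Z) (S.ampl 𝔥) π.1) W := by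
  refine (h.isOrthoIntegrand S).exists_limits (S.isProjFamily 𝔥)
    (S.tendsto_ampl_Ioi 𝔥 hS) (tmul_expVec_total (k := k) 𝔥) ?_
  rintro _ ⟨⟨u, f⟩, rfl⟩
  exact h.hasModulus S u f

end IsFlowProcess

end Processes

/-! ### Separating past from future, and replacing the future of an exponential vector. -/

section Cocycles

variable {k : Type*} [NormedAddCommGroup k] [InnerProductSpace ℂ k]
variable {𝔥 : Type*} [NormedAddCommGroup 𝔥] [InnerProductSpace ℂ 𝔥]

theorem pastFuture_apply (t : ℝ≥0)
    (A : HilbertTensor 𝔥 (FockPast k t) →L[ℂ] HilbertTensor 𝔥 (FockPast k t))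
    (B : FockFuture k t →L[ℂ] FockFuture k t)
    (y : HilbertTensor 𝔥 (FockPast k t)) (η : FockFuture k t) :
    pastFuture t A B (splitLeft 𝔥 (isSplit t) (tmul y η)) =
      splitLeft 𝔥 (isSplit t) (tmul (A y) (B η)) := by
  rw [pastFuture, LinearIsometryEquiv.conjStarAlgEquiv_apply_apply,
    LinearIsometryEquiv.symm_apply_apply, opTensor_tmul]

theorem pastFuture_comp (t : ℝ≥0)
    (A A' : HilbertTensor 𝔥 (FockPast k t) →L[ℂ] HilbertTensor 𝔥 (FockPast k t))
    (B B' : FockFuture k t →L[ℂ] FockFuture k t) :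
    pastFuture t A B ∘L pastFuture t A' B' = pastFuture t (A ∘L A') (B ∘L B') := by
  ext x
  simp only [pastFuture, ContinuousLinearMap.comp_apply,
    LinearIsometryEquiv.conjStarAlgEquiv_apply_apply, LinearIsometryEquiv.symm_apply_apply,
    opTensor_comp]

theorem embed_tmul (t : ℝ≥0) (h : L2 k (Ico 0 (t : ℝ))) (u : 𝔥) (ξ : FockSpace k) :
    embed 𝔥 t (expVec h) (tmul u ξ) =
      splitLeft 𝔥 (isSplit t) (tmul (tmul u (expVec h)) (fockShift (t : ℝ) ξ)) := by
  let L : FockSpace k →L[ℂ] HilbertTensor 𝔥 (FockSpace k) :=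
    embed 𝔥 t (expVec h) ∘L tmulL 𝔥 (FockSpace k) u
  let R : FockSpace k →L[ℂ] HilbertTensor 𝔥 (FockSpace k) :=
    (splitLeft 𝔥 (isSplit t)).toContinuousLinearEquiv.toContinuousLinearMap ∘L
      tmulL (HilbertTensor 𝔥 (FockPast k t)) (FockFuture k t) (tmul u (expVec h)) ∘L
      (fockShift (k := k) (t : ℝ) : FockSpace k →L[ℂ] FockFuture k t)
  have hLR : L = R := by
    refine ContinuousLinearMap.ext_on
      (Submodule.dense_iff_topologicalClosure_eq_top.2 expVec_total) ?_
    rintro _ ⟨g, rfl⟩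
    have e := splitLeft_apply 𝔥 (isSplit t) u (concat t h g)
    rw [restr_concat, restr_right_concat, ← fockShift_expVec] at e
    exact (embed_expVec t h u g).trans e.symm
  exact congrArg (· ξ) hLR

theorem ccrFlow_ampl (t : ℝ≥0) (X : FockSpace k →L[ℂ] FockSpace k) :
    ccrFlow t (opTensor (ContinuousLinearMap.id ℂ 𝔥) X) =
      pastFuture t (ContinuousLinearMap.id ℂ _)
        ((fockShift (k := k) (t : ℝ) : FockSpace k →L[ℂ] FockFuture k t) ∘L X ∘L
          ((fockShift (k := k) (t : ℝ)).symm : FockFuture k t →L[ℂ] FockSpace k)) :=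
  op_ext fun u f => by
    rw [tmul_expVec_eq_embed t u f, ccrFlow_embed, opTensor_tmul, embed_tmul, embed_tmul,
      pastFuture_apply]
    simp

/-- `A ⊗ I_{[t}` commutes with `σ_t(I ⊗ X)`. -/
theorem pastFuture_comm_ccrFlow_ampl (t : ℝ≥0)
    (A : HilbertTensor 𝔥 (FockPast k t) →L[ℂ] HilbertTensor 𝔥 (FockPast k t))
    (X : FockSpace k →L[ℂ] FockSpace k) :
    pastFuture t A (ContinuousLinearMap.id ℂ _) ∘L
        ccrFlow t (opTensor (ContinuousLinearMap.id ℂ 𝔥) X) =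
      ccrFlow t (opTensor (ContinuousLinearMap.id ℂ 𝔥) X) ∘L
        pastFuture t A (ContinuousLinearMap.id ℂ _) := by
  rw [ccrFlow_ampl, pastFuture_comp, pastFuture_comp]
  rfl

theorem norm_pastFuture_apply_le (t : ℝ≥0)
    (A : HilbertTensor 𝔥 (FockPast k t) →L[ℂ] HilbertTensor 𝔥 (FockPast k t))
    (B : FockFuture k t →L[ℂ] FockFuture k t) (x : HilbertTensor 𝔥 (FockSpace k)) :
    ‖pastFuture t A B x‖ ≤ ‖A‖ * ‖B‖ * ‖x‖ := by
  rw [pastFuture, LinearIsometryEquiv.conjStarAlgEquiv_apply_apply, LinearIsometryEquiv.norm_map]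
  refine (norm_opTensor_apply_le _ _ _).trans ?_
  rw [LinearIsometryEquiv.norm_map]

variable (k) in
/-- The operator `ξ ↦ ⟪ε(0), ξ⟫ ε(g)`, which maps every exponential vector to `ε(g)`. -/
def vacuumTo (g : L2 k (Ici 0)) : FockSpace k →L[ℂ] FockSpace k :=
  (innerSL ℂ (expVec (0 : L2 k (Ici 0)))).smulRight (expVec g)

theorem vacuumTo_expVec (f g : L2 k (Ici 0)) : vacuumTo k g (expVec f) = expVec g := by
  simp [vacuumTo, inner_expVec]

theorem norm_vacuumTo_le (g : L2 k (Ici 0)) : ‖vacuumTo k g‖ ≤ ‖expVec g‖ := by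
  rw [vacuumTo, ContinuousLinearMap.norm_smulRight_apply, innerSL_apply_norm, norm_expVec_zero,
    one_mul]

variable (𝔥) in
/-- The operator on `𝔥 ⊗ F` which replaces the future of an exponential vector after the time `t`
by the right shift of `g`. -/
def replaceFuture (t : ℝ≥0) (g : L2 k (Ici 0)) : Op 𝔥 k :=
  ccrFlow t (opTensor (ContinuousLinearMap.id ℂ 𝔥) (vacuumTo k g))

theorem replaceFuture_tmul (t : ℝ≥0) (g : L2 k (Ici 0)) (u : 𝔥) (f : L2 k (Ici 0)) :
    replaceFuture 𝔥 t g (tmul u (expVec f)) =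
      tmul u (expVec (concat t (restr (isSplit t).left f) g)) := by
  rw [replaceFuture, ccrFlow_tmul_expVec, opTensor_tmul, vacuumTo_expVec,
    ContinuousLinearMap.id_apply, embed_expVec]

theorem replaceFuture_add (s t : ℝ≥0) (g : L2 k (Ici 0)) :
    replaceFuture 𝔥 (s + t) g = ccrFlow s (replaceFuture 𝔥 t g) := ccrFlow_add _ _ _

/-- Any exponential vector is recovered from its truncation at `t`, so a relation commuting with
`replaceFuture` need only be checked on truncated vectors. -/
theorem replaceFuture_truncate (t : ℝ≥0) (u : 𝔥) (f : L2 k (Ici 0)) :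
    replaceFuture 𝔥 t (leftShift t f)
        (tmul u (expVec (concat t (restr (isSplit t).left f) 0))) = tmul u (expVec f) := by
  rw [replaceFuture_tmul, restr_concat, concat_restr_leftShift]

theorem norm_replaceFuture_apply_le (t : ℝ≥0) (g : L2 k (Ici 0))
    (x : HilbertTensor 𝔥 (FockSpace k)) : ‖replaceFuture 𝔥 t g x‖ ≤ ‖expVec g‖ * ‖x‖ := by
  refine (norm_ccrFlow_apply_le _ _ _).trans (mul_le_mul_of_nonneg_right ?_ (norm_nonneg _))
  refine ContinuousLinearMap.opNorm_le_bound _ (norm_nonneg _) fun y => ?_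
  refine (norm_opTensor_apply_le _ _ _).trans (mul_le_mul_of_nonneg_right ?_ (norm_nonneg _))
  exact (mul_le_of_le_one_left (norm_nonneg _) ContinuousLinearMap.norm_id_le).trans
    (norm_vacuumTo_le g)

/-- The operator does nothing to the initial space. Hence `replaceFuture 𝔥 (s + t) g` has the form
`σ_s(I ⊗ X)`, which commutes with `V.hat s`. -/
theorem exists_replaceFuture_eq_ampl (t : ℝ≥0) (g : L2 k (Ici 0)) :
    ∃ X : FockSpace k →L[ℂ] FockSpace k,
      replaceFuture 𝔥 t g = opTensor (ContinuousLinearMap.id ℂ 𝔥) X := by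
  refine ⟨(fockSplit (isSplit t)).conjStarAlgEquiv (opTensor (ContinuousLinearMap.id ℂ _)
    ((innerSL ℂ (expVec (0 : L2 k (Ici (t : ℝ))))).smulRight (expVec (rightShift (t : ℝ) g)))),
    op_ext fun u f => ?_⟩
  rw [replaceFuture_tmul, opTensor_tmul, LinearIsometryEquiv.conjStarAlgEquiv_apply_apply,
    fockSplit_symm_apply, opTensor_tmul]
  have e := fockSplit_apply (isSplit t) (concat t (restr (isSplit t).left f) g)
  rw [restr_concat, restr_right_concat] at e
  simp [inner_expVec, e]

namespace AdaptedProcess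

variable [CompleteSpace 𝔥] {𝒜 : VonNeumannAlgebra 𝔥} {p : k →L[ℂ] k} (V : AdaptedProcess 𝒜 p)

theorem hat_replaceFuture (t : ℝ≥0) (g : L2 k (Ici 0)) :
    V.hat t ∘L replaceFuture 𝔥 t g = replaceFuture 𝔥 t g ∘L V.hat t :=
  pastFuture_comm_ccrFlow_ampl _ _ _

theorem hat_replaceFuture_add (s t : ℝ≥0) (g : L2 k (Ici 0)) :
    V.hat s ∘L replaceFuture 𝔥 (s + t) g = replaceFuture 𝔥 (s + t) g ∘L V.hat s := by
  obtain ⟨X, hX⟩ := exists_replaceFuture_eq_ampl (𝔥 := 𝔥) t g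
  rw [replaceFuture_add, hX]
  exact pastFuture_comm_ccrFlow_ampl _ _ _

end AdaptedProcess
end Cocycles

/-! ### The cocycle identity and strong continuity for the identity-adapted process. -/

section Cocycles

variable {k : Type*} [NormedAddCommGroup k] [InnerProductSpace ℂ k]
variable {𝔥 : Type*} [NormedAddCommGroup 𝔥] [InnerProductSpace ℂ 𝔥]

namespace AdaptedProcess

variable [CompleteSpace 𝔥] {𝒜 : VonNeumannAlgebra 𝔥} {p : k →L[ℂ] k} {V : AdaptedProcess 𝒜 p}

theorem IsIsometric.inner_hat (hV : V.IsIsometric) (t : ℝ≥0)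
    (x y : HilbertTensor 𝔥 (FockSpace k)) : ⟪V.hat t x, V.hat t y⟫_ℂ = ⟪x, y⟫_ℂ := by
  rw [hat, pastFuture, LinearIsometryEquiv.conjStarAlgEquiv_apply_apply,
    LinearIsometryEquiv.conjStarAlgEquiv_apply_apply, LinearIsometryEquiv.inner_map_map,
    inner_opTensor (X' := ContinuousLinearMap.adjoint (V.past t))
      (Y' := ContinuousLinearMap.id ℂ _)
      (fun a b => (ContinuousLinearMap.adjoint_inner_right _ _ _).symm) (fun _ _ => rfl),
    ← ContinuousLinearMap.comp_apply, ← opTensor_comp, hV t, ContinuousLinearMap.id_comp,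
    opTensor_id, ContinuousLinearMap.id_apply, LinearIsometryEquiv.inner_map_map]

theorem IsIsometric.norm_hat_apply (hV : V.IsIsometric) (t : ℝ≥0)
    (x : HilbertTensor 𝔥 (FockSpace k)) : ‖V.hat t x‖ = ‖x‖ := by
  have h1 := hV.inner_hat t x x
  rw [inner_self_eq_norm_sq_to_K, inner_self_eq_norm_sq_to_K] at h1
  rw [← sq_eq_sq₀ (norm_nonneg _) (norm_nonneg _)]
  exact_mod_cast h1

theorem IsIsometric.norm_op_apply_le (hV : V.IsIsometric) (t : ℝ≥0)
    (x : HilbertTensor 𝔥 (FockSpace k)) : ‖V.op t x‖ ≤ ‖x‖ := by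
  rw [V.op_eq t]
  refine (norm_pastFuture_apply_le _ _ _ _).trans (mul_le_of_le_one_left (norm_nonneg _) ?_)
  refine mul_le_one₀ ?_ (norm_nonneg _) (Submodule.starProjection_norm_le _)
  refine ContinuousLinearMap.opNorm_le_bound _ zero_le_one fun y => ?_
  have h : ⟪V.past t y, V.past t y⟫_ℂ = ⟪y, y⟫_ℂ := by
    rw [← ContinuousLinearMap.adjoint_inner_right, ← ContinuousLinearMap.comp_apply, hV t,
      ContinuousLinearMap.id_apply]
  rw [inner_self_eq_norm_sq_to_K, inner_self_eq_norm_sq_to_K] at h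
  have h' : ‖V.past t y‖ ^ 2 = ‖y‖ ^ 2 := by exact_mod_cast h
  rw [one_mul]
  exact ((sq_eq_sq₀ (norm_nonneg _) (norm_nonneg _)).1 h').le

/-- The future component is the vacuum `ε(0)`, which is fixed by `P_{[t}` as well as by the
identity. -/
theorem op_eq_hat_of_leftShift_eq_zero [CompleteSpace k] (hp : IsStarProjection p) {t : ℝ≥0}
    {f : L2 k (Ici 0)} (hf : leftShift t f = 0) (u : 𝔥) :
    V.op t (tmul u (expVec f)) = V.hat t (tmul u (expVec f)) := by
  rw [V.op_eq t, hat, tmul_expVec_eq_embed t u f, embed_tmul, pastFuture_apply, pastFuture_apply,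
    hf, fockShift_expVec, map_zero, futureProj_expVec hp, map_zero, ContinuousLinearMap.id_apply]

/-- On vectors truncated at `s + t` this is the cocycle identity of `V`. The operator `K` restoring
the future commutes with `V.hat (s + t)`, `V.hat s` and `ccrFlow s (V.hat t)`, which extends the
identity to every exponential vector. -/
theorem IsCocycle.hat_add [CompleteSpace k] (hV : V.IsCocycle) (hp : IsStarProjection p)
    (s t : ℝ≥0) : V.hat (s + t) = V.hat s ∘L ccrFlow s (V.hat t) := by
  refine op_ext fun u f => ?_
  set f' := concat (s + t) (restr (isSplit (s + t)).left f) 0 with hf'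
  set K := replaceFuture 𝔥 (s + t) (leftShift (s + t) f) with hK
  have hK' : tmul u (expVec f) = K (tmul u (expVec f')) :=
    (replaceFuture_truncate (s + t) u f).symm
  have h0 : leftShift (s + t) f' = 0 := leftShift_concat _ _ _
  have h1 : V.hat (s + t) (tmul u (expVec f')) =
      (V.hat s ∘L ccrFlow s (V.hat t)) (tmul u (expVec f')) := by
    rw [← op_eq_hat_of_leftShift_eq_zero hp h0, hV s t]
    simp only [ContinuousLinearMap.comp_apply, ccrFlow_tmul_expVec]
    rw [op_eq_hat_of_leftShift_eq_zero hp (by rw [← leftShift_add, h0])]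
  have c1 : V.hat (s + t) ∘L K = K ∘L V.hat (s + t) := V.hat_replaceFuture _ _
  have c2 : V.hat s ∘L K = K ∘L V.hat s := V.hat_replaceFuture_add _ _ _
  have c3 : ccrFlow s (V.hat t) ∘L K = K ∘L ccrFlow s (V.hat t) := by
    rw [hK, replaceFuture_add, ← ccrFlow_comp, ← ccrFlow_comp, V.hat_replaceFuture]
  rw [hK', ← ContinuousLinearMap.comp_apply, ← ContinuousLinearMap.comp_apply, c1,
    ContinuousLinearMap.comp_assoc, c3, ← ContinuousLinearMap.comp_assoc, c2,
    ContinuousLinearMap.comp_apply, h1]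
  rfl

/-- The operator `V.op 0` still contains `P_{[0}`, so only its action on the vacuum is claimed to be
trivial. The cocycle identity at `0` gives `V_0 = V̂_0 V_0`, the operators `V_0` and `V̂_0` agree on
`u ⊗ ε(0)`, and `V̂_0` is injective. -/
theorem IsCocycle.op_zero_vacuum [CompleteSpace k] (hV : V.IsCocycle) (hp : IsStarProjection p)
    (hiso : V.IsIsometric) (u : 𝔥) :
    V.op 0 (tmul u (expVec 0)) = tmul u (expVec (0 : L2 k (Ici 0))) := by
  have h1 := hV 0 0
  rw [add_zero, ccrFlow_zero] at h1
  have h2 := op_eq_hat_of_leftShift_eq_zero (V := V) hp (t := 0) (leftShift_zero 0) u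
  have h3 : V.hat 0 (V.op 0 (tmul u (expVec 0)) - tmul u (expVec 0)) = 0 := by
    rw [map_sub, ← h2, ← ContinuousLinearMap.comp_apply, ← h1, sub_self]
  have h4 := hiso.norm_hat_apply 0 (V.op 0 (tmul u (expVec 0)) - tmul u (expVec 0))
  rw [h3, norm_zero] at h4
  exact sub_eq_zero.1 (norm_eq_zero.1 h4.symm)

/-- Strong continuity passes from `V` to `V.hat` because `f` truncated at `t` tends to `0` as `t →
0`. The problem reduces to `V.op t` on `u ⊗ ε(0)`, and restoring the future costs a factor of at
most `‖ε(f)‖`. -/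
theorem IsCocycle.tendsto_hat [CompleteSpace k] (hV : V.IsCocycle) (hp : IsStarProjection p)
    (hiso : V.IsIsometric) (hcont : V.IsStronglyContinuous) :
    StrongLim (𝓝 0) V.hat (ContinuousLinearMap.id ℂ _) := by
  refine strongLim_of_total (M := 1) (fun t x => by rw [hiso.norm_hat_apply, one_mul])
    (tmul_expVec_total (k := k) 𝔥) _ ?_
  rintro _ ⟨⟨u, f⟩, rfl⟩
  let c : ℝ≥0 → HilbertTensor 𝔥 (FockSpace k) := fun t =>
    tmul u (expVec (concat t (restr (isSplit t).left f) 0))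
  let v : HilbertTensor 𝔥 (FockSpace k) := tmul u (expVec 0)
  have hc : Tendsto c (𝓝 0) (𝓝 v) :=
    ((continuous_tmul_expVec u).tendsto 0).comp (tendsto_concat f 0)
  have hbound : ∀ t : ℝ≥0, ‖V.hat t (tmul u (expVec f)) - tmul u (expVec f)‖ ≤
      ‖expVec f‖ * (‖V.op t v - v‖ + 2 * ‖c t - v‖) := by
    intro t
    have e : tmul u (expVec f) = replaceFuture 𝔥 t (leftShift t f) (c t) :=
      (replaceFuture_truncate t u f).symm
    rw [e, ← ContinuousLinearMap.comp_apply, V.hat_replaceFuture, ContinuousLinearMap.comp_apply,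
      ← map_sub, ← op_eq_hat_of_leftShift_eq_zero hp (leftShift_concat _ _ _)]
    refine (norm_replaceFuture_apply_le _ _ _).trans ?_
    refine mul_le_mul (norm_expVec_le (norm_leftShift_le t f)) ?_ (norm_nonneg _) (norm_nonneg _)
    have e2 : V.op t (c t) - c t = (V.op t v - v) + (V.op t (c t - v) - (c t - v)) := by
      rw [map_sub]; abel
    refine (congrArg norm e2).le.trans ((norm_add_le _ _).trans (add_le_add_right ?_ _))
    refine (norm_sub_le _ _).trans ?_
    have := hiso.norm_op_apply_le t (c t - v)
    linarith
  have h1 : Tendsto (fun t => ‖V.op t v - v‖) (𝓝 0) (𝓝 0) := by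
    have := (((hcont v).tendsto 0).sub_const v).norm
    rwa [hV.op_zero_vacuum hp hiso u, sub_self, norm_zero] at this
  have h2 : Tendsto (fun t => 2 * ‖c t - v‖) (𝓝 0) (𝓝 0) := by
    simpa using (hc.sub_const v).norm.const_mul 2
  rw [tendsto_iff_norm_sub_tendsto_zero]
  refine squeeze_zero (fun _ => norm_nonneg _) hbound ?_
  simpa using (h1.add h2).const_mul ‖expVec f‖

theorem IsCocycle.isFlowProcess_op (hV : V.IsCocycle) (hiso : V.IsIsometric)
    (hcont : V.IsStronglyContinuous) : IsFlowProcess V.op V.hat V.op 1 where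
  nonneg := zero_le_one
  inner_map := hiso.inner_hat
  add := hV
  bound r x := by rw [one_mul]; exact hiso.norm_op_apply_le r x
  tendsto z := (hcont z).tendsto 0

theorem IsCocycle.isFlowProcess_hat [CompleteSpace k] (hV : V.IsCocycle)
    (hp : IsStarProjection p) (hiso : V.IsIsometric) (hcont : V.IsStronglyContinuous) :
    IsFlowProcess V.hat V.hat V.hat 1 where
  nonneg := zero_le_one
  inner_map := hiso.inner_hat
  add := hV.hat_add hp
  bound r x := by rw [one_mul, hiso.norm_hat_apply]
  tendsto := by
    have h := hV.tendsto_hat hp hiso hcont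
    -- The operator `V.hat 0` is an idempotent isometry, hence the identity.
    have h0 : V.hat 0 = ContinuousLinearMap.id ℂ _ := by
      refine op_ext fun u f => ?_
      have e := hV.hat_add hp 0 0
      rw [add_zero, ccrFlow_zero] at e
      have h1 : V.hat 0 (V.hat 0 (tmul u (expVec f)) - tmul u (expVec f)) = 0 := by
        rw [map_sub, ← ContinuousLinearMap.comp_apply, ← e, sub_self]
      have h2 := hiso.norm_hat_apply 0 (V.hat 0 (tmul u (expVec f)) - tmul u (expVec f))
      rw [h1, norm_zero] at h2
      exact sub_eq_zero.1 (norm_eq_zero.1 h2.symm)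
    rwa [h0]

end AdaptedProcess

theorem isFlowProcess_ccrFlow (X : Op 𝔥 k) :
    IsFlowProcess (fun t => ccrFlow t X) (fun _ => ContinuousLinearMap.id ℂ _)
      (fun t => ccrFlow t X) ‖X‖ where
  nonneg := norm_nonneg X
  inner_map _ _ _ := rfl
  add b r := by rw [ccrFlow_add]; rfl
  bound r x := norm_ccrFlow_apply_le r X x
  tendsto := by
    have := tendsto_ccrFlow X
    simpa only [ccrFlow_zero] using this

end Cocycles

/-! ### Factorisation of the Riemann sums under translation by `t`. -/

section Stopping

variable {k : Type*} [NormedAddCommGroup k] [InnerProductSpace ℂ k]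
variable {𝔥 : Type*} [NormedAddCommGroup 𝔥] [InnerProductSpace ℂ 𝔥]

theorem riemannSum_eq_projSum (V : ℝ≥0 → Op 𝔥 k) (S : QuantumStopTime k) {T : ℝ≥0}
    (π : Partition (T : ℝ≥0∞)) :
    riemannSum (fun b => V b.toNNReal) S π.1 = projSum (extendZero V) (S.ampl 𝔥) π.1 := by
  refine Finset.sum_congr rfl fun b hb => ?_
  have hb' : b ≠ ∞ :=
    ne_top_of_le_ne_top ENNReal.coe_ne_top (π.2.2.2 b (Finset.mem_filter.1 hb).1)
  rw [extendZero, if_neg hb']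
  rfl

/-- The two conventions at time `∞`, namely `σ_∞ = I` and the value `0` of `extendZero`, differ only
on the last cell, whose contribution vanishes in the limit by `tendsto_ampl_last`. -/
theorem riemannSum_ccrFlowExt (X : Op 𝔥 k) (S : QuantumStopTime k) (π : Partition ∞) :
    riemannSum (fun b => ccrFlowExt b X) S π.1 =
      projSum (extendZero fun t => ccrFlow t X) (S.ampl 𝔥) π.1 +
        S.ampl 𝔥 (Ioc (pred π.1 ∞) ∞) := by
  have hmem : ∞ ∈ π.1.filter (0 < ·) := Finset.mem_filter.2 ⟨π.2.2.1, ENNReal.zero_lt_top⟩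
  rw [riemannSum, projSum, ← Finset.add_sum_erase _ _ hmem, ← Finset.add_sum_erase _ _ hmem,
    extendZero_top, ContinuousLinearMap.zero_comp, zero_add, add_comm]
  congr 1
  refine Finset.sum_congr rfl fun b hb => ?_
  have hb' : b ≠ ∞ := Finset.ne_of_mem_erase hb
  rw [extendZero, if_neg hb', ccrFlowExt, if_neg hb']
  rfl

theorem tendsto_ampl_last (S : QuantumStopTime k) (hS : S.proj {∞} = 0) :
    StrongLim atTop (fun π : Partition ∞ => S.ampl 𝔥 (Ioc (pred π.1 ∞) ∞)) 0 := by
  intro x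
  rw [zero_apply, Metric.tendsto_nhds]
  intro ε hε
  obtain ⟨T, hT⟩ := (Metric.tendsto_nhds.1 (S.tendsto_ampl_Ioi 𝔥 hS x) ε hε).exists
  filter_upwards [eventually_mem_partition (U := ∞) (T := (T : ℝ≥0∞)) le_top] with π hπ
  refine lt_of_le_of_lt ?_ hT
  rw [dist_zero_right, dist_zero_right]
  refine (S.isProjFamily 𝔥).norm_mono measurableSet_Ioc measurableSet_Ioi (fun s hs => ?_) x
  exact (le_pred hπ ENNReal.coe_lt_top).trans_lt hs.1

/-- The partition of `[0, T]` obtained by translating a partition of `[0, T + t]` by `-t`. -/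
def shiftPartition {T t : ℝ≥0} (π : Partition ((T + t : ℝ≥0) : ℝ≥0∞)) : Partition (T : ℝ≥0∞) :=
  ⟨π.1.image (· - (t : ℝ≥0∞)), Finset.mem_image.2 ⟨0, π.2.1, by simp⟩,
    Finset.mem_image.2 ⟨_, π.2.2.1, by simp⟩, by
      intro x hx
      obtain ⟨y, hy, rfl⟩ := Finset.mem_image.1 hx
      have := π.2.2.2 y hy
      rw [ENNReal.coe_add] at this
      exact tsub_le_iff_right.2 this⟩

/-- Translation by `-t` is cofinal: a prescribed `π₀` is eventually contained in the image, because
its translate by `t` can be included in the partition. -/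
theorem tendsto_shiftPartition (T t : ℝ≥0) :
    Tendsto (shiftPartition : Partition ((T + t : ℝ≥0) : ℝ≥0∞) → Partition (T : ℝ≥0∞))
      atTop atTop := by
  refine tendsto_atTop.2 fun π₀ => ?_
  let π₁ : Partition ((T + t : ℝ≥0) : ℝ≥0∞) := ⟨insert 0 (π₀.1.image (· + (t : ℝ≥0∞))), by simp,
    Finset.mem_insert_of_mem (Finset.mem_image.2 ⟨_, π₀.2.2.1, by simp⟩), by
      intro x hx
      rcases Finset.mem_insert.1 hx with rfl | hx
      · exact zero_le
      · obtain ⟨y, hy, rfl⟩ := Finset.mem_image.1 hx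
        rw [ENNReal.coe_add]
        exact add_le_add_left (π₀.2.2.2 y hy) _⟩
  filter_upwards [eventually_ge_atTop π₁] with π hπ x hx
  refine Finset.mem_image.2 ⟨x + t, hπ ?_, ENNReal.add_sub_cancel_right ENNReal.coe_ne_top⟩
  exact Finset.mem_insert_of_mem (Finset.mem_image_of_mem _ hx)

theorem preimage_add_Ioc_pred {t : ℝ≥0} {π : Finset ℝ≥0∞} (ht : (t : ℝ≥0∞) ∈ π) {b : ℝ≥0∞}
    (hb : (t : ℝ≥0∞) < b) :
    (fun s : ℝ≥0∞ => s + (t : ℝ≥0∞)) ⁻¹' Ioc (pred π b) b =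
      Ioc (pred (π.image (· - (t : ℝ≥0∞))) (b - t)) (b - t) := by
  have htt : (t : ℝ≥0∞) ≠ ∞ := ENNReal.coe_ne_top
  ext s
  rw [mem_preimage, mem_Ioc, mem_Ioc, ENNReal.le_sub_iff_add_le_right htt hb.le]
  refine and_congr_left fun _ => ?_
  rcases eq_or_ne s 0 with rfl | hs
  · rw [zero_add]
    exact iff_of_false (not_lt_of_ge (le_pred ht hb)) not_lt_zero
  have hs0 : 0 < s := pos_iff_ne_zero.2 hs
  rw [pred_lt_iff (hs0.trans_le le_self_add), pred_lt_iff hs0]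
  simp only [Finset.mem_image, forall_exists_index, and_imp, forall_apply_eq_imp_iff₂]
  refine forall₂_congr fun y _ => ?_
  -- Truncated subtraction sends every point `y ≤ t` to `0`; such points impose no condition on
  -- either side because `s > 0`.
  rcases le_or_gt y t with hy | hy
  · rw [tsub_eq_zero_of_le hy]
    exact iff_of_true (fun _ => hy.trans_lt (by
      rw [add_comm]; exact ENNReal.lt_add_right htt hs)) fun _ => hs0
  · have h1 : y < b ↔ y - t < b - t := by
      rw [lt_tsub_iff_right, tsub_add_cancel_of_le hy.le]
    rw [h1, show y - t < s ↔ y < s + t from ENNReal.sub_lt_iff_lt_right htt hy.le]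

/-- The Riemann sums for `V_{S + t}` factorise. -/
theorem projSum_addTime {Z J : ℝ≥0 → Op 𝔥 k} {X : Op 𝔥 k} {S : QuantumStopTime k} {t T : ℝ≥0}
    (hS : S.proj {0} = 0) (hZ : ∀ s, Z (s + t) = J s ∘L ccrFlow s X)
    {π : Partition ((T + t : ℝ≥0) : ℝ≥0∞)} (ht : (t : ℝ≥0∞) ∈ π.1) :
    projSum (extendZero Z) ((S.addTime t).ampl 𝔥) π.1 =
      projSum (extendZero J) (S.ampl 𝔥) (shiftPartition π).1 ∘L
        projSum (extendZero fun s => ccrFlow s X) (S.ampl 𝔥) (shiftPartition π).1 := by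
  have htt : (t : ℝ≥0∞) ≠ ∞ := ENNReal.coe_ne_top
  have hQ := S.isProjFamily 𝔥
  set ρ := (shiftPartition π).1 with hρ
  have hfin : ∀ b ∈ ρ, b ≠ ∞ := fun b hb =>
    ne_top_of_le_ne_top ENNReal.coe_ne_top ((shiftPartition π).2.2.2 b hb)
  have hR : projSum (extendZero J) (S.ampl 𝔥) ρ ∘L
      projSum (extendZero fun s => ccrFlow s X) (S.ampl 𝔥) ρ =
      ∑ b ∈ ρ.filter (0 < ·), (extendZero J b ∘L extendZero (fun s => ccrFlow s X) b) ∘L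
        S.ampl 𝔥 (Ioc (pred ρ b) b) := by
    -- The cell ends at `b`, so its projection belongs to the past of `b` and commutes with
    -- `σ_b(X)`; this places two cell projections side by side, and only the diagonal terms of the
    -- product survive.
    have hcomm : ∀ b ∈ ρ, ∀ x, extendZero (fun s => ccrFlow s X) b
        (S.ampl 𝔥 (Ioc (pred ρ b) b) x) =
        S.ampl 𝔥 (Ioc (pred ρ b) b) (extendZero (fun s => ccrFlow s X) b x) := by
      intro b hb x
      have hle := pred_le ρ b
      lift b to ℝ≥0 using hfin b hb
      rw [extendZero_coe, hQ.Ioc_eq hle]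
      simp only [sub_apply, map_sub]
      rw [S.ampl_Iic_ccrFlow le_rfl, S.ampl_Iic_ccrFlow hle]
    ext x
    simp only [ContinuousLinearMap.comp_apply, sum_apply]
    rw [projSum_apply, projSum_apply]
    refine Finset.sum_congr rfl fun b hb => ?_
    have hbρ := (Finset.mem_filter.1 hb).1
    congr 1
    rw [map_sum, Finset.sum_eq_single_of_mem b hb]
    · rw [hcomm b hbρ, hQ.mul_self _ measurableSet_Ioc]
    · intro c hc hcb
      have hcρ := (Finset.mem_filter.1 hc).1
      rw [hcomm c hcρ, hQ.mul_disjoint _ _ measurableSet_Ioc measurableSet_Ioc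
        (pairwiseDisjoint_Ioc_pred ρ hbρ hcρ hcb.symm)]
  rw [hR, projSum]
  -- A cell ending at or before `t` pulls back into `{0}`, and this is where `S({0}) = 0` enters.
  have hsmall : ∀ b ∈ π.1.filter (0 < ·), ¬ (t : ℝ≥0∞) < b →
      extendZero Z b ∘L (S.addTime t).ampl 𝔥 (Ioc (pred π.1 b) b) = 0 := by
    intro b hb hbt
    have hsub : (fun s : ℝ≥0∞ => s + (t : ℝ≥0∞)) ⁻¹' Ioc (pred π.1 b) b ⊆ {0} := by
      intro s hs
      by_contra hs0
      have h1 : (t : ℝ≥0∞) < t + s := ENNReal.lt_add_right htt hs0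
      rw [add_comm] at h1
      exact hbt (h1.trans_le hs.2)
    have h0 : (S.addTime t).proj (Ioc (pred π.1 b) b) = 0 :=
      S.proj_mono_zero (measurableSet_Ioc.preimage (by fun_prop)) (measurableSet_singleton _)
        hsub hS
    have h1 : (S.addTime t).ampl 𝔥 (Ioc (pred π.1 b) b) = 0 :=
      tensor_ext' fun u ξ => by rw [QuantumStopTime.ampl_tmul, h0]; simp [tmul_zero]
    rw [h1, ContinuousLinearMap.comp_zero]
  rw [← Finset.sum_filter_of_ne (p := fun b => (t : ℝ≥0∞) < b) fun b hb hne => by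
    by_contra hbt
    exact hne (hsmall b hb hbt)]
  refine Finset.sum_bij (fun b _ => b - t) ?_ ?_ ?_ ?_
  · intro b hb
    simp only [Finset.mem_filter] at hb ⊢
    exact ⟨Finset.mem_image_of_mem _ hb.1.1, tsub_pos_of_lt hb.2⟩
  · intro b hb c hc hbc
    simp only [Finset.mem_filter] at hb hc
    rw [← tsub_add_cancel_of_le hb.2.le, hbc, tsub_add_cancel_of_le hc.2.le]
  · intro b hb
    obtain ⟨hb1, hb2⟩ := Finset.mem_filter.1 hb
    obtain ⟨c, hc, rfl⟩ := Finset.mem_image.1 hb1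
    have htc := tsub_pos_iff_lt.1 hb2
    exact ⟨c, Finset.mem_filter.2 ⟨Finset.mem_filter.2 ⟨hc, bot_le.trans_lt htc⟩, htc⟩, rfl⟩
  · intro b hb
    simp only [Finset.mem_filter] at hb
    have e1 : (S.addTime t).ampl 𝔥 (Ioc (pred π.1 b) b) =
        S.ampl 𝔥 (Ioc (pred ρ (b - t)) (b - t)) := by
      rw [QuantumStopTime.ampl, QuantumStopTime.ampl, hρ]
      exact congrArg (fun A => opTensor (ContinuousLinearMap.id ℂ 𝔥) (S.proj A))
        (preimage_add_Ioc_pred ht hb.2)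
    have hmem : b - t ∈ ρ := Finset.mem_image_of_mem _ hb.1.1
    obtain ⟨c, hc⟩ : ∃ c : ℝ≥0, (c : ℝ≥0∞) = b - t := ⟨_, ENNReal.coe_toNNReal (hfin _ hmem)⟩
    have hbc : b = ((c + t : ℝ≥0) : ℝ≥0∞) := by
      rw [ENNReal.coe_add, hc, tsub_add_cancel_of_le hb.2.le]
    rw [e1, ← hc, hbc, extendZero_coe, extendZero_coe, extendZero_coe, hZ]

theorem StrongLim.unique {ι E : Type*} [NormedAddCommGroup E] [NormedSpace ℂ E] {l : Filter ι}
    [NeBot l] {T : ι → E →L[ℂ] E} {K L : E →L[ℂ] E} (hK : StrongLim l T K)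
    (hL : StrongLim l T L) : K = L :=
  ContinuousLinearMap.ext fun z => tendsto_nhds_unique (hK z) (hL z)

end Stopping
end QStop

end

theorem mainTheorem3 {𝔥 k : Type*}
    [NormedAddCommGroup 𝔥] [InnerProductSpace ℂ 𝔥] [CompleteSpace 𝔥]
    [NormedAddCommGroup k] [InnerProductSpace ℂ k] [CompleteSpace k]
    (𝒜 : VonNeumannAlgebra 𝔥) (p : k →L[ℂ] k) (hp : IsStarProjection p)
    (S : QStop.QuantumStopTime k) (hS_zero : S.proj {0} = 0) (hS_finite : S.proj {∞} = 0)
    (V : QStop.AdaptedProcess 𝒜 p) (hV_cocycle : V.IsCocycle) (hV_isometric : V.IsIsometric)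
    (hV_cont : V.IsStronglyContinuous) :
    ∃ VhatS : QStop.Op 𝔥 k,
      QStop.IsStopped V.hat S VhatS ∧
      ∀ t : ℝ≥0, ∃ VSt sigmaSVt : QStop.Op 𝔥 k,
        QStop.IsStopped V.op (S.addTime t) VSt ∧
        QStop.IsStoppedFlow S (V.op t) sigmaSVt ∧
        VSt = VhatS ∘L sigmaSVt := by
  have hhat := hV_cocycle.isFlowProcess_hat hp hV_isometric hV_cont
  obtain ⟨Ht, H, hHt, hHb, hH, -⟩ := hhat.exists_limits S hS_finite
  refine ⟨H, ⟨Ht, fun T _ => ?_, hH⟩, fun t => ?_⟩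
  · simpa only [QStop.IsStoppedBy, QStop.riemannSum_eq_projSum] using hHt T
  have hadd : (S.addTime t).proj {∞} = 0 := by
    have e : (fun s : ℝ≥0∞ => s + (t : ℝ≥0∞)) ⁻¹' {∞} = {∞} := by ext s; simp
    exact (congrArg S.proj e).trans hS_finite
  obtain ⟨Wt, W, hWt, -, hW, -⟩ :=
    (hV_cocycle.isFlowProcess_op hV_isometric hV_cont).exists_limits (S.addTime t) hadd
  obtain ⟨Gt, G, hGt, -, hG, hG'⟩ :=
    (QStop.isFlowProcess_ccrFlow (V.op t)).exists_limits S hS_finite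
  refine ⟨W, G, ⟨Wt, fun T _ => ?_, hW⟩, fun x => ?_, ?_⟩
  · simpa only [QStop.IsStoppedBy, QStop.riemannSum_eq_projSum] using hWt T
  · have := (hG' x).add (QStop.tendsto_ampl_last (𝔥 := 𝔥) S hS_finite x)
    simpa only [QStop.riemannSum_ccrFlowExt, add_apply, zero_apply, add_zero] using this
  -- Factorisation is proved at finite horizons: along partitions of `[0, T + t]` containing `t`,
  -- the sums for `V.op` equal the products of sums over the translated partitions.
  · have hfact : ∀ T : ℝ≥0, Wt (T + t) = Ht T ∘L Gt T := by
      intro T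
      have hshift := QStop.tendsto_shiftPartition T t
      have h1 := QStop.StrongLim.comp (M := 1)
        (fun π x => (hhat.isOrthoIntegrand S).norm_projSum_le (S.isProjFamily 𝔥) _ x)
        (fun z => (hHt T z).comp hshift) (fun z => (hGt T z).comp hshift)
      refine QStop.StrongLim.unique (hWt (T + t)) fun z => (h1 z).congr' ?_
      filter_upwards [QStop.eventually_mem_partition (T := (t : ℝ≥0∞))
        (U := ((T + t : ℝ≥0) : ℝ≥0∞)) (by simp)] with π hπ
      rw [QStop.projSum_addTime hS_zero (fun s => hV_cocycle s t) hπ]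
    -- The horizon `T + t` is cofinal as `T → ∞`, so the limit is unchanged; the bound `hHb` then
    -- permits the limit of the product `Ht T ∘L Gt T`.
    have h2 : QStop.StrongLim atTop (fun T : ℝ≥0 => Wt (T + t)) W := fun z =>
      (hW z).comp (tendsto_atTop_mono (fun _ => le_self_add) tendsto_id)
    have h3 := QStop.StrongLim.comp (M := 1) hHb hH hG
    simp only [hfact] at h2
    exact QStop.StrongLim.unique h2 h3
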